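/- Let $\mathbb P^1=\mathbb P^1_{\mathbb C}$, let $n_1,n_2\in\mathbb Z$ with $-2>n_1>n_2$, let $E=\mathcal O(n_1)\oplus\mathcal O(n_2)$, and put $l_i=-2-n_i$, $d=l_2-l_1$. Denote by $\mathbb C[X_0,X_1]_l$ the space of binary forms of degree $l$, and for $Q\in\mathbb C[X_0,X_1]_d$ let $m_Q:\mathbb C[X_0,X_1]_{l_1}\to\mathbb C[X_0,X_1]_{l_2}$ be the multiplication by $Q$ and ${}^t m_Q$ its transpose. Let $$G=\left\{\begin{pmatrix}u_1&Q\\0&u_2\end{pmatrix}\ \middle|\ u_1,u_2\in\mathbb C^*,\ Q\in\mathbb C[X_0,X_1]_d\right\},\qquad G_0=\{u_1=1\}\subset G,$$ act on $\mathbb C[X_0,X_1]_{l_1}^*\oplus\mathbb C[X_0,X_1]_{l_2}^*$ by $$\begin{pmatrix}u_1&Q\\0&u_2\end{pmatrix}\begin{pmatrix}\Phi_1\\\Phi_2\end{pmatrix}=\begin{pmatrix}u_1\Phi_1+{}^t m_Q(\Phi_2)\\u_2\Phi_2\end{pmatrix}.$$ A holomorphic affine bundle $A$ of rank $2$ on $\mathbb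 P^1$ is a holomorphic bundle of affine spaces with fibre $\mathbb C^2$ and structure group $\mathrm{Aff}(2,\mathbb C)$; its linearisation $L(A)$ is the holomorphic vector bundle of the translations of its fibres, and its invariant $h_A\in H^1(\mathbb P^1,L(A))$ is the class of the Čech cocycle $(s_j-s_i)$ for local holomorphic sections $s_i$ of $A$. For an unstable rank $2$ bundle $F$ let $D_F\subset F$ be its maximal destabilising line subbundle (the line subbundle of largest degree), let $H^1(F)_0\subset H^1(\mathbb P^1,F)$ be the set of classes with non-zero image in $H^1(\mathbb P^1,F/D_F)$, and let $\mathrm{Aut}(F)_0\subset\mathrm{Aut}(F)$ be the subgroup of automorphisms inducing the identity on $D_F$. If $L(A)$ is unstable, $A$ is called non-degenerate if $h_A\in H^1(L(A))_0$; for $x_0\in\mathbb P^1$, an $x_0$-framing of $A$ is a linear isomorphism $\varepsilon:\mathbb C\to D_{L(A),x_0}$, and an isomorphism $(A,\varepsilon)\to(A',\varepsilon')$ of framed bundles is an isomorphism $\psi:A\to A'$ with $L(\psi)\circ\varepsilon=\varepsilon'$. Then there are a linear isomorphism $\kappa:H^1(\mathbb P^1,E)\to\mathbb C[X_0,X_1]_{l_1}^*\oplus\mathbb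 C[X_0,X_1]_{l_2}^*$ (a homeomorphism for the usual topologies of finite dimensional spaces) and a group isomorphism $a:\mathrm{Aut}(E)\to G$, which sends an automorphism to the matrix describing it, such that $\kappa(\varphi\cdot h)=a(\varphi)\cdot\kappa(h)$, such that $\kappa$ maps $H^1(E)_0$ onto $\mathbb C[X_0,X_1]_{l_1}^*\oplus(\mathbb C[X_0,X_1]_{l_2}^*\setminus\{0\})$ and $a$ maps $\mathrm{Aut}(E)_0$ onto $G_0$, and such that the following holds. 1. The map $[A]\mapsto[H^1(f)(h_A)]$, where $f:L(A)\to E$ is any isomorphism, is a well-defined bijection from the set of isomorphism classes of affine bundles $A$ (respectively of non-degenerate affine bundles $A$) with $L(A)\simeq E$ to $H^1(\mathbb P^1,E)/\mathrm{Aut}(E)$ (respectively $H^1(E)_0/\mathrm{Aut}(E)$). For the topology transported by this bijection, $\kappa$ induces a homeomorphism from this moduli space to $$\big(\mathbb C[X_0,X_1]_{l_1}^*\oplus\mathbb C[X_0,X_1]_{l_2}^*\big)/G,\quad\text{respectively}\quad \big(\mathbb C[X_0,X_1]_{l_1}^*\oplus(\mathbb C[X_0,X_1]_{l_2}^*\setminus\{0\})\big)/G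 .$$ 2. Let $x_0\in\mathbb P^1$ and let $\varepsilon_0:\mathbb C\to D_{E,x_0}$ be a linear isomorphism. The map $[(A,\varepsilon)]\mapsto[H^1(f)(h_A)]$, where $f:L(A)\to E$ is any isomorphism with $f\circ\varepsilon=\varepsilon_0$ (such $f$ exist), is a well-defined bijection from the set of isomorphism classes of $x_0$-framed affine bundles (respectively $x_0$-framed non-degenerate affine bundles) with $L(A)\simeq E$ to $H^1(\mathbb P^1,E)/\mathrm{Aut}(E)_0$ (respectively $H^1(E)_0/\mathrm{Aut}(E)_0$). For the topology transported by this bijection, $\kappa$ induces a homeomorphism from this moduli space to $$\big(\mathbb C[X_0,X_1]_{l_1}^*\oplus\mathbb C[X_0,X_1]_{l_2}^*\big)/G_0,\quad\text{respectively}\quad \big(\mathbb C[X_0,X_1]_{l_1}^*\oplus(\mathbb C[X_0,X_1]_{l_2}^*\setminus\{0\})\big)/G_0 .$$ All quotients carry the quotient topology. -/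

import Mathlib

open scoped LinearAlgebra.Projectivization
open TopologicalSpace (Opens)

noncomputable section

namespace AffineP1

/-! ## The complex projective line -/

/-- The complex projective line, as the set of lines of `ℂ²`. -/
abbrev P1 : Type := ℙ ℂ (Fin 2 → ℂ)

/-- The vector `(1, z)` (for `i = 0`), respectively `(z, 1)` (for `i = 1`). -/
def vec (i : Fin 2) (z : ℂ) : Fin 2 → ℂ := ![![1, z], ![z, 1]] i

theorem vec_ne_zero (i : Fin 2) (z : ℂ) : vec i z ≠ 0 := by
  intro h
  have h0 := congrFun h 0
  have h1 := congrFun h 1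
  fin_cases i <;> simp [vec] at h0 h1

/-- The two standard affine charts `z ↦ [1 : z]` and `z ↦ [z : 1]` of the projective line. -/
def aff (i : Fin 2) (z : ℂ) : P1 := Projectivization.mk ℂ (vec i z) (vec_ne_zero i z)

/-- The quotient topology of `ℂ² \ {0}`. -/
instance : TopologicalSpace P1 :=
  TopologicalSpace.coinduced
    (fun v : {v : Fin 2 → ℂ // v ≠ 0} => Projectivization.mk ℂ v.1 v.2) inferInstance

theorem continuous_aff (i : Fin 2) : Continuous (aff i) := by
  have h1 : Continuous (fun v : {v : Fin 2 → ℂ // v ≠ 0} => Projectivization.mk ℂ v.1 v.2) :=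
    continuous_coinduced_rng
  have h2 : Continuous (fun z : ℂ => (⟨vec i z, vec_ne_zero i z⟩ : {v : Fin 2 → ℂ // v ≠ 0})) := by
    refine Continuous.subtype_mk ?_ _
    refine continuous_pi fun j => ?_
    fin_cases i <;> fin_cases j <;> simp [vec] <;> fun_prop
  exact h1.comp h2

/-- A function with values in a normed space is holomorphic on the open set `U` of the projective
line if it is holomorphic on `U` in both standard charts. Only the values on `U` matter. -/
def HolOn {F : Type} [NormedAddCommGroup F] [NormedSpace ℂ F] (U : Opens P1) (f : P1 → F) : Prop :=
  ∀ i : Fin 2, DifferentiableOn ℂ (fun z => f (aff i z)) (aff i ⁻¹' (U : Set P1))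

section HolOnLemmas

variable {F : Type} [NormedAddCommGroup F] [NormedSpace ℂ F]

theorem HolOn.mono {U V : Opens P1} (hUV : U ≤ V) {f : P1 → F} (hf : HolOn V f) : HolOn U f :=
  fun i => (hf i).mono (Set.preimage_mono hUV)

theorem HolOn.add {U : Opens P1} {f g : P1 → F} (hf : HolOn U f) (hg : HolOn U g) :
    HolOn U (fun x => f x + g x) := fun i => (hf i).add (hg i)

theorem HolOn.sub {U : Opens P1} {f g : P1 → F} (hf : HolOn U f) (hg : HolOn U g) :
    HolOn U (fun x => f x - g x) := fun i => (hf i).sub (hg i)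

theorem HolOn.const_smul {U : Opens P1} {f : P1 → F} (hf : HolOn U f) (k : ℂ) :
    HolOn U (fun x => k • f x) := fun i => (hf i).const_smul k

/-- Differentiability on the preimage of an open set under a chart is a local condition. -/
theorem differentiableOn_chart_of_local (i : Fin 2) {U : Opens P1} {f : ℂ → F}
    (h : ∀ x ∈ U, ∃ V : Opens P1, x ∈ V ∧ ∃ g : ℂ → F,
      DifferentiableOn ℂ g (aff i ⁻¹' (V : Set P1)) ∧ ∀ z, aff i z ∈ V → g z = f z) :
    DifferentiableOn ℂ f (aff i ⁻¹' (U : Set P1)) := by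
  intro z hz
  obtain ⟨V, hzV, g, hg, hgf⟩ := h (aff i z) hz
  have ho : IsOpen (aff i ⁻¹' (V : Set P1)) := V.isOpen.preimage (continuous_aff i)
  have hn : aff i ⁻¹' (V : Set P1) ∈ nhds z := ho.mem_nhds hzV
  have hd : DifferentiableAt ℂ g z := hg.differentiableAt hn
  refine (hd.congr_of_eventuallyEq ?_).differentiableWithinAt
  filter_upwards [hn] with w hw
  exact (hgf w hw).symm

theorem HolOn.of_local {U : Opens P1} {f : P1 → F}
    (h : ∀ x ∈ U, ∃ V : Opens P1, x ∈ V ∧ ∃ g : P1 → F, HolOn V g ∧ ∀ y ∈ V, g y = f y) :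
    HolOn U f := by
  intro i
  refine differentiableOn_chart_of_local i fun x hx => ?_
  obtain ⟨V, hxV, g, hg, hgf⟩ := h x hx
  exact ⟨V, hxV, fun z => g (aff i z), hg i, fun z hz => hgf _ hz⟩

end HolOnLemmas

/-! ## Holomorphic bundles through their fibres and their sheaf of holomorphic sections -/

/-- A family of complex vector spaces `Fib x` over the projective line together with a sheaf
of local sections, the "holomorphic" ones. A section over `U` is represented by
an arbitrary extension to the whole line; by `sec_local` (with `mono`: the sheaf axioms) being
a section over `U` only depends on the values on `U`. Holomorphic vector bundles and their
quotients by subbundles are encoded in this way. -/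
structure SectionSheaf where
  Fib : P1 → Type
  [acg : ∀ x, AddCommGroup (Fib x)]
  [mod : ∀ x, Module ℂ (Fib x)]
  sec : Opens P1 → Submodule ℂ (∀ x, Fib x)
  mono : ∀ {U V : Opens P1}, U ≤ V → sec V ≤ sec U
  sec_local : ∀ (U : Opens P1) (s : ∀ x, Fib x),
    (∀ x ∈ U, ∃ V : Opens P1, x ∈ V ∧ ∃ t ∈ sec V, ∀ y ∈ V, t y = s y) → s ∈ sec U

attribute [instance] SectionSheaf.acg SectionSheaf.mod

namespace SectionSheaf

/-- Fibrewise linear maps which preserve the holomorphic sections (bundle morphisms). -/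
structure Hom (S T : SectionSheaf) where
  app : ∀ x, S.Fib x →ₗ[ℂ] T.Fib x
  map_sec : ∀ (U : Opens P1) (s : ∀ x, S.Fib x), s ∈ S.sec U → (fun x => app x (s x)) ∈ T.sec U

/-- Bundle isomorphisms. -/
@[ext] structure Iso (S T : SectionSheaf) where
  app : ∀ x, S.Fib x ≃ₗ[ℂ] T.Fib x
  map_sec : ∀ (U : Opens P1) (s : ∀ x, S.Fib x),
    (fun x => app x (s x)) ∈ T.sec U ↔ s ∈ S.sec U

/-- The morphism underlying an isomorphism. -/
def Iso.hom {S T : SectionSheaf} (f : S.Iso T) : S.Hom T where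
  app x := (f.app x).toLinearMap
  map_sec U s hs := (f.map_sec U s).2 hs

/-- The automorphism group of a bundle, with composition as multiplication. -/
abbrev Aut (S : SectionSheaf) : Type := S.Iso S

instance (S : SectionSheaf) : Group S.Aut where
  mul f g := ⟨fun x => (g.app x).trans (f.app x),
    fun U s => (f.map_sec U (fun x => g.app x (s x))).trans (g.map_sec U s)⟩
  one := ⟨fun x => LinearEquiv.refl ℂ (S.Fib x), fun _ _ => Iff.rfl⟩
  inv f := ⟨fun x => (f.app x).symm, fun U s => by
    rw [← f.map_sec U (fun x => (f.app x).symm (s x))]; simp⟩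
  mul_assoc _ _ _ := rfl
  one_mul _ := rfl
  mul_one _ := rfl
  inv_mul_cancel f := by
    apply Iso.ext
    funext x
    exact LinearEquiv.self_trans_symm (f.app x)

theorem mul_app {S : SectionSheaf} (f g : S.Aut) (x : P1) (v : S.Fib x) :
    (f * g).app x v = f.app x (g.app x v) := rfl

theorem one_app {S : SectionSheaf} (x : P1) (v : S.Fib x) : (1 : S.Aut).app x v = v := rfl

/-! ### First cohomology

Čech cohomology as the direct limit over the open coverings `(U p)` with `p ∈ U p`, indexed by the
points `p` of the line (every open covering is refined by such a one) and ordered by inclusion.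
Two cochains which agree on a smaller covering are identified because their difference is in `B1`.
-/

/-- Čech 1-cocycles for some point-indexed covering, extended arbitrarily. -/
def Z1 (S : SectionSheaf) : Submodule ℂ (P1 → P1 → ∀ x, S.Fib x) where
  carrier := {c | ∃ U : P1 → Opens P1, (∀ p, p ∈ U p) ∧ (∀ p q, c p q ∈ S.sec (U p ⊓ U q)) ∧
    ∀ p q r x, x ∈ U p → x ∈ U q → x ∈ U r → c p r x = c p q x + c q r x}
  zero_mem' := ⟨fun _ => ⊤, fun _ => trivial, fun _ _ => Submodule.zero_mem _,
    fun p q r x _ _ _ => by simp⟩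
  add_mem' := by
    rintro a b ⟨U, hU, ha, ha'⟩ ⟨V, hV, hb, hb'⟩
    refine ⟨fun p => U p ⊓ V p, fun p => ⟨hU p, hV p⟩, fun p q => ?_, fun p q r x hp hq hr => ?_⟩
    · exact Submodule.add_mem _ (S.mono (inf_le_inf inf_le_left inf_le_left) (ha p q))
        (S.mono (inf_le_inf inf_le_right inf_le_right) (hb p q))
    · simp only [Pi.add_apply, ha' p q r x hp.1 hq.1 hr.1, hb' p q r x hp.2 hq.2 hr.2]
      abel
  smul_mem' := by
    rintro k a ⟨U, hU, ha, ha'⟩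
    refine ⟨U, hU, fun p q => Submodule.smul_mem _ k (ha p q), fun p q r x hp hq hr => ?_⟩
    simp only [Pi.smul_apply, ha' p q r x hp hq hr, smul_add]

/-- Čech 1-coboundaries for some point-indexed covering, extended arbitrarily. -/
def B1 (S : SectionSheaf) : Submodule ℂ (P1 → P1 → ∀ x, S.Fib x) where
  carrier := {c | ∃ U : P1 → Opens P1, (∀ p, p ∈ U p) ∧ ∃ s : P1 → ∀ x, S.Fib x,
    (∀ p, s p ∈ S.sec (U p)) ∧ ∀ p q x, x ∈ U p → x ∈ U q → c p q x = s q x - s p x}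
  zero_mem' := ⟨fun _ => ⊤, fun _ => trivial, 0, fun _ => Submodule.zero_mem _,
    fun p q x _ _ => by simp⟩
  add_mem' := by
    rintro a b ⟨U, hU, s, hs, ha⟩ ⟨V, hV, t, ht, hb⟩
    refine ⟨fun p => U p ⊓ V p, fun p => ⟨hU p, hV p⟩, s + t, fun p => ?_, fun p q x hp hq => ?_⟩
    · exact Submodule.add_mem _ (S.mono inf_le_left (hs p)) (S.mono inf_le_right (ht p))
    · simp only [Pi.add_apply, ha p q x hp.1 hq.1, hb p q x hp.2 hq.2]
      abel
  smul_mem' := by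
    rintro k a ⟨U, hU, s, hs, ha⟩
    refine ⟨U, hU, k • s, fun p => Submodule.smul_mem _ k (hs p), fun p q x hp hq => ?_⟩
    simp only [Pi.smul_apply, ha p q x hp hq, smul_sub]

/-- The first cohomology space of a bundle (of its sheaf of holomorphic sections). -/
def H1 (S : SectionSheaf) : Type := S.Z1 ⧸ S.B1.comap S.Z1.subtype

instance (S : SectionSheaf) : AddCommGroup S.H1 :=
  inferInstanceAs (AddCommGroup (S.Z1 ⧸ S.B1.comap S.Z1.subtype))

instance (S : SectionSheaf) : Module ℂ S.H1 :=
  inferInstanceAs (Module ℂ (S.Z1 ⧸ S.B1.comap S.Z1.subtype))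

/-- The finest vector space topology; on a finite dimensional space this is the usual topology. -/
instance (S : SectionSheaf) : TopologicalSpace S.H1 := moduleTopology ℂ S.H1

/-- The class of a cocycle. -/
def H1.mk (S : SectionSheaf) : S.Z1 →ₗ[ℂ] S.H1 := (S.B1.comap S.Z1.subtype).mkQ

/-- The map induced by a morphism on cocycles. -/
def Hom.mapZ {S T : SectionSheaf} (f : S.Hom T) : S.Z1 →ₗ[ℂ] T.Z1 where
  toFun c := ⟨fun p q x => f.app x (c.1 p q x), by
    obtain ⟨c, U, hU, hc, hc'⟩ := c
    exact ⟨U, hU, fun p q => f.map_sec _ _ (hc p q), fun p q r x hp hq hr => by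
      simp only [hc' p q r x hp hq hr, map_add]⟩⟩
  map_add' a b := by
    apply Subtype.ext
    funext p q x
    exact map_add (f.app x) _ _
  map_smul' k a := by
    apply Subtype.ext
    funext p q x
    exact map_smul (f.app x) k _

/-- The linear map `H¹(f)` induced by a morphism `f`. -/
def Hom.mapH1 {S T : SectionSheaf} (f : S.Hom T) : S.H1 →ₗ[ℂ] T.H1 :=
  Submodule.mapQ _ _ f.mapZ (by
    rintro ⟨c, hc⟩ ⟨U, hU, s, hs, h⟩
    exact ⟨U, hU, fun p x => f.app x (s p x), fun p => f.map_sec _ _ (hs p), fun p q x hp hq => by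
      have h' : c p q x = s q x - s p x := h p q x hp hq
      change f.app x (c p q x) = _
      rw [h', map_sub]⟩)

/-- `Aut(S)` acts on `H¹(S)` by functoriality. -/
instance (S : SectionSheaf) : MulAction S.Aut S.H1 where
  smul f h := f.hom.mapH1 h
  one_smul h := by
    obtain ⟨c, rfl⟩ := Submodule.mkQ_surjective _ h
    rfl
  mul_smul f g h := by
    obtain ⟨c, rfl⟩ := Submodule.mkQ_surjective _ h
    rfl

/-! ### Quotients and direct sums -/

/-- The quotient of a bundle by a family of subspaces of its fibres (a subbundle): its holomorphic
sections are those which locally lift to holomorphic sections, i.e. the sections of the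
quotient sheaf. -/
def quot (S : SectionSheaf) (D : ∀ x, Submodule ℂ (S.Fib x)) : SectionSheaf where
  Fib x := S.Fib x ⧸ D x
  sec U :=
    { carrier := {s | ∀ x ∈ U, ∃ V : Opens P1, x ∈ V ∧ ∃ t ∈ S.sec V,
        ∀ y ∈ V, (D y).mkQ (t y) = s y}
      zero_mem' := fun x _ => ⟨⊤, trivial, 0, Submodule.zero_mem _, fun y _ => by simp⟩
      add_mem' := by
        intro a b ha hb x hx
        obtain ⟨V, hV, t, ht, h⟩ := ha x hx
        obtain ⟨V', hV', t', ht', h'⟩ := hb x hx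
        refine ⟨V ⊓ V', ⟨hV, hV'⟩, t + t', Submodule.add_mem _ (S.mono inf_le_left ht)
          (S.mono inf_le_right ht'), fun y hy => ?_⟩
        rw [Pi.add_apply, Pi.add_apply, map_add, h y hy.1, h' y hy.2]
      smul_mem' := by
        intro k a ha x hx
        obtain ⟨V, hV, t, ht, h⟩ := ha x hx
        refine ⟨V, hV, k • t, Submodule.smul_mem _ k ht, fun y hy => ?_⟩
        rw [Pi.smul_apply, Pi.smul_apply, map_smul, h y hy] }
  mono hUV _ hs x hx := hs x (hUV hx)
  sec_local U s h x hx := by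
    obtain ⟨V, hxV, t, ht, hts⟩ := h x hx
    obtain ⟨W, hxW, r, hr, hrt⟩ := ht x hxV
    exact ⟨V ⊓ W, ⟨hxV, hxW⟩, r, S.mono inf_le_right hr, fun y hy => by
      rw [hrt y hy.2, hts y hy.1]⟩

/-- The canonical epimorphism onto the quotient. -/
def quotHom (S : SectionSheaf) (D : ∀ x, Submodule ℂ (S.Fib x)) : S.Hom (S.quot D) where
  app x := (D x).mkQ
  map_sec U s hs _ hx := ⟨U, hx, s, hs, fun _ _ => rfl⟩

/-- The direct sum of two bundles. -/
def prod (S T : SectionSheaf) : SectionSheaf where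
  Fib x := S.Fib x × T.Fib x
  sec U :=
    { carrier := {s | (fun x => (s x).1) ∈ S.sec U ∧ (fun x => (s x).2) ∈ T.sec U}
      zero_mem' := ⟨Submodule.zero_mem _, Submodule.zero_mem _⟩
      add_mem' := fun ha hb => ⟨Submodule.add_mem _ ha.1 hb.1, Submodule.add_mem _ ha.2 hb.2⟩
      smul_mem' := fun k _ ha => ⟨Submodule.smul_mem _ k ha.1, Submodule.smul_mem _ k ha.2⟩ }
  mono hUV _ hs := ⟨S.mono hUV hs.1, T.mono hUV hs.2⟩
  sec_local U s h := by
    refine ⟨S.sec_local U _ fun x hx => ?_, T.sec_local U _ fun x hx => ?_⟩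
    · obtain ⟨V, hxV, t, ht, hts⟩ := h x hx
      exact ⟨V, hxV, _, ht.1, fun y hy => by rw [hts y hy]⟩
    · obtain ⟨V, hxV, t, ht, hts⟩ := h x hx
      exact ⟨V, hxV, _, ht.2, fun y hy => by rw [hts y hy]⟩

end SectionSheaf

/-! ## The line bundles `𝒪(n)` -/

/-- The line `x ⊂ ℂ²` without the origin. -/
def Punctured (x : P1) : Type :=
  {v : Fin 2 → ℂ // ∃ h : v ≠ 0, Projectivization.mk ℂ v h = x}

/-- The fibre of `𝒪(n)` at `x`: functions on the punctured line `x \ {0}` which are homogeneous of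
degree `n`; for `n = 1` this is the dual of the tautological line `x`. -/
def lineFibre (n : ℤ) (x : P1) : Submodule ℂ (Punctured x → ℂ) where
  carrier := {f | ∀ (c : ℂ) (v w : Punctured x), w.1 = c • v.1 → f w = c ^ n * f v}
  zero_mem' := fun c v w _ => by simp
  add_mem' := fun ha hb c v w h => by
    simp only [Pi.add_apply, ha c v w h, hb c v w h, mul_add]
  smul_mem' := fun k a ha c v w h => by
    simp only [Pi.smul_apply, ha c v w h, smul_eq_mul]
    ring

/-- The vector `(1, z)`, respectively `(z, 1)`, as a point of the line which it spans. -/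
def affPoint (i : Fin 2) (z : ℂ) : Punctured (aff i z) := ⟨vec i z, vec_ne_zero i z, rfl⟩

/-- The line bundle `𝒪(n)`. A section is a function on a cone of `ℂ² \ {0}` which is homogeneous
of degree `n`; it is holomorphic if the functions `z ↦ s(1, z)` and `z ↦ s(z, 1)` are. -/
def lineBundle (n : ℤ) : SectionSheaf where
  Fib x := lineFibre n x
  sec U :=
    { carrier := {s | ∀ i : Fin 2, DifferentiableOn ℂ (fun z => (s (aff i z)).1 (affPoint i z))
        (aff i ⁻¹' (U : Set P1))}
      zero_mem' := fun _ => differentiableOn_const 0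
      add_mem' := fun ha hb i => (ha i).add (hb i)
      smul_mem' := fun k _ ha i => (ha i).const_smul k }
  mono hUV _ hs i := (hs i).mono (Set.preimage_mono hUV)
  sec_local U s h i := by
    refine differentiableOn_chart_of_local i fun x hx => ?_
    obtain ⟨V, hxV, t, ht, hts⟩ := h x hx
    exact ⟨V, hxV, _, ht i, fun z hz => by rw [hts _ hz]⟩

/-- The rank 2 bundle `𝒪(n₁) ⊕ 𝒪(n₂)`. -/
def splitBundle (n₁ n₂ : ℤ) : SectionSheaf := (lineBundle n₁).prod (lineBundle n₂)

/-- First component of a vector of the fibre of `𝒪(n₁) ⊕ 𝒪(n₂)`, as a homogeneous function. -/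
def comp₁ {n₁ n₂ : ℤ} {x : P1} (s : (splitBundle n₁ n₂).Fib x) : Punctured x → ℂ :=
  (show lineFibre n₁ x × lineFibre n₂ x from s).1.1

/-- Second component of a vector of the fibre of `𝒪(n₁) ⊕ 𝒪(n₂)`, as a homogeneous function. -/
def comp₂ {n₁ n₂ : ℤ} {x : P1} (s : (splitBundle n₁ n₂).Fib x) : Punctured x → ℂ :=
  (show lineFibre n₁ x × lineFibre n₂ x from s).2.1

/-! ## The maximal destabilising line subbundle -/

/-- `D` is a holomorphic line subbundle of degree `m`: the image of a fibrewise injective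
holomorphic bundle map from `𝒪(m)`, the line bundle of degree `m`. -/
def IsLineSubbundle (S : SectionSheaf) (m : ℤ) (D : ∀ x, Submodule ℂ (S.Fib x)) : Prop :=
  ∃ i : (lineBundle m).Hom S, ∀ x, Function.Injective (i.app x) ∧ LinearMap.range (i.app x) = D x

/-- `D` is a line subbundle whose degree is larger than that of every other line subbundle. A
rank 2 bundle has such a `D` if and only if it is unstable, and then `D` is
its maximal destabilising line subbundle. -/
def IsMaxDestab (S : SectionSheaf) (D : ∀ x, Submodule ℂ (S.Fib x)) : Prop :=
  ∃ m : ℤ, IsLineSubbundle S m D ∧ ∀ m' D', IsLineSubbundle S m' D' → D' ≠ D → m' < m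

/-- The fibre at `x` of the maximal destabilising line subbundle of an unstable rank 2 bundle (the
supremum is over the set with this single element). -/
def maxDestab (S : SectionSheaf) (x : P1) : Submodule ℂ (S.Fib x) :=
  ⨆ D ∈ {D | IsMaxDestab S D}, D x

/-- `H¹(S)₀`: the classes with non-zero image in the first cohomology of the quotient of `S`
by its maximal destabilising line subbundle. -/
def H1₀ (S : SectionSheaf) : Set S.H1 := {h | (S.quotHom (maxDestab S)).mapH1 h ≠ 0}

/-- `Aut(S)₀`: the automorphisms inducing the identity on the maximal destabilising
line subbundle. -/
def Aut₀ (S : SectionSheaf) : Subgroup S.Aut where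
  carrier := {f | ∀ x, ∀ v ∈ maxDestab S x, f.app x v = v}
  mul_mem' := by
    intro f g hf hg x v hv
    rw [SectionSheaf.mul_app, hg x v hv, hf x v hv]
  one_mem' := fun x v _ => SectionSheaf.one_app x v
  inv_mem' := by
    intro f hf x v hv
    change (f.app x).symm v = v
    rw [LinearEquiv.symm_apply_eq, hf x v hv]

/-! ## Holomorphic affine bundles -/

/-- A local trivialisation over the open set `base` of a family of affine spaces, with
standard fibre `ℂʳ`. Only the maps `map x` with `x ∈ base` matter. -/
structure AffTriv (r : ℕ) (Lin Fib : P1 → Type) [∀ x, AddCommGroup (Lin x)]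
    [∀ x, Module ℂ (Lin x)] [∀ x, AddTorsor (Lin x) (Fib x)] where
  base : Opens P1
  map : ∀ x, Fib x ≃ᵃ[ℂ] (Fin r → ℂ)

/-- The comparison map between two local trivialisations is a holomorphic map to the
group of affine transformations of `ℂʳ`. -/
def AffTriv.Compatible {r : ℕ} {Lin Fib : P1 → Type} [∀ x, AddCommGroup (Lin x)]
    [∀ x, Module ℂ (Lin x)] [∀ x, AddTorsor (Lin x) (Fib x)] (τ θ : AffTriv r Lin Fib) : Prop :=
  ∀ w : Fin r → ℂ, HolOn (τ.base ⊓ θ.base) (fun x => τ.map x ((θ.map x).symm w))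

/-- A holomorphic affine bundle of rank `r` on the projective line: fibres `Fib x` which are affine
spaces with spaces of translations `Lin x`, and a maximal atlas of local trivialisations with
holomorphic affine comparison maps. (The complex manifold structure of the total space is the one
for which the trivialisations are biholomorphic.) -/
structure AffineBundle (r : ℕ) where
  Fib : P1 → Type
  Lin : P1 → Type
  [acg : ∀ x, AddCommGroup (Lin x)]
  [mod : ∀ x, Module ℂ (Lin x)]
  [tor : ∀ x, AddTorsor (Lin x) (Fib x)]
  atlas : Set (AffTriv r Lin Fib)
  cover : ∀ x, ∃ τ ∈ atlas, x ∈ τ.base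
  compat : ∀ τ ∈ atlas, ∀ θ ∈ atlas, τ.Compatible θ
  maximal : ∀ τ, (∀ θ ∈ atlas, τ.Compatible θ ∧ θ.Compatible τ) → τ ∈ atlas

attribute [instance] AffineBundle.acg AffineBundle.mod AffineBundle.tor

namespace AffineBundle

variable {r : ℕ}

/-- Holomorphic sections over `U` of an affine bundle. -/
def IsSec (A : AffineBundle r) (U : Opens P1) (s : ∀ x, A.Fib x) : Prop :=
  ∀ τ ∈ A.atlas, HolOn (U ⊓ τ.base) (fun x => τ.map x (s x))

/-- The linearisation `L(A)`, trivialised by the linear parts of the trivialisations of `A`. -/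
def linearisation (A : AffineBundle r) : SectionSheaf where
  Fib := A.Lin
  sec U :=
    { carrier := {s | ∀ τ ∈ A.atlas, HolOn (U ⊓ τ.base) (fun x => (τ.map x).linear (s x))}
      zero_mem' := fun τ _ i => by simp
      add_mem' := fun ha hb τ hτ => by
        simpa only [Pi.add_apply, map_add] using (ha τ hτ).add (hb τ hτ)
      smul_mem' := fun k a ha τ hτ => by
        simpa only [Pi.smul_apply, map_smul] using (ha τ hτ).const_smul k }
  mono hUV _ hs τ hτ := (hs τ hτ).mono (inf_le_inf_right _ hUV)
  sec_local U s h τ hτ := by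
    refine HolOn.of_local fun x hx => ?_
    obtain ⟨V, hxV, t, ht, hts⟩ := h x hx.1
    exact ⟨V ⊓ τ.base, ⟨hxV, hx.2⟩, _, ht τ hτ, fun y hy => by rw [hts y hy.1]⟩

/-- A chosen local trivialisation around the point `p`. -/
def trivAt (A : AffineBundle r) (p : P1) : AffTriv r A.Lin A.Fib := (A.cover p).choose

theorem trivAt_mem (A : AffineBundle r) (p : P1) : A.trivAt p ∈ A.atlas :=
  (A.cover p).choose_spec.1

theorem mem_trivAt (A : AffineBundle r) (p : P1) : p ∈ (A.trivAt p).base :=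
  (A.cover p).choose_spec.2

/-- A chosen holomorphic section around the point `p`. -/
def localSec (A : AffineBundle r) (p x : P1) : A.Fib x := ((A.trivAt p).map x).symm 0

theorem localSec_isSec (A : AffineBundle r) (p : P1) :
    A.IsSec (A.trivAt p).base (A.localSec p) := by
  intro τ hτ
  have h := A.compat τ hτ _ (A.trivAt_mem p) 0
  rwa [inf_comm] at h

/-- The differences of holomorphic local sections form a cocycle of `L(A)`. -/
def cocycle (A : AffineBundle r) : A.linearisation.Z1 :=
  ⟨fun p q x => (A.localSec q x -ᵥ A.localSec p x : A.Lin x),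
    fun p => (A.trivAt p).base, A.mem_trivAt, by
      intro p q τ hτ
      have hp := (A.localSec_isSec p τ hτ).mono
        (inf_le_inf_right τ.base (inf_le_left : (A.trivAt p).base ⊓ (A.trivAt q).base ≤ _))
      have hq := (A.localSec_isSec q τ hτ).mono
        (inf_le_inf_right τ.base (inf_le_right : (A.trivAt p).base ⊓ (A.trivAt q).base ≤ _))
      have h := hq.sub hp
      have e : (fun x => τ.map x (A.localSec q x) - τ.map x (A.localSec p x)) =
          fun x => (τ.map x).linear (A.localSec q x -ᵥ A.localSec p x) := by
        funext x
        exact ((τ.map x).toAffineMap.linearMap_vsub _ _).symm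
      rwa [e] at h, by
      intro p q s x _ _ _
      change A.localSec s x -ᵥ A.localSec p x =
        (A.localSec q x -ᵥ A.localSec p x) + (A.localSec s x -ᵥ A.localSec q x)
      rw [add_comm, vsub_add_vsub_cancel]⟩

/-- The cohomology invariant `h_A ∈ H¹(L(A))`: the class of the differences of local holomorphic
sections of `A`. Local sections of `A` are the local lifts of `1 ∈ H⁰(𝒪)` in the extension of
`𝒪` by `L(A)` associated with `A`, so this is the image of `1` by the connecting morphism. -/
def invariant (A : AffineBundle r) : A.linearisation.H1 := SectionSheaf.H1.mk _ A.cocycle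

/-- Isomorphisms of affine bundles: fibrewise affine isomorphisms which are holomorphic in both
directions. -/
structure Iso (A B : AffineBundle r) where
  app : ∀ x, A.Fib x ≃ᵃ[ℂ] B.Fib x
  map_sec : ∀ (U : Opens P1) (s : ∀ x, A.Fib x), B.IsSec U (fun x => app x (s x)) ↔ A.IsSec U s

def Iso.refl (A : AffineBundle r) : A.Iso A := ⟨fun x => AffineEquiv.refl ℂ (A.Fib x),
  fun _ _ => Iff.rfl⟩

def Iso.symm {A B : AffineBundle r} (f : A.Iso B) : B.Iso A := ⟨fun x => (f.app x).symm,
  fun U s => by rw [← f.map_sec U (fun x => (f.app x).symm (s x))]; simp⟩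

def Iso.trans {A B C : AffineBundle r} (f : A.Iso B) (g : B.Iso C) : A.Iso C :=
  ⟨fun x => (f.app x).trans (g.app x),
    fun U s => (g.map_sec U (fun x => f.app x (s x))).trans (f.map_sec U s)⟩

/-- `L(A) ≃ E`. -/
def HasLinearisation (E : SectionSheaf) (A : AffineBundle r) : Prop :=
  Nonempty (A.linearisation.Iso E)

/-- Non-degeneracy of a rank 2 affine bundle with unstable linearisation. -/
def NonDegenerate (A : AffineBundle 2) : Prop := A.invariant ∈ H1₀ A.linearisation

end AffineBundle

/-- A rank 2 affine bundle with an `x₀`-framing: a linear isomorphism of `ℂ` with the fibre at `x₀`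
of the maximal destabilising line subbundle of the linearisation. -/
structure FramedAffineBundle (x₀ : P1) where
  bundle : AffineBundle 2
  framing : ℂ ≃ₗ[ℂ] maxDestab bundle.linearisation x₀

/-- Isomorphisms of framed affine bundles: their linear part is compatible with the framings. -/
def FramedAffineBundle.IsIso {x₀ : P1} {A B : FramedAffineBundle x₀}
    (f : A.bundle.Iso B.bundle) : Prop :=
  ∀ c : ℂ, (f.app x₀).linear (A.framing c).1 = (B.framing c).1

/-! ## Moduli sets and quotient spaces -/

/-- Isomorphism of rank 2 affine bundles with the property `P`. -/
def isoSetoid (P : AffineBundle 2 → Prop) : Setoid {A : AffineBundle 2 // P A} where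
  r A B := Nonempty (A.1.Iso B.1)
  iseqv := ⟨fun A => ⟨AffineBundle.Iso.refl A.1⟩, fun ⟨f⟩ => ⟨f.symm⟩,
    fun ⟨f⟩ ⟨g⟩ => ⟨f.trans g⟩⟩

/-- The set of isomorphism classes of rank 2 affine bundles with the property `P`. -/
def Moduli (P : AffineBundle 2 → Prop) : Type 1 := Quotient (isoSetoid P)

/-- The isomorphism class of an affine bundle. -/
def Moduli.mk {P : AffineBundle 2 → Prop} (A : AffineBundle 2) (hA : P A) : Moduli P :=
  Quotient.mk (isoSetoid P) ⟨A, hA⟩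

/-- Isomorphism of framed affine bundles whose underlying affine bundle has the property `P`. -/
def framedIsoSetoid (x₀ : P1) (P : AffineBundle 2 → Prop) :
    Setoid {A : FramedAffineBundle x₀ // P A.bundle} where
  r A B := ∃ f : A.1.bundle.Iso B.1.bundle, FramedAffineBundle.IsIso f
  iseqv := by
    refine ⟨fun A => ⟨AffineBundle.Iso.refl A.1.bundle, fun c => rfl⟩, ?_, ?_⟩
    · rintro A B ⟨f, hf⟩
      refine ⟨f.symm, fun c => ?_⟩
      exact ((f.app x₀).linear.symm_apply_eq).2 (hf c).symm
    · rintro A B C ⟨f, hf⟩ ⟨g, hg⟩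
      refine ⟨f.trans g, fun c => ?_⟩
      change (g.app x₀).linear ((f.app x₀).linear _) = _
      rw [hf c, hg c]

/-- The set of isomorphism classes of `x₀`-framed affine bundles (with underlying affine bundle of
property `P`). -/
def FramedModuli (x₀ : P1) (P : AffineBundle 2 → Prop) : Type 1 :=
  Quotient (framedIsoSetoid x₀ P)

/-- The isomorphism class of a framed affine bundle. -/
def FramedModuli.mk {x₀ : P1} {P : AffineBundle 2 → Prop} (A : FramedAffineBundle x₀)
    (hA : P A.bundle) : FramedModuli x₀ P := Quotient.mk (framedIsoSetoid x₀ P) ⟨A, hA⟩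

/-- For a `Γ`-invariant subset `S` of `X`, the quotient `S / Γ`. -/
def OrbitSpace (Γ : Type) {X : Type} [Group Γ] [MulAction Γ X] (S : Set X) : Type :=
  Quotient ((MulAction.orbitRel Γ X).comap (Subtype.val : S → X))

/-- The quotient topology. -/
instance (Γ : Type) {X : Type} [Group Γ] [MulAction Γ X] [TopologicalSpace X] (S : Set X) :
    TopologicalSpace (OrbitSpace Γ S) :=
  inferInstanceAs (TopologicalSpace (Quotient ((MulAction.orbitRel Γ X).comap
    (Subtype.val : S → X))))

/-- The orbit of a point of `S`. -/
def OrbitSpace.mk (Γ : Type) {X : Type} [Group Γ] [MulAction Γ X] {S : Set X} (x : X)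
    (hx : x ∈ S) : OrbitSpace Γ S :=
  Quotient.mk ((MulAction.orbitRel Γ X).comap (Subtype.val : S → X)) ⟨x, hx⟩

/-- A moduli set `M`, as a topological space: it is endowed with the topology which is induced by
its identification `b` with an orbit space `Y`. -/
def ModuliSpace {M : Type 1} {Y : Type} (_b : M ≃ Y) : Type 1 := M

instance {M : Type 1} {Y : Type} [TopologicalSpace Y] (b : M ≃ Y) :
    TopologicalSpace (ModuliSpace b) := TopologicalSpace.induced b inferInstance

/-- `b` is the classifying map `[A] ↦ [H¹(f)(h_A)]`, where `f : L(A) → E` is any isomorphism. -/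
def IsClassifyingMap (E : SectionSheaf) {P : AffineBundle 2 → Prop} {S : Set E.H1}
    (b : Moduli P ≃ OrbitSpace E.Aut S) : Prop :=
  ∀ (A : AffineBundle 2) (hA : P A) (f : A.linearisation.Iso E),
    ∃ h : f.hom.mapH1 A.invariant ∈ S, b (Moduli.mk A hA) = OrbitSpace.mk E.Aut _ h

/-- `f ∘ ε = ε₀` for the framing `ε` of `A`. -/
def MatchesFraming {E : SectionSheaf} {x₀ : P1} (ε₀ : ℂ ≃ₗ[ℂ] maxDestab E x₀)
    (A : FramedAffineBundle x₀) (f : A.bundle.linearisation.Iso E) : Prop :=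
  ∀ c : ℂ, f.app x₀ (A.framing c) = ε₀ c

/-- `b` is the classifying map `[(A, ε)] ↦ [H¹(f)(h_A)]`, where `f : L(A) → E` is any isomorphism
with `f ∘ ε = ε₀`; moreover such isomorphisms exist. -/
def IsFramedClassifyingMap (E : SectionSheaf) {x₀ : P1} (ε₀ : ℂ ≃ₗ[ℂ] maxDestab E x₀)
    {P : AffineBundle 2 → Prop} {S : Set E.H1}
    (b : FramedModuli x₀ P ≃ OrbitSpace (Aut₀ E) S) : Prop :=
  ∀ (A : FramedAffineBundle x₀) (hA : P A.bundle),
    (∃ f : A.bundle.linearisation.Iso E, MatchesFraming ε₀ A f) ∧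
    ∀ f : A.bundle.linearisation.Iso E, MatchesFraming ε₀ A f →
      ∃ h : f.hom.mapH1 A.bundle.invariant ∈ S,
        b (FramedModuli.mk A hA) = OrbitSpace.mk (Aut₀ E) _ h

/-- The homeomorphism `Φ` from a moduli space to an orbit space `S' / Γ'` is induced by the map `κ`:
if `m` is identified by `b` with the orbit of `x`, then `Φ m` is the orbit of `κ x`. -/
def InducedBy {M : Type 1} {Γ Γ' X X' : Type} [Group Γ] [MulAction Γ X] [TopologicalSpace X]
    [Group Γ'] [MulAction Γ' X'] [TopologicalSpace X'] {S : Set X} {S' : Set X'}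
    (b : M ≃ OrbitSpace Γ S) (κ : X → X') (Φ : ModuliSpace b ≃ₜ OrbitSpace Γ' S') : Prop :=
  ∀ (m : M) (x : X) (hx : x ∈ S), b m = OrbitSpace.mk Γ x hx →
    ∃ h : κ x ∈ S', Φ m = OrbitSpace.mk Γ' (κ x) h

/-! ## Binary forms and the groups `G`, `G₀` -/

/-- `ℂ[X₀, X₁]_l`. -/
abbrev Forms (l : ℕ) : Type := MvPolynomial.homogeneousSubmodule (Fin 2) ℂ l

/-- The multiplication map `m_Q : ℂ[X₀, X₁]_l → ℂ[X₀, X₁]_{l+d}`, for `Q ∈ ℂ[X₀, X₁]_d`. -/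
def mulForm {l d : ℕ} (Q : Forms d) : Forms l →ₗ[ℂ] Forms (l + d) where
  toFun P := ⟨P.1 * Q.1, MvPolynomial.IsHomogeneous.mul P.2 Q.2⟩
  map_add' P P' := Subtype.ext (add_mul P.1 P'.1 Q.1)
  map_smul' k P := Subtype.ext (smul_mul_assoc k P.1 Q.1)

/-- `ℂ[X₀, X₁]_{l₁}^* ⊕ ℂ[X₀, X₁]_{l₂}^*`, where `l₁ = l` and `l₂ = l + d`. -/
def DualPairs (l d : ℕ) : Type := Module.Dual ℂ (Forms l) × Module.Dual ℂ (Forms (l + d))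

instance (l d : ℕ) : AddCommGroup (DualPairs l d) :=
  inferInstanceAs (AddCommGroup (Module.Dual ℂ (Forms l) × Module.Dual ℂ (Forms (l + d))))

instance (l d : ℕ) : Module ℂ (DualPairs l d) :=
  inferInstanceAs (Module ℂ (Module.Dual ℂ (Forms l) × Module.Dual ℂ (Forms (l + d))))

/-- The usual topology of a finite dimensional complex vector space. -/
instance (l d : ℕ) : TopologicalSpace (DualPairs l d) := moduleTopology ℂ (DualPairs l d)

/-- The group `G` of the matrices `(u₁, Q; 0, u₂)` with `u₁, u₂ ∈ ℂ*`, `Q ∈ ℂ[X₀, X₁]_d`. -/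
@[ext] structure G (d : ℕ) where
  u₁ : ℂˣ
  u₂ : ℂˣ
  Q : Forms d

/-- The matrix of an element of `G`. -/
def G.toMatrix {d : ℕ} (g : G d) : Matrix (Fin 2) (Fin 2) (MvPolynomial (Fin 2) ℂ) :=
  !![MvPolynomial.C (g.u₁ : ℂ), g.Q.1; 0, MvPolynomial.C (g.u₂ : ℂ)]

/-- The group structure is matrix multiplication. -/
instance (d : ℕ) : Group (G d) where
  mul g g' := ⟨g.u₁ * g'.u₁, g.u₂ * g'.u₂, (g.u₁ : ℂ) • g'.Q + (g'.u₂ : ℂ) • g.Q⟩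
  one := ⟨1, 1, 0⟩
  inv g := ⟨g.u₁⁻¹, g.u₂⁻¹, -(((g.u₁⁻¹ : ℂˣ) : ℂ) * ((g.u₂⁻¹ : ℂˣ) : ℂ)) • g.Q⟩
  mul_assoc a b c := by
    refine G.ext (mul_assoc _ _ _) (mul_assoc _ _ _) ?_
    change ((a.u₁ * b.u₁ : ℂˣ) : ℂ) • c.Q + (c.u₂ : ℂ) • ((a.u₁ : ℂ) • b.Q + (b.u₂ : ℂ) • a.Q) =
      (a.u₁ : ℂ) • ((b.u₁ : ℂ) • c.Q + (c.u₂ : ℂ) • b.Q) + ((b.u₂ * c.u₂ : ℂˣ) : ℂ) • a.Q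
    push_cast
    module
  one_mul a := by
    refine G.ext (one_mul _) (one_mul _) ?_
    change ((1 : ℂˣ) : ℂ) • a.Q + (a.u₂ : ℂ) • (0 : Forms d) = a.Q
    simp
  mul_one a := by
    refine G.ext (mul_one _) (mul_one _) ?_
    change (a.u₁ : ℂ) • (0 : Forms d) + ((1 : ℂˣ) : ℂ) • a.Q = a.Q
    simp
  inv_mul_cancel a := by
    refine G.ext (inv_mul_cancel _) (inv_mul_cancel _) ?_
    change ((a.u₁⁻¹ : ℂˣ) : ℂ) • a.Q +
      (a.u₂ : ℂ) • (-(((a.u₁⁻¹ : ℂˣ) : ℂ) * ((a.u₂⁻¹ : ℂˣ) : ℂ)) • a.Q) = 0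
    have h : (a.u₂ : ℂ) * ((a.u₂⁻¹ : ℂˣ) : ℂ) = 1 := by simp
    rw [smul_smul, ← add_smul]
    have h' : ((a.u₁⁻¹ : ℂˣ) : ℂ) + (a.u₂ : ℂ) * -(((a.u₁⁻¹ : ℂˣ) : ℂ) * ((a.u₂⁻¹ : ℂˣ) : ℂ)) = 0 := by
      linear_combination (-((a.u₁⁻¹ : ℂˣ) : ℂ)) * h
    rw [h', zero_smul]

theorem G.toMatrix_mul {d : ℕ} (g g' : G d) : (g * g').toMatrix = g.toMatrix * g'.toMatrix := by
  have h₁ : (g * g').u₁ = g.u₁ * g'.u₁ := rfl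
  have h₂ : (g * g').u₂ = g.u₂ * g'.u₂ := rfl
  have h₃ : (g * g').Q = (g.u₁ : ℂ) • g'.Q + (g'.u₂ : ℂ) • g.Q := rfl
  simp only [G.toMatrix, h₁, h₂, h₃, Matrix.mul_fin_two]
  simp [MvPolynomial.smul_eq_C_mul, mul_comm]

/-- The subgroup `G₀ ⊂ G` defined by `u₁ = 1`. -/
def G₀ (d : ℕ) : Subgroup (G d) where
  carrier := {g | g.u₁ = 1}
  mul_mem' := by
    intro a b ha hb
    change a.u₁ * b.u₁ = 1
    rw [show a.u₁ = 1 from ha, show b.u₁ = 1 from hb, one_mul]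
  one_mem' := rfl
  inv_mem' := by
    intro a ha
    change a.u₁⁻¹ = 1
    rw [show a.u₁ = 1 from ha, inv_one]

/-- The action `(u₁, Q; 0, u₂) • (Φ₁, Φ₂) = (u₁ Φ₁ + ᵗm_Q(Φ₂), u₂ Φ₂)`. -/
instance (l d : ℕ) : MulAction (G d) (DualPairs l d) where
  smul g Φ := ((g.u₁ : ℂ) • Φ.1 + Φ.2 ∘ₗ mulForm g.Q, (g.u₂ : ℂ) • Φ.2)
  one_smul Φ := by
    refine Prod.ext (LinearMap.ext fun P => ?_) (LinearMap.ext fun P => ?_)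
    · change ((1 : ℂˣ) : ℂ) * Φ.1 P + Φ.2 (mulForm (0 : Forms d) P) = Φ.1 P
      have h : mulForm (0 : Forms d) P = 0 := Subtype.ext (mul_zero P.1)
      simp [h]
    · change ((1 : ℂˣ) : ℂ) * Φ.2 P = Φ.2 P
      simp
  mul_smul a b Φ := by
    refine Prod.ext (LinearMap.ext fun P => ?_) (LinearMap.ext fun P => ?_)
    · change ((a.u₁ * b.u₁ : ℂˣ) : ℂ) * Φ.1 P +
          Φ.2 (mulForm ((a.u₁ : ℂ) • b.Q + (b.u₂ : ℂ) • a.Q) P) =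
        (a.u₁ : ℂ) * ((b.u₁ : ℂ) * Φ.1 P + Φ.2 (mulForm b.Q P)) +
          (b.u₂ : ℂ) * Φ.2 (mulForm a.Q P)
      have h : mulForm ((a.u₁ : ℂ) • b.Q + (b.u₂ : ℂ) • a.Q) P =
          (a.u₁ : ℂ) • mulForm b.Q P + (b.u₂ : ℂ) • mulForm a.Q P := by
        apply Subtype.ext
        change P.1 * ((a.u₁ : ℂ) • b.Q.1 + (b.u₂ : ℂ) • a.Q.1) =
          (a.u₁ : ℂ) • (P.1 * b.Q.1) + (b.u₂ : ℂ) • (P.1 * a.Q.1)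
        rw [mul_add, mul_smul_comm, mul_smul_comm]
      rw [h, map_add, map_smul, map_smul, smul_eq_mul, smul_eq_mul]
      push_cast
      ring
    · change ((a.u₂ * b.u₂ : ℂˣ) : ℂ) * Φ.2 P = (a.u₂ : ℂ) * ((b.u₂ : ℂ) * Φ.2 P)
      push_cast
      ring

/-- `ℂ[X₀, X₁]_{l₁}^* ⊕ (ℂ[X₀, X₁]_{l₂}^* \ {0})`. -/
def DualPairs₀ (l d : ℕ) : Set (DualPairs l d) := {Φ | Φ.2 ≠ 0}

/-- The automorphism `φ` of `𝒪(n₁) ⊕ 𝒪(n₂)` is given by the matrix `g = (u₁, Q; 0, u₂)`, where forms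
act by multiplication on homogeneous functions. -/
def IsGivenBy {n₁ n₂ : ℤ} {d : ℕ} (φ : (splitBundle n₁ n₂).Aut) (g : G d) : Prop :=
  ∀ (x : P1) (s : (splitBundle n₁ n₂).Fib x) (v : Punctured x),
    comp₁ (φ.app x s) v = g.u₁ * comp₁ s v + MvPolynomial.eval v.1 g.Q.1 * comp₂ s v ∧
    comp₂ (φ.app x s) v = g.u₂ * comp₂ s v

end AffineP1

end

open scoped LinearAlgebra.Projectivization
open TopologicalSpace (Opens)

noncomputable section

namespace AffineP1

open Set Metric Complex Filter Topology

/-! An affine bundle with linearisation `E` is a torsor under `E`, so classes in `H¹(E)` classify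
such bundles. If an isomorphism of linearisations `f : L(A) → L(B)` sends `h_A` to `h_B`, one can
choose local sections `σ p` of `B` whose differences are the images under `f` of the differences of
the chosen sections `s p` of `A`; then `a ↦ f (a - s p) + σ p` does not depend on `p` and is an
isomorphism with linear part `f` (`exists_iso_of_mapH1_invariant`). Conversely every class is an
invariant: the fibres of `E` are kept and the holomorphic structure is twisted by the cocycle
(`exists_affineBundle`). Hence isomorphism classes are the orbits of `Aut(E)`, the ambiguity in the
choice of `f : L(A) → E`.

A framing reduces this ambiguity. Every isomorphism respects the maximal destabilising subbundles,
and a scalar automorphism of `E` adjusts `f` so that it matches the framings. Two such choices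
differ by an automorphism fixing a non-zero vector of `D_E` at `x₀`. Automorphisms act on `D_E` by a
constant scalar, so this one lies in `Aut(E)₀`.

For the split bundle everything is computed in the two charts. A morphism `𝒪(n) → 𝒪(m)` is an entire
function `F` with `F(z) = z^(m-n) G(1/z)`, `G` entire; by Liouville it is zero if `m < n` and a form
of degree `m - n` otherwise. So automorphisms are triangular matrices (`exists_matrixAut`), and a
line subbundle of degree at least `n₁` has zero projection to `𝒪(n₂)`, which identifies `D_E` with
`𝒪(n₁)` (`isMaxDestab_split`).

The cohomology of `𝒪(-2-l)` is determined directly with Čech cocycles. On discs cocycles split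
(`splitsOn_ball`): splittings on small rectangles are glued with Cauchy integrals. The two resulting
splittings, one per chart, differ by a function on an annulus; Laurent and Taylor expansion reduce
it to the principal parts `z⁻¹, …, z^(-l-1)` (`exists_laurentSec`). The residue pairing with forms
of degree `l` kills coboundaries, because the product is a section of `𝒪(-2)`, that is, a
differential form; and it is perfect on principal parts. This is Serre duality, and since `(Q s) P =
s (P Q)` under the integral, it turns multiplication by `Q` into `ᵗm_Q`. The resulting `κ` is linear
and equivariant, so it induces homeomorphisms of all the orbit spaces. -/

/-! ## Complex analysis in the plane -/

/-- Integrals of Cauchy type depend holomorphically on the parameter. -/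
theorem differentiableAt_integral_div {a b : ℝ} {φ α β : ℝ → ℂ} (hφ : ContinuousOn φ (uIcc a b))
    (hα : Continuous α) (hβ : Continuous β) {z₀ : ℂ} (h : ∀ t ∈ uIcc a b, α t - β t * z₀ ≠ 0) :
    DifferentiableAt ℂ (fun z => ∫ t in a..b, φ t / (α t - β t * z)) z₀ := by
  have hK : IsCompact (uIcc a b) := isCompact_uIcc
  -- Compactness gives one disc on which no denominator vanishes, hence a uniform bound for the
  -- derivative. The form `α - β z` covers both kernels `1 / (w - z)` and `1 / (1 - w z)`.
  have hev : ∀ᶠ z in 𝓝 z₀, ∀ t ∈ uIcc a b, α t - β t * z ≠ 0 := by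
    refine hK.eventually_forall_of_forall_eventually fun t ht => ?_
    have hc : Continuous (fun p : ℂ × ℝ => α p.2 - β p.2 * p.1) := by fun_prop
    exact hc.continuousAt.eventually_ne (h t ht)
  obtain ⟨ε, hε, hball⟩ := Metric.nhds_basis_closedBall.eventually_iff.1 hev
  have hcont : ContinuousOn (fun p : ℝ × ℂ => φ p.1 * β p.1 / (α p.1 - β p.1 * p.2) ^ 2)
      (uIcc a b ×ˢ closedBall z₀ ε) := by
    refine ContinuousOn.div ?_ (by fun_prop) ?_
    · exact (hφ.comp continuousOn_fst fun p hp => hp.1).mul (by fun_prop)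
    · intro p hp
      exact pow_ne_zero 2 (hball hp.2 p.1 hp.1)
  obtain ⟨C, hC⟩ := (hK.prod (isCompact_closedBall z₀ ε)).exists_bound_of_continuousOn hcont
  have hFc : ∀ z ∈ closedBall z₀ ε, ContinuousOn (fun t => φ t / (α t - β t * z)) (uIcc a b) := by
    intro z hz
    exact hφ.div (by fun_prop) fun t ht => hball hz t ht
  have hF'c : ContinuousOn (fun t => φ t * β t / (α t - β t * z₀) ^ 2) (uIcc a b) := by
    refine (hφ.mul hβ.continuousOn).div (by fun_prop) fun t ht => pow_ne_zero 2 (h t ht)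
  have hsub : uIoc a b ⊆ uIcc a b := uIoc_subset_uIcc
  refine (intervalIntegral.hasDerivAt_integral_of_dominated_loc_of_deriv_le
    (F := fun z t => φ t / (α t - β t * z)) (F' := fun z t => φ t * β t / (α t - β t * z) ^ 2)
    (bound := fun _ => C) (closedBall_mem_nhds z₀ hε) ?_ ?_ ?_ ?_ ?_ ?_).2.differentiableAt
  · filter_upwards [closedBall_mem_nhds z₀ hε] with z hz
    exact ((hFc z hz).mono hsub).aestronglyMeasurable measurableSet_uIoc
  · exact (hFc z₀ (mem_closedBall_self hε.le)).intervalIntegrable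
  · exact (hF'c.mono hsub).aestronglyMeasurable measurableSet_uIoc
  · exact Eventually.of_forall fun t ht z hz => hC (t, z) ⟨hsub ht, hz⟩
  · exact intervalIntegrable_const
  · refine Eventually.of_forall fun t ht z hz => ?_
    have hne := hball hz t (hsub ht)
    have h1 : HasDerivAt (fun z => α t - β t * z) (-(β t)) z := by
      simpa using ((hasDerivAt_id z).const_mul (β t)).const_sub (α t)
    have h2 := (h1.inv hne).const_mul (φ t)
    refine h2.congr_deriv ?_ |>.congr_of_eventuallyEq (Eventually.of_forall fun w => ?_)
    · simp; ring
    · simp [div_eq_mul_inv]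

/-- The integral over the boundary of the rectangle with corners `a + c i` and `b + d i`. -/
def rectIntegral (f : ℂ → ℂ) (a b c d : ℝ) : ℂ :=
  (∫ x : ℝ in a..b, f (x + c * I)) - (∫ x : ℝ in a..b, f (x + d * I)) +
    I • (∫ y : ℝ in c..d, f (b + y * I)) - I • (∫ y : ℝ in c..d, f (a + y * I))

/-- The principal logarithm of `w - z` is a primitive of `1 / (w - z)` on three sides. The left side
meets the cut, so `log (-(w - z))` is used there; the two primitives differ by `πi` in opposite
directions at the two left corners, and these jumps add up to `2πi`. -/
theorem rectIntegral_inv_sub {a b c d : ℝ} {z : ℂ} (ha : a < z.re) (hb : z.re < b) (hc : c < z.im)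
    (hd : z.im < d) : rectIntegral (fun w => (w - z)⁻¹) a b c d = 2 * Real.pi * I := by
  have hor : ∀ y : ℝ, y ≠ z.im → ∫ x : ℝ in a..b, ((x : ℂ) + y * I - z)⁻¹ =
      log (b + y * I - z) - log (a + y * I - z) := by
    intro y hy
    refine intervalIntegral.integral_eq_sub_of_hasDerivAt
      (f := fun x : ℝ => log ((x : ℂ) + y * I - z)) (fun x _ => ?_) ?_
    · have h1 : HasDerivAt (fun x : ℂ => x + y * I - z) 1 (x : ℂ) := by
        simpa using ((hasDerivAt_id (x : ℂ)).add_const (y * I)).sub_const z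
      have h2 : (x : ℂ) + y * I - z ∈ slitPlane := by
        rw [mem_slitPlane_iff]; right; simp; intro h; exact hy (by linarith)
      simpa using (h1.clog h2).comp_ofReal
    · refine ContinuousOn.intervalIntegrable (ContinuousOn.inv₀ (by fun_prop) fun x _ h => hy ?_)
      have := congrArg Complex.im h
      simp at this; linarith
  have hright : ∫ y : ℝ in c..d, ((b : ℂ) + y * I - z)⁻¹ =
      (log (b + d * I - z) - log (b + c * I - z)) / I := by
    rw [sub_div]
    refine intervalIntegral.integral_eq_sub_of_hasDerivAt
      (f := fun y : ℝ => log ((b : ℂ) + y * I - z) / I) (fun y _ => ?_) ?_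
    · have h1 : HasDerivAt (fun y : ℂ => b + y * I - z) I (y : ℂ) := by
        simpa using (((hasDerivAt_id (y : ℂ)).mul_const I).const_add (b : ℂ)).sub_const z
      have h2 : (b : ℂ) + y * I - z ∈ slitPlane := by
        rw [mem_slitPlane_iff]; left; simp; linarith
      have h3 := ((h1.clog h2).div_const I).comp_ofReal
      refine h3.congr_deriv ?_
      field_simp
    · refine ContinuousOn.intervalIntegrable (ContinuousOn.inv₀ (by fun_prop) fun x _ h => ?_)
      have := congrArg Complex.re h
      simp at this; linarith
  have hleft : ∫ y : ℝ in c..d, ((a : ℂ) + y * I - z)⁻¹ =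
      (log (-(a + d * I - z)) - log (-(a + c * I - z))) / I := by
    rw [sub_div]
    refine intervalIntegral.integral_eq_sub_of_hasDerivAt
      (f := fun y : ℝ => log (-((a : ℂ) + y * I - z)) / I) (fun y _ => ?_) ?_
    · have h1 : HasDerivAt (fun y : ℂ => -(a + y * I - z)) (-I) (y : ℂ) := by
        have h := ((((hasDerivAt_id (y : ℂ)).mul_const I).const_add (a : ℂ)).sub_const z).neg
        rw [one_mul] at h
        exact h
      have h2 : -((a : ℂ) + y * I - z) ∈ slitPlane := by
        rw [mem_slitPlane_iff]; left; simp; linarith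
      have h3 := ((h1.clog h2).div_const I).comp_ofReal
      refine h3.congr_deriv ?_
      rw [div_div, neg_div, neg_mul, div_neg, neg_neg, div_mul_eq_div_div_swap, div_self I_ne_zero,
        one_div]
    · refine ContinuousOn.intervalIntegrable (ContinuousOn.inv₀ (by fun_prop) fun x _ h => ?_)
      have := congrArg Complex.re h
      simp at this; linarith
  have htl : log (-(a + d * I - z)) = log (a + d * I - z) - Real.pi * I := by
    have h : 0 < ((a : ℂ) + d * I - z).im := by simp; linarith
    apply Complex.ext
    · simp [log_re, norm_sub_rev]
    · simp [log_im, -neg_sub, arg_neg_eq_arg_sub_pi_of_im_pos h]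
  have hbl : log (-(a + c * I - z)) = log (a + c * I - z) + Real.pi * I := by
    have h : ((a : ℂ) + c * I - z).im < 0 := by simp; linarith
    apply Complex.ext
    · simp [log_re, norm_sub_rev]
    · simp [log_im, -neg_sub, arg_neg_eq_arg_add_pi_of_im_neg h]
  unfold rectIntegral
  rw [hor c hc.ne, hor d hd.ne', hright, hleft, htl, hbl]
  simp only [smul_eq_mul]
  field_simp
  ring

/-- **Cauchy's integral formula** for a rectangle. -/
theorem rectIntegral_div_sub {a b c d : ℝ} {z : ℂ} (ha : a < z.re) (hb : z.re < b) (hc : c < z.im)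
    (hd : z.im < d) {f : ℂ → ℂ} (hf : DifferentiableOn ℂ f (Icc a b ×ℂ Icc c d)) :
    rectIntegral (fun w => f w / (w - z)) a b c d = 2 * Real.pi * I * f z := by
  have hab : a ≤ b := (ha.trans hb).le
  have hcd : c ≤ d := (hc.trans hd).le
  have hz : (Icc a b ×ℂ Icc c d) ∈ 𝓝 z := by
    have h1 : Ioo a b ×ℂ Ioo c d ∈ 𝓝 z :=
      (isOpen_Ioo.reProdIm isOpen_Ioo).mem_nhds ⟨⟨ha, hb⟩, ⟨hc, hd⟩⟩
    exact mem_of_superset h1 fun w hw => ⟨Ioo_subset_Icc_self hw.1, Ioo_subset_Icc_self hw.2⟩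
  -- The difference quotient of `f` at `z`, completed at `z`, is holomorphic, so its boundary
  -- integral vanishes; on the boundary it equals `f w / (w - z) - f z / (w - z)`.
  have hds := (differentiableOn_dslope hz).2 hf
  have h0 := integral_boundary_rect_eq_zero_of_differentiableOn (dslope f z) ⟨a, c⟩ ⟨b, d⟩
    (by simpa [uIcc_of_le hab, uIcc_of_le hcd] using hds)
  have h0' : rectIntegral (dslope f z) a b c d = 0 := h0
  have key : ∀ w, w ≠ z → dslope f z w = f w / (w - z) - f z * (w - z)⁻¹ := by
    intro w hw
    rw [dslope_of_ne _ hw, slope_def_field, sub_div, div_eq_mul_inv (f z)]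
  have hhor : ∀ y : ℝ, y ∈ Icc c d → y ≠ z.im →
      (∫ x : ℝ in a..b, dslope f z (x + y * I)) =
      (∫ x : ℝ in a..b, f (x + y * I) / (x + y * I - z)) -
        f z * ∫ x : ℝ in a..b, ((x : ℂ) + y * I - z)⁻¹ := by
    intro y hy hyz
    have hne : ∀ x : ℝ, (x : ℂ) + y * I - z ≠ 0 := by
      intro x h
      have := congrArg Complex.im h
      simp at this; exact hyz (by linarith)
    have hfc : ContinuousOn (fun x : ℝ => f (x + y * I)) (uIcc a b) := by
      refine hf.continuousOn.comp (by fun_prop) fun x hx => ?_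
      rw [uIcc_of_le hab] at hx
      exact ⟨by simpa using hx, by simpa using hy⟩
    rw [← intervalIntegral.integral_const_mul, ← intervalIntegral.integral_sub]
    · exact intervalIntegral.integral_congr fun x _ => key _ (sub_ne_zero.1 (hne x))
    · exact (hfc.div (by fun_prop) fun x _ => hne x).intervalIntegrable
    · exact (continuousOn_const.mul (ContinuousOn.inv₀ (by fun_prop)
        fun x _ => hne x)).intervalIntegrable
  have hver : ∀ x : ℝ, x ∈ Icc a b → x ≠ z.re →
      (∫ y : ℝ in c..d, dslope f z (x + y * I)) =
      (∫ y : ℝ in c..d, f (x + y * I) / (x + y * I - z)) -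
        f z * ∫ y : ℝ in c..d, ((x : ℂ) + y * I - z)⁻¹ := by
    intro x hx hxz
    have hne : ∀ y : ℝ, (x : ℂ) + y * I - z ≠ 0 := by
      intro y h
      have := congrArg Complex.re h
      simp at this; exact hxz (by linarith)
    have hfc : ContinuousOn (fun y : ℝ => f (x + y * I)) (uIcc c d) := by
      refine hf.continuousOn.comp (by fun_prop) fun y hy => ?_
      rw [uIcc_of_le hcd] at hy
      exact ⟨by simpa using hx, by simpa using hy⟩
    rw [← intervalIntegral.integral_const_mul, ← intervalIntegral.integral_sub]
    · exact intervalIntegral.integral_congr fun y _ => key _ (sub_ne_zero.1 (hne y))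
    · exact (hfc.div (by fun_prop) fun y _ => hne y).intervalIntegrable
    · exact (continuousOn_const.mul (ContinuousOn.inv₀ (by fun_prop)
        fun y _ => hne y)).intervalIntegrable
  have hinv := rectIntegral_inv_sub ha hb hc hd
  unfold rectIntegral at h0' hinv ⊢
  rw [hhor c ⟨le_rfl, hcd⟩ hc.ne, hhor d ⟨hcd, le_rfl⟩ hd.ne', hver a ⟨le_rfl, hab⟩ ha.ne,
    hver b ⟨hab, le_rfl⟩ hb.ne'] at h0'
  simp only [smul_eq_mul] at h0' hinv ⊢
  linear_combination h0' + f z * hinv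

/-- A function which is holomorphic near a rectangle is the difference of two functions which
extend to the left and to the right. -/
theorem exists_split_rect {b δ c d : ℝ} (hδ : 0 < δ) {f : ℂ → ℂ}
    (hf : DifferentiableOn ℂ f (Icc (b - δ) (b + δ) ×ℂ Icc c d)) :
    ∃ f₁ f₂ : ℂ → ℂ, DifferentiableOn ℂ f₁ (Iio (b + δ) ×ℂ Ioo c d) ∧
      DifferentiableOn ℂ f₂ (Ioi (b - δ) ×ℂ Ioo c d) ∧
      ∀ z ∈ Ioo (b - δ) (b + δ) ×ℂ Ioo c d, f z = f₁ z - f₂ z := by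
  rcases lt_or_ge d c with hdc | hcd
  · refine ⟨0, 0, differentiableOn_const 0, differentiableOn_const 0, fun z hz => ?_⟩
    exact absurd (hz.2.1.trans hz.2.2) (by linarith)
  have hcor : ∀ x y : ℝ, x ∈ Icc (b - δ) (b + δ) → y ∈ Icc c d → (x : ℂ) + y * I ∈
      Icc (b - δ) (b + δ) ×ℂ Icc c d := fun x y hx hy => ⟨by simpa using hx, by simpa using hy⟩
  have hhor : ∀ y ∈ Icc c d, ∀ l r : ℝ, l ≤ r → b - δ ≤ l → r ≤ b + δ →
      ContinuousOn (fun x : ℝ => f (x + y * I)) (uIcc l r) := by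
    intro y hy l r hlr hl hr
    refine hf.continuousOn.comp (by fun_prop) fun x hx => hcor x y ?_ hy
    rw [uIcc_of_le hlr] at hx
    exact ⟨hl.trans hx.1, hx.2.trans hr⟩
  have hver : ∀ x ∈ Icc (b - δ) (b + δ),
      ContinuousOn (fun y : ℝ => f (x + y * I)) (uIcc c d) := by
    intro x hx
    refine hf.continuousOn.comp (by fun_prop) fun y hy => hcor x y hx ?_
    rwa [uIcc_of_le hcd] at hy
  have hdh : ∀ y ∈ Icc c d, ∀ l r : ℝ, l ≤ r → b - δ ≤ l → r ≤ b + δ → ∀ z : ℂ, y ≠ z.im →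
      DifferentiableAt ℂ (fun z => ∫ x : ℝ in l..r, f (x + y * I) / (x + y * I - z)) z := by
    intro y hy l r hlr hl hr z hyz
    have := differentiableAt_integral_div (hhor y hy l r hlr hl hr)
      (α := fun x : ℝ => (x : ℂ) + y * I) (β := fun _ => 1) (by fun_prop) (by fun_prop) (z₀ := z) ?_
    · simpa using this
    · intro t _ h
      have := congrArg Complex.im h
      simp at this; exact hyz (by linarith)
  have hdv : ∀ x ∈ Icc (b - δ) (b + δ), ∀ z : ℂ, x ≠ z.re →
      DifferentiableAt ℂ (fun z => ∫ y : ℝ in c..d, f (x + y * I) / (x + y * I - z)) z := by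
    intro x hx z hxz
    have := differentiableAt_integral_div (hver x hx)
      (α := fun y : ℝ => (x : ℂ) + y * I) (β := fun _ => 1) (by fun_prop) (by fun_prop) (z₀ := z) ?_
    · simpa using this
    · intro t _ h
      have := congrArg Complex.re h
      simp at this; exact hxz (by linarith)
  -- The contour of Cauchy's formula is cut along `Re = b`. Inside the strip `c < Im < d` the right
  -- half of the integral is singular only on `Re = b + δ`, the left half only on `Re = b - δ`.
  let H (y l r : ℝ) (z : ℂ) : ℂ := ∫ x : ℝ in l..r, f (x + y * I) / (x + y * I - z)
  let V (x : ℝ) (z : ℂ) : ℂ := ∫ y : ℝ in c..d, f (x + y * I) / (x + y * I - z)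
  refine ⟨fun z => (2 * Real.pi * I)⁻¹ * (H c b (b + δ) z - H d b (b + δ) z +
      I * V ((b + δ : ℝ)) z),
    fun z => -((2 * Real.pi * I)⁻¹ * (H c (b - δ) b z - H d (b - δ) b z -
      I * V ((b - δ : ℝ)) z)), ?_, ?_, ?_⟩
  · intro z hz
    have h1 := hdh c ⟨le_rfl, hcd⟩ b (b + δ) (by linarith) (by linarith) le_rfl z hz.2.1.ne
    have h2 := hdh d ⟨hcd, le_rfl⟩ b (b + δ) (by linarith) (by linarith) le_rfl z hz.2.2.ne'
    have h3 := hdv (b + δ) ⟨by linarith, le_rfl⟩ z (ne_of_gt hz.1)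
    exact (((h1.sub h2).add (h3.const_mul I)).const_mul _).differentiableWithinAt
  · intro z hz
    have h1 := hdh c ⟨le_rfl, hcd⟩ (b - δ) b (by linarith) le_rfl (by linarith) z hz.2.1.ne
    have h2 := hdh d ⟨hcd, le_rfl⟩ (b - δ) b (by linarith) le_rfl (by linarith) z hz.2.2.ne'
    have h3 := hdv (b - δ) ⟨le_rfl, by linarith⟩ z (ne_of_lt hz.1)
    exact (((h1.sub h2).sub (h3.const_mul I)).const_mul _).neg.differentiableWithinAt
  · intro z hz
    have hC := rectIntegral_div_sub hz.1.1 hz.1.2 hz.2.1 hz.2.2 hf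
    have hadd : ∀ y ∈ Icc c d, y ≠ z.im → H y (b - δ) b z + H y b (b + δ) z =
        ∫ x : ℝ in (b - δ)..(b + δ), f (x + y * I) / (x + y * I - z) := by
      intro y hy hyz
      have hne : ∀ x : ℝ, (x : ℂ) + y * I - z ≠ 0 := by
        intro x h
        have := congrArg Complex.im h
        simp at this; exact hyz (by linarith)
      refine intervalIntegral.integral_add_adjacent_intervals ?_ ?_
      · exact ((hhor y hy (b - δ) b (by linarith) le_rfl (by linarith)).div (by fun_prop)
          fun x _ => hne x).intervalIntegrable
      · exact ((hhor y hy b (b + δ) (by linarith) (by linarith) le_rfl).div (by fun_prop)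
          fun x _ => hne x).intervalIntegrable
    unfold rectIntegral at hC
    rw [← hadd c ⟨le_rfl, hcd⟩ hz.2.1.ne, ← hadd d ⟨hcd, le_rfl⟩ hz.2.2.ne'] at hC
    have hpi : (2 * Real.pi * I : ℂ) ≠ 0 := two_pi_I_ne_zero
    have hV1 : V (b + δ) z = ∫ y : ℝ in c..d, f (((b + δ : ℝ) : ℂ) + y * I) /
      (((b + δ : ℝ) : ℂ) + y * I - z) := rfl
    have hV2 : V (b - δ) z = ∫ y : ℝ in c..d, f (((b - δ : ℝ) : ℂ) + y * I) /
      (((b - δ : ℝ) : ℂ) + y * I - z) := rfl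
    rw [← hV1, ← hV2] at hC
    simp only [smul_eq_mul] at hC
    rw [sub_neg_eq_add, ← mul_add, eq_inv_mul_iff_mul_eq₀ hpi, ← hC]
    ring

/-! ### The additive Cousin problem on discs. -/

section Cousin

variable {ι : Type*}

/-- A family of holomorphic functions on the pairwise intersections of open subsets
of the plane is a coboundary on `W`. -/
def SplitsOn (U : ι → Set ℂ) (c : ι → ι → ℂ → ℂ) (W : Set ℂ) : Prop :=
  ∃ t : ι → ℂ → ℂ, (∀ p, DifferentiableOn ℂ (t p) (U p ∩ W)) ∧
    ∀ p q, ∀ z ∈ W, z ∈ U p → z ∈ U q → c p q z = t q z - t p z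

theorem SplitsOn.mono {U : ι → Set ℂ} {c : ι → ι → ℂ → ℂ} {W W' : Set ℂ} (h : SplitsOn U c W)
    (hW : W' ⊆ W) : SplitsOn U c W' := by
  obtain ⟨t, ht, hc⟩ := h
  exact ⟨t, fun p => (ht p).mono (inter_subset_inter_right _ hW),
    fun p q z hz => hc p q z (hW hz)⟩

/-- The open `ε`-neighbourhood of a rectangle. -/
def thickRect (a b c d ε : ℝ) : Set ℂ := Ioo (a - ε) (b + ε) ×ℂ Ioo (c - ε) (d + ε)

theorem thickRect_mono {a b c d a' b' c' d' ε ε' : ℝ} (ha : a' - ε' ≤ a - ε) (hb : b + ε ≤ b' + ε')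
    (hc : c' - ε' ≤ c - ε) (hd : d + ε ≤ d' + ε') :
    thickRect a b c d ε ⊆ thickRect a' b' c' d' ε' :=
  fun _ hz => ⟨Ioo_subset_Ioo ha hb hz.1, Ioo_subset_Ioo hc hd hz.2⟩

theorem isOpen_thickRect (a b c d ε : ℝ) : IsOpen (thickRect a b c d ε) :=
  isOpen_Ioo.reProdIm isOpen_Ioo

/-- The cocycle `c` splits near a closed rectangle. -/
def SplitsNear (U : ι → Set ℂ) (f : ι → ι → ℂ → ℂ) (a b c d : ℝ) : Prop :=
  ∃ ε > 0, SplitsOn U f (thickRect a b c d ε)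

theorem SplitsNear.mono {U : ι → Set ℂ} {f : ι → ι → ℂ → ℂ} {a b c d a' b' c' d' : ℝ}
    (h : SplitsNear U f a b c d) (ha : a ≤ a') (hb : b' ≤ b) (hc : c ≤ c') (hd : d' ≤ d) :
    SplitsNear U f a' b' c' d' := by
  obtain ⟨ε, hε, h⟩ := h
  exact ⟨ε, hε, h.mono (thickRect_mono (by linarith) (by linarith) (by linarith) (by linarith))⟩

/-- Splittings near two rectangles with a common vertical edge can be glued. -/
theorem SplitsNear.glue_re {U : ι → Set ℂ} {f : ι → ι → ℂ → ℂ} (hU : ∀ p, IsOpen (U p))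
    (hcov : ∀ z, ∃ p, z ∈ U p) {a b b' c d : ℝ} (hab : a ≤ b) (hbb : b ≤ b')
    (h₁ : SplitsNear U f a b c d) (h₂ : SplitsNear U f b b' c d) : SplitsNear U f a b' c d := by
  obtain ⟨ε₁, hε₁, h₁⟩ := h₁
  obtain ⟨ε₂, hε₂, h₂⟩ := h₂
  obtain ⟨ε, hε, hεl, hεr⟩ : ∃ ε > 0, ε ≤ ε₁ ∧ ε ≤ ε₂ :=
    ⟨min ε₁ ε₂, lt_min hε₁ hε₂, min_le_left _ _, min_le_right _ _⟩
  obtain ⟨t₁, ht₁, hf₁⟩ := h₁.mono (W' := thickRect a b c d ε)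
    (thickRect_mono (by linarith) (by linarith) (by linarith) (by linarith))
  obtain ⟨t₂, ht₂, hf₂⟩ := h₂.mono (W' := thickRect b b' c d ε)
    (thickRect_mono (by linarith) (by linarith) (by linarith) (by linarith))
  choose k hk using hcov
  have hmem₁ : ∀ z, z ∈ thickRect b b c d ε → z ∈ thickRect a b c d ε := fun z hz =>
    thickRect_mono (by linarith) le_rfl le_rfl le_rfl hz
  have hmem₂ : ∀ z, z ∈ thickRect b b c d ε → z ∈ thickRect b b' c d ε := fun z hz =>
    thickRect_mono le_rfl (by linarith) le_rfl le_rfl hz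
  -- Both splittings have the coboundary `f`, so `t₂ p - t₁ p` is independent of `p` and defines one
  -- holomorphic function near the common edge; `k z` is an arbitrary index at `z`.
  let g : ℂ → ℂ := fun z => t₂ (k z) z - t₁ (k z) z
  have hg : ∀ p, ∀ z ∈ thickRect b b c d ε, z ∈ U p → g z = t₂ p z - t₁ p z := by
    intro p z hz hp
    have e₁ := hf₁ p (k z) z (hmem₁ z hz) hp (hk z)
    have e₂ := hf₂ p (k z) z (hmem₂ z hz) hp (hk z)
    simp only [g]
    linear_combination e₁ - e₂
  have hgd : DifferentiableOn ℂ g (thickRect b b c d ε) := by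
    intro z hz
    have hn : U (k z) ∩ thickRect b b c d ε ∈ 𝓝 z :=
      ((hU _).inter (isOpen_thickRect _ _ _ _ _)).mem_nhds ⟨hk z, hz⟩
    have d₁ := ((ht₁ (k z)).mono fun w hw => ⟨hw.1, hmem₁ w hw.2⟩).differentiableAt hn
    have d₂ := ((ht₂ (k z)).mono fun w hw => ⟨hw.1, hmem₂ w hw.2⟩).differentiableAt hn
    refine ((d₂.sub d₁).congr_of_eventuallyEq ?_).differentiableWithinAt
    filter_upwards [hn] with w hw
    exact hg _ w hw.2 hw.1
  -- With `g = g₁ - g₂` the corrected splittings `t₁ + g₁` and `t₂ + g₂` agree near the edge.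
  -- Halving `ε` places the closed rectangle required here inside the open one.
  obtain ⟨g₁, g₂, hg₁, hg₂, hgg⟩ := exists_split_rect (b := b) (δ := ε / 2) (c := c - ε / 2)
    (d := d + ε / 2) (by linarith) (f := g) (hgd.mono fun z hz =>
      ⟨⟨by linarith [hz.1.1], by linarith [hz.1.2]⟩, ⟨by linarith [hz.2.1], by linarith [hz.2.2]⟩⟩)
  have heq : ∀ p z, z ∈ U p → z ∈ Ioo (b - ε / 2) (b + ε / 2) ×ℂ Ioo (c - ε / 2) (d + ε / 2) →
      t₁ p z + g₁ z = t₂ p z + g₂ z := by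
    intro p z hp hz
    have e := hg p z ⟨⟨by linarith [hz.1.1], by linarith [hz.1.2]⟩,
      ⟨by linarith [hz.2.1], by linarith [hz.2.2]⟩⟩ hp
    linear_combination e - hgg z hz
  let t : ι → ℂ → ℂ := fun p z => if z.re < b then t₁ p z + g₁ z else t₂ p z + g₂ z
  have hleft : ∀ p z, z ∈ U p → z ∈ thickRect a b c d (ε / 2) → t p z = t₁ p z + g₁ z := by
    intro p z hp hz
    by_cases hb : z.re < b
    · simp [t, hb]
    · simp only [t, hb, if_false]
      exact (heq p z hp ⟨⟨by linarith, hz.1.2⟩, hz.2⟩).symm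
  have hright : ∀ p z, z ∈ U p → z ∈ thickRect b b' c d (ε / 2) → t p z = t₂ p z + g₂ z := by
    intro p z hp hz
    by_cases hb : z.re < b
    · simp only [t, hb, if_true]
      exact heq p z hp ⟨⟨hz.1.1, by linarith⟩, hz.2⟩
    · simp [t, hb]
  have hcase : ∀ z ∈ thickRect a b' c d (ε / 2),
      z ∈ thickRect a b c d (ε / 2) ∨ z ∈ thickRect b b' c d (ε / 2) := by
    intro z hz
    rcases lt_or_ge z.re (b + ε / 2) with h | h
    · exact Or.inl ⟨⟨hz.1.1, h⟩, hz.2⟩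
    · exact Or.inr ⟨⟨by linarith, hz.1.2⟩, hz.2⟩
  have hs₁ : thickRect a b c d (ε / 2) ⊆ thickRect a b c d ε :=
    thickRect_mono (by linarith) (by linarith) (by linarith) (by linarith)
  have hs₂ : thickRect b b' c d (ε / 2) ⊆ thickRect b b' c d ε :=
    thickRect_mono (by linarith) (by linarith) (by linarith) (by linarith)
  refine ⟨ε / 2, by linarith, t, fun p z hz => ?_, fun p q z hz hp hq => ?_⟩
  · rcases hcase z hz.2 with h | h
    · have hn : U p ∩ thickRect a b c d (ε / 2) ∈ 𝓝 z :=
        ((hU _).inter (isOpen_thickRect _ _ _ _ _)).mem_nhds ⟨hz.1, h⟩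
      have d₁ := ((ht₁ p).mono (inter_subset_inter_right _ hs₁)).differentiableAt hn
      have d₂ := hg₁.differentiableAt ((isOpen_Iio.reProdIm isOpen_Ioo).mem_nhds ⟨h.1.2, h.2⟩)
      refine ((d₁.add d₂).congr_of_eventuallyEq ?_).differentiableWithinAt
      filter_upwards [hn] with w hw
      exact hleft p w hw.1 hw.2
    · have hn : U p ∩ thickRect b b' c d (ε / 2) ∈ 𝓝 z :=
        ((hU _).inter (isOpen_thickRect _ _ _ _ _)).mem_nhds ⟨hz.1, h⟩
      have d₁ := ((ht₂ p).mono (inter_subset_inter_right _ hs₂)).differentiableAt hn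
      have d₂ := hg₂.differentiableAt ((isOpen_Ioi.reProdIm isOpen_Ioo).mem_nhds ⟨h.1.1, h.2⟩)
      refine ((d₁.add d₂).congr_of_eventuallyEq ?_).differentiableWithinAt
      filter_upwards [hn] with w hw
      exact hright p w hw.1 hw.2
  · rcases hcase z hz with h | h
    · rw [hleft p z hp h, hleft q z hq h, hf₁ p q z (hs₁ h) hp hq]; ring
    · rw [hright p z hp h, hright q z hq h, hf₂ p q z (hs₂ h) hp hq]; ring

/-- A quarter turn exchanges horizontal and vertical edges, so that gluing along horizontal edges
reduces to `SplitsNear.glue_re`. -/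
theorem SplitsNear.rotate {U : ι → Set ℂ} {f : ι → ι → ℂ → ℂ} {a b c d : ℝ}
    (h : SplitsNear U f a b c d) : SplitsNear (fun p => (fun z => I * z) ⁻¹' U p)
      (fun p q z => f p q (I * z)) c d (-b) (-a) := by
  obtain ⟨ε, hε, t, ht, hf⟩ := h
  have hm : ∀ z, z ∈ thickRect c d (-b) (-a) ε → I * z ∈ thickRect a b c d ε := by
    intro z hz
    have h1 := hz.1; have h2 := hz.2
    constructor
    · change (I * z).re ∈ Ioo _ _
      simp only [mul_re, I_re, I_im, zero_mul, one_mul, zero_sub]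
      exact ⟨by linarith [h2.2], by linarith [h2.1]⟩
    · change (I * z).im ∈ Ioo _ _
      simp only [mul_im, I_re, I_im, zero_mul, one_mul, zero_add]
      exact ⟨h1.1, h1.2⟩
  refine ⟨ε, hε, fun p z => t p (I * z), fun p => ?_, fun p q z hz hp hq => hf p q _ (hm z hz) hp hq⟩
  exact (ht p).comp (by fun_prop) fun z hz => ⟨hz.1, hm z hz.2⟩

/-- Three more quarter turns undo the first one, because `I ^ 4 = 1`. -/
theorem SplitsNear.of_rotate {U : ι → Set ℂ} {f : ι → ι → ℂ → ℂ} {a b c d : ℝ}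
    (h : SplitsNear (fun p => (fun z => I * z) ⁻¹' U p) (fun p q z => f p q (I * z)) c d (-b) (-a)) :
    SplitsNear U f a b c d := by
  have h3 := h.rotate.rotate.rotate
  have e : ∀ z : ℂ, I * (I * (I * (I * z))) = z := by
    intro z; linear_combination (I ^ 2 - 1) * z * I_sq
  simpa [preimage, e] using h3

/-- Splittings near two rectangles with a common horizontal edge can be glued. -/
theorem SplitsNear.glue_im {U : ι → Set ℂ} {f : ι → ι → ℂ → ℂ} (hU : ∀ p, IsOpen (U p))
    (hcov : ∀ z, ∃ p, z ∈ U p) {a b c d d' : ℝ} (hcd : c ≤ d) (hdd : d ≤ d')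
    (h₁ : SplitsNear U f a b c d) (h₂ : SplitsNear U f a b d d') : SplitsNear U f a b c d' :=
  (h₁.rotate.glue_re (fun p => (hU p).preimage (by fun_prop)) (fun z => hcov (I * z)) hcd hdd
    h₂.rotate).of_rotate

/-- The first cohomology of the structure sheaf vanishes near closed discs. -/
theorem splitsOn_ball {U : ι → Set ℂ} {f : ι → ι → ℂ → ℂ} (hU : ∀ p, IsOpen (U p))
    (hcov : ∀ z, ∃ p, z ∈ U p) (hf : ∀ p q, DifferentiableOn ℂ (f p q) (U p ∩ U q))
    (hc : ∀ p q r z, z ∈ U p → z ∈ U q → z ∈ U r → f p r z = f p q z + f q r z) {R : ℝ}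
    (hR : 0 < R) : SplitsOn U f (ball 0 R) := by
  have hK : IsCompact (Icc (-R) R ×ℂ Icc (-R) R) := isCompact_Icc.reProdIm isCompact_Icc
  obtain ⟨δ, hδ, hL⟩ := lebesgue_number_lemma_of_metric hK hU
    (fun z _ => mem_iUnion.2 (hcov z))
  -- This makes four times the mesh `h = 2R/N` smaller than the Lebesgue number `δ`. A cell of side
  -- `h` thickened by `h` is within `2h + 2h` of its corner, hence inside a single `U k`.
  obtain ⟨N, hN⟩ := exists_nat_gt (8 * R / δ)
  have hN0 : (0 : ℝ) < N := lt_trans (by positivity) hN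
  let h : ℝ := 2 * R / N
  have hh : 0 < h := by positivity
  have hh4 : 4 * h < δ := by
    have : 8 * R < N * δ := (div_lt_iff₀ hδ).1 hN
    simp only [h]
    rw [mul_div_assoc', div_lt_iff₀ hN0]
    linarith
  have hNh : N * h = 2 * R := by simp only [h]; field_simp
  have hcell : ∀ x y : ℝ, x ∈ Icc (-R) R → y ∈ Icc (-R) R →
      SplitsNear U f x (x + h) y (y + h) := by
    intro x y hx hy
    obtain ⟨k, hk⟩ := hL (⟨x, y⟩ : ℂ) ⟨hx, hy⟩
    have hsub : thickRect x (x + h) y (y + h) h ⊆ U k := by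
      intro z hz
      apply hk
      rw [mem_ball, dist_eq]
      refine (norm_le_abs_re_add_abs_im _).trans_lt ?_
      have h1 : |(z - ⟨x, y⟩ : ℂ).re| < 2 * h := by
        rw [abs_lt]; simp; exact ⟨by linarith [hz.1.1], by linarith [hz.1.2]⟩
      have h2 : |(z - ⟨x, y⟩ : ℂ).im| < 2 * h := by
        rw [abs_lt]; simp; exact ⟨by linarith [hz.2.1], by linarith [hz.2.2]⟩
      linarith
    -- Inside a single `U k` the functions `f k p` split the cocycle: `f p q = f k q - f k p`.
    refine ⟨h, hh, fun p => f k p, fun p => (hf k p).mono fun z hz => ⟨hsub hz.2, hz.1⟩,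
      fun p q z hz hp hq => ?_⟩
    simp only [hc k p q z (hsub hz) hp hq]; ring
  have hle : ∀ k : ℕ, k < N → -R + k * h ∈ Icc (-R) R := by
    intro k hk
    have : (k : ℝ) ≤ N := by exact_mod_cast hk.le
    have h2 : (k : ℝ) * h ≤ N * h := mul_le_mul_of_nonneg_right this hh.le
    exact ⟨by nlinarith [Nat.cast_nonneg (α := ℝ) k], by linarith⟩
  have hrow : ∀ y ∈ Icc (-R) R, ∀ k : ℕ, k ≤ N → SplitsNear U f (-R) (-R + k * h) y (y + h) := by
    intro y hy k
    induction k with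
    | zero =>
      intro _
      exact (hcell (-R) y ⟨le_rfl, by linarith⟩ hy).mono le_rfl (by simp; linarith) le_rfl le_rfl
    | succ k ih =>
      intro hk
      have hm := hle k hk
      have e : -R + ((k + 1 : ℕ) : ℝ) * h = -R + k * h + h := by push_cast; ring
      rw [e]
      exact (ih (by omega)).glue_re hU hcov hm.1 (by linarith) (hcell _ y hm hy)
  have hcol : ∀ k : ℕ, k ≤ N → SplitsNear U f (-R) R (-R) (-R + k * h) := by
    have hrow' : ∀ y ∈ Icc (-R) R, SplitsNear U f (-R) R y (y + h) := by
      intro y hy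
      exact (hrow y hy N le_rfl).mono le_rfl (by linarith) le_rfl le_rfl
    intro k
    induction k with
    | zero =>
      intro _
      exact (hrow' (-R) ⟨le_rfl, by linarith⟩).mono le_rfl le_rfl le_rfl (by simp; linarith)
    | succ k ih =>
      intro hk
      have hm := hle k hk
      have e : -R + ((k + 1 : ℕ) : ℝ) * h = -R + k * h + h := by push_cast; ring
      rw [e]
      exact (ih (by omega)).glue_im hU hcov hm.1 (by linarith) (hrow' _ hm)
  obtain ⟨ε, hε, hs⟩ := hcol N le_rfl
  refine hs.mono fun z hz => ?_
  rw [mem_ball_zero_iff] at hz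
  have h1 := abs_lt.1 ((abs_re_le_norm z).trans_lt hz)
  have h2 := abs_lt.1 ((abs_im_le_norm z).trans_lt hz)
  exact ⟨⟨by linarith, by linarith⟩, ⟨by linarith, by linarith⟩⟩

end Cousin

/-- Laurent decomposition on an annulus. -/
theorem exists_laurent_split {g : ℂ → ℂ} (hg : DifferentiableOn ℂ g {z | 3⁻¹ < ‖z‖ ∧ ‖z‖ < 3}) :
    ∃ a b : ℂ → ℂ, DifferentiableOn ℂ a (ball 0 2) ∧ DifferentiableOn ℂ b (ball 0 2) ∧
      ∀ z : ℂ, 2⁻¹ < ‖z‖ → ‖z‖ < 2 → g z = a z + b z⁻¹ := by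
  have hcirc : ∀ r : ℝ, 3⁻¹ < r → r < 3 → Continuous (fun θ : ℝ => g (circleMap 0 r θ)) := by
    intro r h1 h2
    refine continuousOn_univ.1 (hg.continuousOn.comp (continuous_circleMap 0 r).continuousOn ?_)
    intro θ _
    have : ‖circleMap 0 r θ‖ = r := by
      rw [norm_circleMap_zero, abs_of_pos (by linarith [show (0 : ℝ) < 3⁻¹ by norm_num])]
    simp only [mem_ofPred_eq, this]; exact ⟨h1, h2⟩
  have hda : ∀ z ∈ ball (0 : ℂ) 2,
      DifferentiableAt ℂ (fun z => ∮ w in C(0, 2), g w / (w - z)) z := by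
    intro z hz
    have := differentiableAt_integral_div (a := 0) (b := 2 * Real.pi)
      (φ := fun θ => deriv (circleMap 0 2) θ * g (circleMap 0 2 θ)) (α := circleMap 0 2)
      (β := fun _ => 1) (z₀ := z) ?_ (continuous_circleMap 0 2) continuous_const ?_
    · refine this.congr_of_eventuallyEq (Eventually.of_forall fun w => ?_)
      simp only [circleIntegral, smul_eq_mul, mul_div_assoc, one_mul]
    · simp only [deriv_circleMap]
      exact ((continuous_circleMap 0 2).mul continuous_const |>.mul
        (hcirc 2 (by norm_num) (by norm_num))).continuousOn
    · intro t _ h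
      rw [one_mul, sub_eq_zero] at h
      rw [mem_ball_zero_iff, ← h, norm_circleMap_zero] at hz
      norm_num at hz
  have hdb : ∀ z ∈ ball (0 : ℂ) 2,
      DifferentiableAt ℂ (fun z => ∮ w in C(0, 2⁻¹), g w / (1 - w * z)) z := by
    intro z hz
    have := differentiableAt_integral_div (a := 0) (b := 2 * Real.pi)
      (φ := fun θ => deriv (circleMap 0 2⁻¹) θ * g (circleMap 0 2⁻¹ θ)) (α := fun _ => 1)
      (β := circleMap 0 2⁻¹) (z₀ := z) ?_ continuous_const (continuous_circleMap 0 2⁻¹) ?_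
    · refine this.congr_of_eventuallyEq (Eventually.of_forall fun w => ?_)
      simp only [circleIntegral, smul_eq_mul, mul_div_assoc]
    · simp only [deriv_circleMap]
      exact ((continuous_circleMap 0 _).mul continuous_const |>.mul
        (hcirc 2⁻¹ (by norm_num) (by norm_num))).continuousOn
    · intro t _ h
      rw [sub_eq_zero] at h
      have h' := congrArg norm h
      rw [norm_mul, norm_circleMap_zero, abs_of_pos (by norm_num), norm_one] at h'
      rw [mem_ball_zero_iff] at hz
      linarith
  -- `a` is the Cauchy integral over the outer circle. `b` is minus the one over the inner circle,
  -- rewritten in the variable `1/z` so that it extends over infinity.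
  refine ⟨fun z => (2 * Real.pi * I)⁻¹ * ∮ w in C(0, 2), g w / (w - z),
    fun z => (2 * Real.pi * I)⁻¹ * (z * ∮ w in C(0, 2⁻¹), g w / (1 - w * z)),
    fun z hz => ((hda z hz).const_mul _).differentiableWithinAt,
    fun z hz => ((differentiableAt_id.mul (hdb z hz)).const_mul _).differentiableWithinAt, ?_⟩
  intro z hz1 hz2
  have hz0 : z ≠ 0 := by rintro rfl; norm_num at hz1
  have hopen : IsOpen {z : ℂ | 3⁻¹ < ‖z‖ ∧ ‖z‖ < 3} :=
    (isOpen_lt continuous_const continuous_norm).inter (isOpen_lt continuous_norm continuous_const)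
  have hds := (differentiableOn_dslope (hopen.mem_nhds
    (⟨by linarith [show (3 : ℝ)⁻¹ < 2⁻¹ by norm_num], by linarith⟩ :
      z ∈ {z : ℂ | 3⁻¹ < ‖z‖ ∧ ‖z‖ < 3}))).2 hg
  -- The difference quotient at `z` is holomorphic on the annulus, so both circles give the same
  -- integral. Separating the term `g z / (w - z)`, which contributes only on the outer circle,
  -- yields Cauchy's formula for the annulus.
  have heq : (∮ w in C(0, 2), dslope g z w) = ∮ w in C(0, 2⁻¹), dslope g z w := by
    refine circleIntegral_eq_of_differentiable_on_annulus_off_countable (by norm_num) (by norm_num)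
      countable_empty (hds.continuousOn.mono fun w hw => ?_) fun w hw => ?_
    · simp only [Set.mem_sdiff, mem_closedBall_zero_iff, mem_ball_zero_iff, not_lt] at hw
      exact ⟨by linarith [hw.2, show (3 : ℝ)⁻¹ < 2⁻¹ by norm_num], by linarith [hw.1]⟩
    · simp only [Set.mem_sdiff, mem_closedBall_zero_iff, mem_ball_zero_iff, not_le] at hw
      exact hds.differentiableAt (hopen.mem_nhds
        ⟨by linarith [hw.1.2, show (3 : ℝ)⁻¹ < 2⁻¹ by norm_num], by linarith [hw.1.1]⟩)
  have key : ∀ r : ℝ, 3⁻¹ < r → r < 3 → r ≠ ‖z‖ → (∮ w in C(0, r), dslope g z w) =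
      (∮ w in C(0, r), g w / (w - z)) - g z * ∮ w in C(0, r), (w - z)⁻¹ := by
    intro r h1 h2 hr
    have hr0 : 0 ≤ r := by linarith [show (0 : ℝ) < 3⁻¹ by norm_num]
    have hne : ∀ w ∈ sphere (0 : ℂ) r, w - z ≠ 0 := by
      intro w hw h
      rw [mem_sphere_zero_iff_norm, sub_eq_zero.1 h] at hw
      exact hr hw.symm
    rw [← circleIntegral.integral_const_mul, ← circleIntegral.integral_sub]
    · refine circleIntegral.integral_congr hr0 fun w hw => ?_
      change dslope g z w = g w / (w - z) - g z * (w - z)⁻¹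
      rw [dslope_of_ne _ (sub_ne_zero.1 (hne w hw)), slope_def_field, sub_div,
        div_eq_mul_inv (g z)]
    · refine ContinuousOn.circleIntegrable hr0 (ContinuousOn.div (hg.continuousOn.mono ?_)
        (by fun_prop) hne)
      intro w hw
      rw [mem_sphere_zero_iff_norm] at hw
      simp only [mem_ofPred_eq, hw]; exact ⟨h1, h2⟩
    · exact ContinuousOn.circleIntegrable hr0 (continuousOn_const.mul
        (ContinuousOn.inv₀ (by fun_prop) hne))
  have hI1 : (∮ w in C(0, 2), (w - z)⁻¹) = 2 * Real.pi * I :=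
    circleIntegral.integral_sub_inv_of_mem_ball (by simpa using hz2)
  have hI2 : (∮ w in C(0, 2⁻¹), (w - z)⁻¹) = 0 := by
    have hne : ∀ w ∈ closedBall (0 : ℂ) 2⁻¹, w - z ≠ 0 := by
      intro w hw h
      rw [mem_closedBall_zero_iff, sub_eq_zero.1 h] at hw
      linarith
    refine circleIntegral_eq_zero_of_differentiable_on_off_countable (by norm_num) countable_empty
      (ContinuousOn.inv₀ (by fun_prop) hne) fun w hw => ?_
    exact DifferentiableAt.inv (by fun_prop) (hne w (ball_subset_closedBall hw.1))
  rw [key 2 (by norm_num) (by norm_num) hz2.ne', key 2⁻¹ (by norm_num) (by norm_num) hz1.ne, hI1,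
    hI2] at heq
  have hb : (z⁻¹ * ∮ w in C(0, 2⁻¹), g w / (1 - w * z⁻¹)) =
      -∮ w in C(0, 2⁻¹), g w / (w - z) := by
    rw [← circleIntegral.integral_const_mul, ← neg_one_mul, ← circleIntegral.integral_const_mul]
    refine circleIntegral.integral_congr (by norm_num) fun w hw => ?_
    have hwz : w - z ≠ 0 := by
      intro h
      rw [mem_sphere_zero_iff_norm, sub_eq_zero.1 h] at hw
      exact hz1.ne hw.symm
    have hzw : z - w ≠ 0 := by rw [← neg_sub]; exact neg_ne_zero.2 hwz
    have h3 : 1 - w * z⁻¹ = (z - w) * z⁻¹ := by field_simp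
    change z⁻¹ * (g w / (1 - w * z⁻¹)) = -1 * (g w / (w - z))
    rw [h3, ← neg_sub z w, div_neg]
    field_simp
  have hpi : (2 * Real.pi * I : ℂ) ≠ 0 := two_pi_I_ne_zero
  change g z = (2 * Real.pi * I)⁻¹ * _ + (2 * Real.pi * I)⁻¹ * _
  rw [hb, ← mul_add, eq_inv_mul_iff_mul_eq₀ hpi]
  linear_combination -heq

/-- Taylor expansion with holomorphic remainder. -/
theorem exists_taylor {S : Set ℂ} (hS : S ∈ 𝓝 (0 : ℂ)) (k : ℕ) : ∀ {F : ℂ → ℂ},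
    DifferentiableOn ℂ F S → ∃ (f : ℕ → ℂ) (H : ℂ → ℂ), DifferentiableOn ℂ H S ∧
      ∀ z, F z = ∑ j ∈ Finset.range k, f j * z ^ j + z ^ k * H z := by
  induction k with
  | zero => intro F hF; exact ⟨0, F, hF, fun z => by simp⟩
  | succ k ih =>
    intro F hF
    obtain ⟨f, H, hH, h⟩ := ih hF
    refine ⟨fun j => if j = k then H 0 else f j, dslope H 0, (differentiableOn_dslope hS).2 hH,
      fun z => ?_⟩
    have e : H z = H 0 + z * dslope H 0 z := by
      have := sub_smul_dslope H 0 z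
      rw [smul_eq_mul, sub_zero] at this
      rw [this]; ring
    rw [Finset.sum_range_succ, h z, e]
    simp only [if_true]
    have : ∑ j ∈ Finset.range k, (if j = k then H 0 else f j) * z ^ j =
        ∑ j ∈ Finset.range k, f j * z ^ j :=
      Finset.sum_congr rfl fun j hj => by rw [if_neg (Finset.mem_range.1 hj).ne]
    rw [this]; ring

/-! ### Entire functions with prescribed growth at infinity. -/

theorem tendsto_inv_cocompact : Tendsto (fun z : ℂ => z⁻¹) (cocompact ℂ) (𝓝 0) := by
  rw [← Metric.cobounded_eq_cocompact]
  exact tendsto_inv₀_cobounded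

theorem eq_zero_of_tendsto_zero {F : ℂ → ℂ} (hF : Differentiable ℂ F)
    (h : Tendsto F (cocompact ℂ) (𝓝 0)) (z : ℂ) : F z = 0 :=
  hF.apply_eq_of_tendsto_cocompact z h

/-- Entire functions with `F(z) = zᵏ G(1/z)` for an entire function `G` are polynomials of
degree at most `k`. -/
theorem eq_sum_of_inversion {F G : ℂ → ℂ} (hF : Differentiable ℂ F) (hG : Differentiable ℂ G)
    {k : ℕ} (h : ∀ z, z ≠ 0 → F z = z ^ k * G z⁻¹) :
    ∃ f : ℕ → ℂ, ∀ z, F z = ∑ j ∈ Finset.range (k + 1), f j * z ^ j := by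
  obtain ⟨f, H, hH, e⟩ := exists_taylor (S := univ) univ_mem (k + 1) hF.differentiableOn
  refine ⟨f, fun z => ?_⟩
  -- With `w = 1/z` the entire remainder `H` equals `w G(w) - ∑ f_j w^(k+1-j)`, which tends to zero
  -- with `w`; Liouville's theorem then gives `H = 0`.
  have hH0 : ∀ z, H z = 0 := by
    refine eq_zero_of_tendsto_zero (differentiableOn_univ.1 hH) ?_
    have hc : Continuous (fun w : ℂ => w * G w -
        ∑ j ∈ Finset.range (k + 1), f j * w ^ (k + 1 - j)) :=
      (continuous_id.mul hG.continuous).sub (by fun_prop)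
    have ht := (hc.tendsto 0).comp tendsto_inv_cocompact
    have h0 : (0 : ℂ) * G 0 - ∑ j ∈ Finset.range (k + 1), f j * 0 ^ (k + 1 - j) = 0 := by
      rw [zero_mul, zero_sub, neg_eq_zero]
      refine Finset.sum_eq_zero fun j hj => ?_
      rw [zero_pow (by have := Finset.mem_range.1 hj; omega), mul_zero]
    rw [h0] at ht
    refine ht.congr' ?_
    have hne : ∀ᶠ z : ℂ in cocompact ℂ, z ≠ 0 :=
      (isCompact_singleton (x := (0 : ℂ))).compl_mem_cocompact
    filter_upwards [hne] with z hz
    have e1 := e z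
    rw [h z hz] at e1
    have hzk : z ^ (k + 1) ≠ 0 := pow_ne_zero _ hz
    apply mul_left_cancel₀ hzk
    have e2 : z ^ (k + 1) * H z = z ^ k * G z⁻¹ - ∑ j ∈ Finset.range (k + 1), f j * z ^ j := by
      rw [e1]; ring
    rw [e2]
    simp only [Function.comp]
    rw [mul_sub, Finset.mul_sum]
    congr 1
    · rw [pow_succ]; field_simp
    · refine Finset.sum_congr rfl fun j hj => ?_
      have hj' := Finset.mem_range.1 hj
      have : z ^ (k + 1) = z ^ j * z ^ (k + 1 - j) := by rw [← pow_add]; congr 1; omega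
      rw [this, inv_pow]
      field_simp
  rw [e z, hH0 z, mul_zero, add_zero]

/-- There is no entire function `F ≠ 0` with `F(z) = zᵏ G(1/z)` for an entire function `G` and
`k < 0`. -/
theorem eq_zero_of_inversion {F G : ℂ → ℂ} (hF : Differentiable ℂ F) (hG : Differentiable ℂ G)
    {k : ℕ} (hk : 0 < k) (h : ∀ z, z ≠ 0 → F z = z⁻¹ ^ k * G z⁻¹) (z : ℂ) : F z = 0 := by
  refine eq_zero_of_tendsto_zero hF ?_ z
  have hc : Continuous (fun w : ℂ => w ^ k * G w) := (continuous_id.pow k).mul hG.continuous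
  have ht := (hc.tendsto 0).comp tendsto_inv_cocompact
  rw [zero_pow hk.ne', zero_mul] at ht
  refine ht.congr' ?_
  have hne : ∀ᶠ z : ℂ in cocompact ℂ, z ≠ 0 :=
    (isCompact_singleton (x := (0 : ℂ))).compl_mem_cocompact
  filter_upwards [hne] with w hw
  exact (h w hw).symm

/-! ## Charts of the projective line -/

theorem eq_or_eq_one_sub (i j : Fin 2) : j = i ∨ j = 1 - i := by
  fin_cases i <;> fin_cases j <;> simp

@[simp] theorem one_sub_one_sub (i : Fin 2) : 1 - (1 - i) = i := by
  fin_cases i <;> rfl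

@[simp] theorem vec_self (i : Fin 2) (z : ℂ) : vec i z i = 1 := by
  fin_cases i <;> simp [vec]

@[simp] theorem vec_one_sub (i : Fin 2) (z : ℂ) : vec i z (1 - i) = z := by
  fin_cases i <;> simp [vec]

@[simp] theorem vec_one_sub_self (i : Fin 2) (z : ℂ) : vec (1 - i) z i = z := by
  fin_cases i <;> simp [vec]

theorem fin2_ext (i : Fin 2) {v w : Fin 2 → ℂ} (h : v i = w i) (h' : v (1 - i) = w (1 - i)) :
    v = w := by
  funext j
  rcases eq_or_eq_one_sub i j with rfl | rfl
  · exact h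
  · exact h'

theorem vec_eq_smul (i : Fin 2) {z : ℂ} (hz : z ≠ 0) : vec i z = z • vec (1 - i) z⁻¹ := by
  refine fin2_ext i ?_ ?_ <;> simp [hz]

theorem aff_eq_mk (i : Fin 2) {v : Fin 2 → ℂ} (hv : v ≠ 0) (hi : v i ≠ 0) :
    aff i (v (1 - i) / v i) = Projectivization.mk ℂ v hv := by
  refine (Projectivization.mk_eq_mk_iff' ..).2 ⟨(v i)⁻¹, ?_⟩
  refine fin2_ext i ?_ ?_ <;> simp [hi, div_eq_inv_mul]

theorem aff_inv (i : Fin 2) {z : ℂ} (hz : z ≠ 0) : aff i z = aff (1 - i) z⁻¹ := by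
  refine (Projectivization.mk_eq_mk_iff' ..).2 ⟨z, (vec_eq_smul i hz).symm⟩

theorem aff_injective (i : Fin 2) : Function.Injective (aff i) := by
  intro z w h
  obtain ⟨c, hc⟩ := (Projectivization.mk_eq_mk_iff' ..).1 h
  have h1 := congrFun hc i
  have h2 := congrFun hc (1 - i)
  simp at h1 h2
  simpa [h1] using h2.symm

theorem aff_mem_image_iff (i : Fin 2) (z : ℂ) (O : Set ℂ) : aff i z ∈ aff i '' O ↔ z ∈ O :=
  (aff_injective i).mem_set_image

theorem mk_mem_image_aff (i : Fin 2) (O : Set ℂ) {v : Fin 2 → ℂ} (hv : v ≠ 0) :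
    Projectivization.mk ℂ v hv ∈ aff i '' O ↔ v i ≠ 0 ∧ v (1 - i) / v i ∈ O := by
  constructor
  · rintro ⟨z, hz, h⟩
    obtain ⟨c, hc⟩ := (Projectivization.mk_eq_mk_iff' ..).1 h.symm
    have h1 := congrFun hc i
    have h2 := congrFun hc (1 - i)
    simp at h1 h2
    have h0 : v i ≠ 0 := by
      rintro h0
      have hc0 : c = 0 := by rw [h1, h0]
      exact hv (by rw [← hc, hc0, zero_smul])
    refine ⟨h0, ?_⟩
    rw [← h2, h1, mul_div_cancel_left₀ _ h0]
    exact hz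
  · rintro ⟨h0, h1⟩
    exact ⟨_, h1, aff_eq_mk i hv h0⟩

theorem isOpenMap_aff (i : Fin 2) : IsOpenMap (aff i) := by
  intro O hO
  rw [isOpen_coinduced]
  have : (fun v : {v : Fin 2 → ℂ // v ≠ 0} => Projectivization.mk ℂ v.1 v.2) ⁻¹' (aff i '' O) =
      {v | v.1 i ≠ 0 ∧ v.1 (1 - i) / v.1 i ∈ O} := by
    ext v
    exact mk_mem_image_aff i O v.2
  rw [this]
  have h1 : IsOpen {v : {v : Fin 2 → ℂ // v ≠ 0} | v.1 i ≠ 0} :=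
    isOpen_ne_fun ((continuous_apply i).comp continuous_subtype_val) continuous_const
  have h2 : ContinuousOn (fun v : {v : Fin 2 → ℂ // v ≠ 0} => v.1 (1 - i) / v.1 i)
      {v | v.1 i ≠ 0} :=
    ContinuousOn.div ((continuous_apply _).comp continuous_subtype_val).continuousOn
      ((continuous_apply _).comp continuous_subtype_val).continuousOn fun v hv => hv
  exact h2.isOpen_inter_preimage h1 hO

/-- The image of an open subset of the plane under a chart. -/
def chartOpens (i : Fin 2) (O : Opens ℂ) : Opens P1 := ⟨aff i '' O, isOpenMap_aff i _ O.isOpen⟩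

/-- The domain of a chart. -/
def chartDomain (i : Fin 2) : Opens P1 := chartOpens i ⊤

/-- The part of the projective line where the coordinate has absolute value less than two. -/
def chartBall (i : Fin 2) : Opens P1 := chartOpens i ⟨ball 0 2, isOpen_ball⟩

theorem aff_mem_chartDomain (i : Fin 2) (z : ℂ) : aff i z ∈ chartDomain i := ⟨z, trivial, rfl⟩

theorem chartBall_le (i : Fin 2) : chartBall i ≤ chartDomain i := by
  rintro _ ⟨z, _, rfl⟩
  exact aff_mem_chartDomain i z

theorem aff_mem_chartBall (i : Fin 2) (z : ℂ) : aff i z ∈ chartBall i ↔ ‖z‖ < 2 := by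
  rw [← mem_ball_zero_iff]
  exact aff_mem_image_iff i z _

theorem ne_zero_of_aff_mem (i : Fin 2) {z : ℂ} (h : aff (1 - i) z ∈ chartDomain i) : z ≠ 0 := by
  have := ((mk_mem_image_aff i _ (vec_ne_zero (1 - i) z)).1 h).1
  simpa using this

theorem aff_mem_other (i : Fin 2) {z : ℂ} (hz : z ≠ 0) : aff i z ∈ chartDomain (1 - i) := by
  rw [aff_inv i hz]; exact aff_mem_chartDomain _ _

theorem exists_aff (x : P1) : ∃ i z, aff i z = x := by
  induction x using Projectivization.ind with
  | h v hv =>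
    by_cases h0 : v 0 = 0
    · have h1 : v 1 ≠ 0 := fun h1 => hv (fin2_ext 0 h0 h1)
      exact ⟨1, _, aff_eq_mk 1 hv h1⟩
    · exact ⟨0, _, aff_eq_mk 0 hv h0⟩

/-- Any radius above one would do. With radius two the discs overlap in `1/2 < |z| < 2`, the annulus
of `exists_laurent_split`. -/
theorem mem_chartBall_or (x : P1) : x ∈ chartBall 0 ∨ x ∈ chartBall 1 := by
  have key : ∀ (i : Fin 2) z, aff i z ∈ chartBall i ∨ aff i z ∈ chartBall (1 - i) := by
    intro i z
    by_cases hz : ‖z‖ < 2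
    · exact Or.inl ((aff_mem_chartBall i z).2 hz)
    · right
      have h0 : z ≠ 0 := by rintro rfl; simp at hz
      rw [aff_inv i h0, aff_mem_chartBall, norm_inv]
      have : (2 : ℝ) ≤ ‖z‖ := not_lt.1 hz
      have h3 := inv_anti₀ (by norm_num) this
      linarith [show (2 : ℝ)⁻¹ < 2 by norm_num]
  obtain ⟨i, z, rfl⟩ := exists_aff x
  fin_cases i
  · exact key 0 z
  · exact (key 1 z).symm

/-- Holomorphy on an open subset of the domain of a chart can be tested in this chart. -/
theorem holOn_of_le {F : Type} [NormedAddCommGroup F] [NormedSpace ℂ F] {i : Fin 2} {U : Opens P1}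
    (hU : U ≤ chartDomain i) {f : P1 → F}
    (hf : DifferentiableOn ℂ (fun z => f (aff i z)) (aff i ⁻¹' U)) : HolOn U f := by
  intro j
  rcases eq_or_eq_one_sub i j with rfl | rfl
  · exact hf
  · have h0 : ∀ z ∈ aff (1 - i) ⁻¹' (U : Set P1), z ≠ 0 := fun z hz => ne_zero_of_aff_mem i (hU hz)
    have h1 : DifferentiableOn ℂ (fun z => f (aff i z⁻¹)) (aff (1 - i) ⁻¹' U) := by
      refine hf.comp (differentiableOn_inv.mono fun z hz => h0 z hz) fun z hz => ?_
      have := aff_inv (1 - i) (h0 z hz)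
      rw [one_sub_one_sub] at this
      change aff i z⁻¹ ∈ U
      rw [← this]
      exact hz
    refine h1.congr fun z hz => ?_
    rw [aff_inv (1 - i) (h0 z hz), one_sub_one_sub]

/-! ## Sections of `𝒪(n)` in the charts -/

/-- The punctured line is a single `ℂ*`-orbit, so one value determines a homogeneous function. -/
theorem lineFibre_ext {n : ℤ} {x : P1} {f g : lineFibre n x} (v : Punctured x)
    (h : f.1 v = g.1 v) : f = g := by
  refine Subtype.ext (funext fun w => ?_)
  obtain ⟨hv, hv'⟩ := v.2
  obtain ⟨hw, hw'⟩ := w.2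
  obtain ⟨c, hc⟩ := (Projectivization.mk_eq_mk_iff' ..).1 (hw'.trans hv'.symm)
  rw [f.2 c v w hc.symm, g.2 c v w hc.symm, h]

/-- A homogeneous function on `ℂ²`, as a family of elements of the fibres of `𝒪(n)`. -/
def homFam (n : ℤ) (F : (Fin 2 → ℂ) → ℂ) (hF : ∀ c : ℂ, c ≠ 0 → ∀ v, F (c • v) = c ^ n * F v)
    (x : P1) : lineFibre n x :=
  ⟨fun v => F v.1, fun c v w h => by
    have hc : c ≠ 0 := by
      rintro rfl
      obtain ⟨hw, _⟩ := w.2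
      exact hw (by rw [h, zero_smul])
    exact (congrArg F h).trans (hF c hc v.1)⟩

/-- The section of `𝒪(n)` which is given by the function `f` in the chart `i`. -/
def chartSec (i : Fin 2) (n : ℤ) (f : ℂ → ℂ) : ∀ x, lineFibre n x :=
  homFam n (fun v => v i ^ n * f (v (1 - i) / v i)) fun c hc v => by
    simp only [Pi.smul_apply, smul_eq_mul, mul_zpow, mul_div_mul_left _ _ hc]
    ring

/-- The function which describes a section of `𝒪(n)` in the chart `i`. -/
def coord {n : ℤ} (i : Fin 2) (s : ∀ x, lineFibre n x) (z : ℂ) : ℂ := (s (aff i z)).1 (affPoint i z)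

@[simp] theorem coord_chartSec (i : Fin 2) (n : ℤ) (f : ℂ → ℂ) (z : ℂ) :
    coord i (chartSec i n f) z = f z := by
  simp [coord, chartSec, homFam, affPoint]

/-- The points `aff i z` and `aff (1 - i) z⁻¹` are only propositionally equal; carrying `x = y` as a
hypothesis avoids casts between the fibres. -/
theorem lineFibre_homogeneous {n : ℤ} (s : ∀ x, lineFibre n x) {x y : P1} (hxy : x = y)
    (v : Punctured x) (w : Punctured y) (c : ℂ) (h : v.1 = c • w.1) :
    (s x).1 v = c ^ n * (s y).1 w := by
  subst hxy
  exact (s x).2 c w v h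

/-- This is the transition function `zⁿ` of `𝒪(n)`, coming from homogeneity and `(1, z) = z (1/z,
1)`. -/
theorem coord_inv {n : ℤ} (i : Fin 2) (s : ∀ x, lineFibre n x) {z : ℂ} (hz : z ≠ 0) :
    coord i s z = z ^ n * coord (1 - i) s z⁻¹ :=
  lineFibre_homogeneous s (aff_inv i hz) _ _ z (vec_eq_smul i hz)

theorem eq_of_coord_eq {n : ℤ} (i : Fin 2) {s t : ∀ x, lineFibre n x} {z : ℂ}
    (h : coord i s z = coord i t z) : s (aff i z) = t (aff i z) := lineFibre_ext _ h

theorem mem_sec_iff {n : ℤ} {U : Opens P1} {s : ∀ x, lineFibre n x} :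
    s ∈ (lineBundle n).sec U ↔ ∀ i, DifferentiableOn ℂ (coord i s) (aff i ⁻¹' U) := Iff.rfl

/-- Holomorphy over an open subset of the domain of a chart can be tested in this chart. -/
theorem mem_sec_of_le {n : ℤ} {i : Fin 2} {U : Opens P1} (hU : U ≤ chartDomain i)
    {s : ∀ x, lineFibre n x} (hs : DifferentiableOn ℂ (coord i s) (aff i ⁻¹' U)) :
    s ∈ (lineBundle n).sec U := by
  rw [mem_sec_iff]
  intro j
  rcases eq_or_eq_one_sub i j with rfl | rfl
  · exact hs
  · have h0 : ∀ z ∈ aff (1 - i) ⁻¹' (U : Set P1), z ≠ 0 := fun z hz => ne_zero_of_aff_mem i (hU hz)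
    have h1 : DifferentiableOn ℂ (fun z => z ^ n * coord i s z⁻¹) (aff (1 - i) ⁻¹' U) := by
      refine DifferentiableOn.mul (fun z hz => ?_) ?_
      · exact (differentiableAt_zpow.2 (Or.inl (h0 z hz))).differentiableWithinAt
      refine hs.comp (differentiableOn_inv.mono fun z hz => h0 z hz) fun z hz => ?_
      have := aff_inv (1 - i) (h0 z hz)
      rw [one_sub_one_sub] at this
      change aff i z⁻¹ ∈ U
      rw [← this]
      exact hz
    refine h1.congr fun z hz => ?_
    rw [coord_inv (1 - i) s (h0 z hz), one_sub_one_sub]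

/-! ## Homomorphisms between the line bundles `𝒪(n)` -/

/-- The form of degree `d` with given coefficients. -/
def formOfCoeffs (d : ℕ) (f : ℕ → ℂ) : Forms d :=
  ⟨∑ j ∈ Finset.range (d + 1), MvPolynomial.C (f j) *
      (MvPolynomial.X 0 ^ (d - j) * MvPolynomial.X 1 ^ j), by
    refine Submodule.sum_mem _ fun j hj => ?_
    have hj' : j ≤ d := by have := Finset.mem_range.1 hj; omega
    rw [MvPolynomial.mem_homogeneousSubmodule]
    have h := ((MvPolynomial.isHomogeneous_X_pow (R := ℂ) (0 : Fin 2) (d - j)).mul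
      (MvPolynomial.isHomogeneous_X_pow (R := ℂ) (1 : Fin 2) j)).C_mul (f j)
    rwa [Nat.sub_add_cancel hj'] at h⟩

theorem eval_formOfCoeffs (d : ℕ) (f : ℕ → ℂ) (v : Fin 2 → ℂ) :
    MvPolynomial.eval v (formOfCoeffs d f).1 =
      ∑ j ∈ Finset.range (d + 1), f j * (v 0 ^ (d - j) * v 1 ^ j) := by
  simp [formOfCoeffs, map_sum]

theorem eval_form_smul {d : ℕ} (Q : Forms d) (c : ℂ) (v : Fin 2 → ℂ) :
    MvPolynomial.eval (c • v) Q.1 = c ^ d * MvPolynomial.eval v Q.1 := by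
  have h : (Q.1).IsHomogeneous d := Q.2
  rw [MvPolynomial.eval_eq', MvPolynomial.eval_eq', Finset.mul_sum]
  refine Finset.sum_congr rfl fun e he => ?_
  have hd : ∑ i, e i = d := by
    have := h (MvPolynomial.mem_support_iff.1 he)
    rw [← this, Finsupp.weight_apply, Finsupp.sum_fintype _ _ (by simp)]
    simp
  simp only [Pi.smul_apply, smul_eq_mul, mul_pow, Finset.prod_mul_distrib,
    Finset.prod_pow_eq_pow_sum, hd]
  ring

theorem differentiable_eval_vec (P : MvPolynomial (Fin 2) ℂ) (i : Fin 2) :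
    Differentiable ℂ (fun z => MvPolynomial.eval (vec i z) P) := by
  simp only [MvPolynomial.eval_eq]
  refine Differentiable.fun_sum fun e _ => (Differentiable.fun_finsetProd fun j _ => ?_).const_mul _
  refine Differentiable.pow ?_ _
  rcases eq_or_eq_one_sub i j with rfl | rfl <;> simp

/-- Multiplication by a form of degree `d`, as a morphism `𝒪(n) → 𝒪(n + d)`. -/
def mulHom {n m : ℤ} {d : ℕ} (h : m = n + d) (Q : Forms d) : (lineBundle n).Hom (lineBundle m) where
  app x :=
    { toFun := fun f => ⟨fun v => MvPolynomial.eval v.1 Q.1 * f.1 v, fun c v w hw => by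
        have hc : c ≠ 0 := by
          rintro rfl
          obtain ⟨hw', _⟩ := w.2
          exact hw' (by rw [hw, zero_smul])
        have h1 : MvPolynomial.eval w.1 Q.1 = c ^ d * MvPolynomial.eval v.1 Q.1 :=
          (congrArg (fun u => MvPolynomial.eval u Q.1) hw).trans (eval_form_smul Q c v.1)
        have h2 : c ^ m = c ^ n * c ^ d := by rw [h, zpow_add₀ hc, zpow_natCast]
        change MvPolynomial.eval w.1 Q.1 * f.1 w = c ^ m * (MvPolynomial.eval v.1 Q.1 * f.1 v)
        linear_combination f.1 w * h1 + c ^ d * MvPolynomial.eval v.1 Q.1 * f.2 c v w hw -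
          MvPolynomial.eval v.1 Q.1 * f.1 v * h2⟩
      map_add' := fun f g => Subtype.ext (funext fun v => mul_add _ _ _)
      map_smul' := fun k f => Subtype.ext (funext fun v => mul_left_comm _ _ _) }
  map_sec U s hs i := by
    exact DifferentiableOn.mul (differentiable_eval_vec Q.1 i).differentiableOn (hs i)

/-- Outside the chart `v i = 0`, and `chartSec` takes a meaningless value coming from division by
zero; hence the restriction on `U`. -/
theorem chartSec_mem (i : Fin 2) (n : ℤ) {f : ℂ → ℂ} {U : Opens P1} (hU : U ≤ chartDomain i)
    (hf : DifferentiableOn ℂ f (aff i ⁻¹' U)) : chartSec i n f ∈ (lineBundle n).sec U :=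
  mem_sec_of_le hU (hf.congr fun z _ => coord_chartSec i n f z)

section Hom

variable {n m : ℤ} (φ : (lineBundle n).Hom (lineBundle m))

/-- The function which describes a morphism between line bundles in a chart. -/
def homCoord (i : Fin 2) (z : ℂ) : ℂ :=
  coord (n := m) i (fun x => φ.app x (chartSec i n (fun _ => 1) x)) z

theorem differentiable_homCoord (i : Fin 2) : Differentiable ℂ (homCoord φ i) := by
  have h := mem_sec_iff.1 (φ.map_sec (chartDomain i) _
    (chartSec_mem i n (f := fun _ => 1) le_rfl (differentiableOn_const 1))) i
  have e : aff i ⁻¹' (chartDomain i : Set P1) = univ :=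
    eq_univ_of_forall fun z => aff_mem_chartDomain i z
  rw [e] at h
  exact differentiableOn_univ.1 h

theorem coord_hom (i : Fin 2) (s : ∀ x, lineFibre n x) (z : ℂ) :
    coord (n := m) i (fun x => φ.app x (s x)) z = homCoord φ i z * coord i s z := by
  have h : s (aff i z) = coord i s z • chartSec i n (fun _ => 1) (aff i z) := by
    refine lineFibre_ext (affPoint i z) ?_
    change coord i s z = coord i s z * coord i (chartSec i n (fun _ => 1)) z
    rw [coord_chartSec, mul_one]
  have h2 : φ.app (aff i z) (s (aff i z)) =
      coord i s z • φ.app (aff i z) (chartSec i n (fun _ => 1) (aff i z)) :=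
    (congrArg (φ.app (aff i z)) h).trans ((φ.app (aff i z)).map_smul _ _)
  change (show lineFibre m _ from φ.app (aff i z) (s (aff i z))).1 (affPoint i z) = _
  rw [h2]
  exact mul_comm _ _

/-- A morphism `𝒪(n) → 𝒪(m)` is a section of `𝒪(m - n)`, and this is its transition rule. -/
theorem homCoord_inv (i : Fin 2) {z : ℂ} (hz : z ≠ 0) :
    homCoord φ i z = z ^ (m - n) * homCoord φ (1 - i) z⁻¹ := by
  have h := coord_inv (n := m) i (fun x => φ.app x (chartSec i n (fun _ => 1) x)) hz
  have h2 := coord_inv (n := n) i (chartSec i n (fun _ => 1)) hz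
  rw [coord_chartSec] at h2
  rw [coord_hom φ (1 - i)] at h
  change homCoord φ i z = _ at h
  rw [h, zpow_sub₀ hz, div_mul_eq_mul_div, eq_div_iff (zpow_ne_zero _ hz)]
  linear_combination -z ^ m * homCoord φ (1 - i) z⁻¹ * h2

theorem hom_app_eq_of_homCoord_eq {φ ψ : (lineBundle n).Hom (lineBundle m)}
    (h : ∀ i z, homCoord φ i z = homCoord ψ i z) (x : P1) (f : lineFibre n x) :
    φ.app x f = ψ.app x f := by
  obtain ⟨i, z, rfl⟩ := exists_aff x
  have e : f = chartSec i n (fun _ => f.1 (affPoint i z)) (aff i z) := by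
    refine lineFibre_ext (affPoint i z) ?_
    exact (coord_chartSec i n (fun _ => f.1 (affPoint i z)) z).symm
  rw [e]
  refine lineFibre_ext (affPoint i z) ?_
  have h1 := coord_hom φ i (chartSec i n (fun _ => f.1 (affPoint i z))) z
  have h2 := coord_hom ψ i (chartSec i n (fun _ => f.1 (affPoint i z))) z
  rw [h, ← h2] at h1
  exact h1

/-- The bundle `𝒪(m - n)` has negative degree: in a chart, a section is an entire function tending
to zero at infinity. -/
theorem hom_eq_zero (hmn : m < n) (x : P1) (f : lineFibre n x) : φ.app x f = 0 := by
  have h0 : ∀ i z, homCoord φ i z = 0 := by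
    intro i
    refine eq_zero_of_inversion (differentiable_homCoord φ i) (differentiable_homCoord φ (1 - i))
      (k := (n - m).toNat) (by omega) fun z hz => ?_
    rw [homCoord_inv φ i hz, inv_pow, ← zpow_natCast, ← zpow_neg]
    congr 2
    omega
  let ψ : (lineBundle n).Hom (lineBundle m) := ⟨fun _ => 0, fun U s _ => Submodule.zero_mem _⟩
  have := hom_app_eq_of_homCoord_eq (φ := φ) (ψ := ψ) (fun i z => (h0 i z).trans rfl) x f
  exact this

/-- All morphisms `𝒪(n) → 𝒪(n + d)` are multiplications by forms of degree `d`. -/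
theorem exists_form_of_hom {d : ℕ} (h : m = n + d) : ∃ Q : Forms d, ∀ (x : P1) (f : lineFibre n x),
    φ.app x f = (mulHom h Q).app x f := by
  have hd : m - n = d := by omega
  obtain ⟨f, hf⟩ := eq_sum_of_inversion (differentiable_homCoord φ 0) (differentiable_homCoord φ 1)
    (k := d) fun z hz => by
      have := homCoord_inv φ 0 hz
      rwa [hd, zpow_natCast] at this
  refine ⟨formOfCoeffs d f, hom_app_eq_of_homCoord_eq fun i z => ?_⟩
  have hQ : ∀ (i : Fin 2) z, homCoord (mulHom h (formOfCoeffs d f)) i z =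
      MvPolynomial.eval (vec i z) (formOfCoeffs d f).1 := by
    intro i z
    have : homCoord (mulHom h (formOfCoeffs d f)) i z =
      MvPolynomial.eval (vec i z) (formOfCoeffs d f).1 * coord i (chartSec i n (fun _ => 1)) z := rfl
    rw [this, coord_chartSec, mul_one]
  have h0 : ∀ z, homCoord φ 0 z = homCoord (mulHom h (formOfCoeffs d f)) 0 z := by
    intro z
    rw [hQ, hf, eval_formOfCoeffs]
    simp [vec]
  have h1 : ∀ z, homCoord φ 1 z = homCoord (mulHom h (formOfCoeffs d f)) 1 z := by
    -- The transition rule gives the equality away from the origin of the second chart, continuity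
    -- gives it there.
    have hc := (differentiable_homCoord φ 1).continuous.ext_on (dense_compl_singleton (0 : ℂ))
      (differentiable_homCoord (mulHom h (formOfCoeffs d f)) 1).continuous ?_
    · exact fun z => congrFun hc z
    · intro z hz
      have hz' : z ≠ 0 := hz
      rw [homCoord_inv φ 1 hz', homCoord_inv _ 1 hz']
      exact congrArg _ (h0 _)
  fin_cases i
  · exact h0 z
  · exact h1 z

end Hom

theorem eval_form_vec {d : ℕ} (Q : Forms d) {z : ℂ} (hz : z ≠ 0) :
    MvPolynomial.eval (vec 0 z) Q.1 = z ^ d * MvPolynomial.eval (vec 1 z⁻¹) Q.1 := by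
  rw [vec_eq_smul 0 hz, eval_form_smul]
  rfl

/-- A form is determined by its values on an affine line. -/
theorem form_ext {d : ℕ} {P Q : Forms d}
    (h : ∀ z, MvPolynomial.eval (vec 0 z) P.1 = MvPolynomial.eval (vec 0 z) Q.1) : P = Q := by
  -- The hypothesis is silent on the line `X₀ = 0`. The factor `X₀` makes both sides vanish there
  -- and can be cancelled afterwards.
  have h1 : P.1 * MvPolynomial.X 0 = Q.1 * MvPolynomial.X 0 := by
    refine MvPolynomial.funext fun v => ?_
    rw [map_mul, map_mul, MvPolynomial.eval_X]
    by_cases hv : v 0 = 0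
    · simp [hv]
    · have e : v = v 0 • vec 0 (v 1 / v 0) := by
        refine fin2_ext 0 ?_ ?_
        · simp
        · simp [vec, mul_div_cancel₀ _ hv]
      rw [e, eval_form_smul, eval_form_smul, h]
  exact Subtype.ext (mul_right_cancel₀ (MvPolynomial.X_ne_zero 0) h1)

/-- The function `P(1, z)` is entire and satisfies the transition rule of degree `d`, so
`eq_sum_of_inversion` supplies the coefficients without a monomial computation. -/
theorem exists_eq_formOfCoeffs {d : ℕ} (P : Forms d) : ∃ f, P = formOfCoeffs d f := by
  obtain ⟨f, hf⟩ := eq_sum_of_inversion (differentiable_eval_vec P.1 0)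
    (differentiable_eval_vec P.1 1) fun z hz => eval_form_vec P hz
  refine ⟨f, form_ext fun z => ?_⟩
  rw [hf, eval_formOfCoeffs]
  simp [vec]

/-! ## The first cohomology of `𝒪(n)` -/

theorem SectionSheaf.H1.mk_surjective (S : SectionSheaf) :
    Function.Surjective (SectionSheaf.H1.mk S) := Submodule.mkQ_surjective _

theorem SectionSheaf.H1.mk_eq_zero_iff {S : SectionSheaf} {c : S.Z1} :
    SectionSheaf.H1.mk S c = 0 ↔ c.1 ∈ S.B1 :=
  (Submodule.Quotient.mk_eq_zero _).trans Iff.rfl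

theorem SectionSheaf.H1.mk_eq_mk_iff {S : SectionSheaf} {c c' : S.Z1} :
    SectionSheaf.H1.mk S c = SectionSheaf.H1.mk S c' ↔ c.1 - c'.1 ∈ S.B1 := by
  rw [← sub_eq_zero, ← map_sub, SectionSheaf.H1.mk_eq_zero_iff]
  rfl

/-- The intersection of the domains of the two charts. -/
def overlap : Opens P1 := chartDomain 0 ⊓ chartDomain 1

open Classical in
/-- The number of a chart which contains a given point. -/
def chartIndex (p : P1) : Fin 2 := if p ∈ chartBall 0 then 0 else 1

theorem mem_chartBall_chartIndex (p : P1) : p ∈ chartBall (chartIndex p) := by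
  unfold chartIndex
  split_ifs with h
  · exact h
  · exact (mem_chartBall_or p).resolve_left h

/-- The chart number as a complex number. -/
def chartNum (p : P1) : ℂ := if chartIndex p = 0 then 0 else 1

theorem chartIndex_cases (p q : P1) : (chartIndex p = 0 ∨ chartIndex p = 1) ∧
    (chartIndex q = 0 ∨ chartIndex q = 1) :=
  ⟨eq_or_eq_one_sub 0 _, eq_or_eq_one_sub 0 _⟩

/-- A section over the intersection of the domains of the charts defines a cocycle. -/
def overlapCocycle (S : SectionSheaf) : S.sec overlap →ₗ[ℂ] S.Z1 where
  -- The factor is `1` from chart 0 to chart 1, `-1` in the other direction and `0` within one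
  -- chart. Being a difference, it satisfies the cocycle identity.
  toFun s := ⟨fun p q => (chartNum q - chartNum p) • s.1, fun p => chartDomain (chartIndex p),
    fun p => chartBall_le _ (mem_chartBall_chartIndex p), fun p q => by
      change _ ∈ S.sec (chartDomain (chartIndex p) ⊓ chartDomain (chartIndex q))
      obtain ⟨hp | hp, hq | hq⟩ := chartIndex_cases p q
      · simp [chartNum, hp, hq]
      · rw [hp, hq]
        exact Submodule.smul_mem _ _ s.2
      · rw [hp, hq, inf_comm]
        exact Submodule.smul_mem _ _ s.2
      · simp [chartNum, hp, hq], fun p q r x _ _ _ => by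
      simp only [Pi.smul_apply]
      module⟩
  map_add' s t := Subtype.ext (funext fun p => funext fun q => smul_add _ _ _)
  map_smul' k s := Subtype.ext (funext fun p => funext fun q => smul_comm _ _ _)

/-- The connecting map of the Mayer-Vietoris sequence of the covering by the two charts. -/
def overlapClass (S : SectionSheaf) : S.sec overlap →ₗ[ℂ] S.H1 :=
  SectionSheaf.H1.mk S ∘ₗ overlapCocycle S

/-- The sections over the intersection of the domains of the charts with trivial class. -/
theorem exists_sub_of_overlapClass_eq_zero {S : SectionSheaf} {s : S.sec overlap}
    (h : overlapClass S s = 0) : ∃ s₀ ∈ S.sec (chartDomain 0), ∃ s₁ ∈ S.sec (chartDomain 1),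
      s.1 = s₁ - s₀ := by
  obtain ⟨U, hU, σ, hσ, hc⟩ := SectionSheaf.H1.mk_eq_zero_iff.1 h
  have hc' : ∀ p q x, x ∈ U p → x ∈ U q →
    (chartNum q - chartNum p) • s.1 x = σ q x - σ p x := hc
  -- The sections `σ p - chartNum p • s` agree on overlaps and glue to `s₀`. It is holomorphic on
  -- chart 0 because a term involving `s` occurs only inside the overlap; the same holds for `s₀ +
  -- s` on chart 1.
  let s₀ : ∀ x, S.Fib x := fun x => σ x x - chartNum x • s.1 x
  have key : ∀ p x, x ∈ U p → s₀ x = σ p x - chartNum p • s.1 x := by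
    intro p x hx
    have h1 := hc' p x x hx (hU x)
    simp only [s₀]
    rw [sub_smul] at h1
    rw [sub_eq_sub_iff_sub_eq_sub, ← h1]
  refine ⟨s₀, S.sec_local _ _ fun x hx => ?_, s₀ + s.1, S.sec_local _ _ fun x hx => ?_, by simp⟩
  · rcases eq_or_eq_one_sub 0 (chartIndex x) with h0 | h0
    · refine ⟨U x, hU x, σ x, hσ x, fun y hy => ?_⟩
      rw [key x y hy]; simp [chartNum, h0]
    · have hx1 := chartBall_le _ (mem_chartBall_chartIndex x)
      rw [h0] at hx1
      refine ⟨U x ⊓ overlap, ⟨hU x, hx, hx1⟩, σ x - chartNum x • s.1,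
        Submodule.sub_mem _ (S.mono inf_le_left (hσ x))
          (Submodule.smul_mem _ _ (S.mono inf_le_right s.2)), fun y hy => ?_⟩
      rw [key x y hy.1]; rfl
  · rcases eq_or_eq_one_sub 0 (chartIndex x) with h0 | h0
    · have hx1 := chartBall_le _ (mem_chartBall_chartIndex x)
      rw [h0] at hx1
      refine ⟨U x ⊓ overlap, ⟨hU x, hx1, hx⟩, σ x - chartNum x • s.1 + s.1,
        Submodule.add_mem _ (Submodule.sub_mem _ (S.mono inf_le_left (hσ x))
          (Submodule.smul_mem _ _ (S.mono inf_le_right s.2))) (S.mono inf_le_right s.2),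
        fun y hy => ?_⟩
      rw [Pi.add_apply, Pi.add_apply, key x y hy.1]; rfl
    · refine ⟨U x, hU x, σ x, hσ x, fun y hy => ?_⟩
      rw [Pi.add_apply, key x y hy]; simp [chartNum, h0]

/-- The section of `𝒪(n)` with principal part `∑ b_j z^{-(j+1)}`, `0 ≤ j ≤ l`. -/
def laurentSec (n : ℤ) (l : ℕ) (b : ℕ → ℂ) : (lineBundle n).sec overlap :=
  ⟨chartSec 0 n (fun z => ∑ j ∈ Finset.range (l + 1), b j * z⁻¹ ^ (j + 1)),
    chartSec_mem 0 n inf_le_left (by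
      refine DifferentiableOn.fun_sum fun j _ => ((differentiableOn_inv.mono ?_).pow _).const_mul _
      intro z hz
      exact ne_zero_of_aff_mem 1 hz.2)⟩

theorem coord_laurentSec (n : ℤ) (l : ℕ) (b : ℕ → ℂ) (z : ℂ) :
    coord (n := n) 0 (laurentSec n l b).1 z = ∑ j ∈ Finset.range (l + 1), b j * z⁻¹ ^ (j + 1) :=
  coord_chartSec 0 n (fun z => ∑ j ∈ Finset.range (l + 1), b j * z⁻¹ ^ (j + 1)) z

theorem coord_chartSec_inv (i : Fin 2) (n : ℤ) (f : ℂ → ℂ) {z : ℂ} (hz : z ≠ 0) :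
    coord i (chartSec (1 - i) n f) z = z ^ n * f z⁻¹ := by
  rw [coord_inv i _ hz, coord_chartSec]

theorem coord_sub {n : ℤ} (i : Fin 2) (s t : ∀ x, lineFibre n x) (z : ℂ) :
    coord i (s - t) z = coord i s z - coord i t z := rfl

/-- Every class in `H¹(𝒪(-2-l))` is represented by a principal part of degree at most `l + 1`. -/
theorem exists_laurentSec {n : ℤ} {l : ℕ} (hn : n = -2 - l) (h : (lineBundle n).H1) :
    ∃ b, overlapClass (lineBundle n) (laurentSec n l b) = h := by
  obtain ⟨⟨c, U, hU, hc, hcc⟩, rfl⟩ := SectionSheaf.H1.mk_surjective _ h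
  have hcc' : ∀ i p q r z, aff i z ∈ U p → aff i z ∈ U q → aff i z ∈ U r →
      coord (n := n) i (c p r) z = coord (n := n) i (c p q) z + coord (n := n) i (c q r) z := by
    intro i p q r z hp hq hr
    have := congrArg (fun f : lineFibre n (aff i z) => f.1 (affPoint i z)) (hcc p q r _ hp hq hr)
    exact this
  have hsp : ∀ i : Fin 2, ∃ t : P1 → ℂ → ℂ,
      (∀ p, DifferentiableOn ℂ (t p) (aff i ⁻¹' (U p : Set P1) ∩ ball 0 3)) ∧
      ∀ p q, ∀ z ∈ ball (0 : ℂ) 3, aff i z ∈ U p → aff i z ∈ U q →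
        coord (n := n) i (c p q) z = t q z - t p z := by
    intro i
    exact splitsOn_ball (U := fun p => aff i ⁻¹' (U p : Set P1))
      (f := fun p q => coord (n := n) i (c p q))
      (fun p => (U p).isOpen.preimage (continuous_aff i)) (fun z => ⟨aff i z, hU _⟩)
      (fun p q => mem_sec_iff.1 (hc p q) i) (hcc' i) (by norm_num)
  choose t ht htc using hsp
  -- In each chart the cocycle splits on the disc of radius 3. The difference of the two splittings,
  -- written in chart 0, does not depend on the index `p`, so it is one holomorphic function on the
  -- annulus.
  let g : ℂ → ℂ := fun z => z ^ n * t 1 (aff 0 z) z⁻¹ - t 0 (aff 0 z) z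
  have hball : ∀ z : ℂ, 3⁻¹ < ‖z‖ → ‖z‖ < 3 → z ≠ 0 ∧ z ∈ ball (0 : ℂ) 3 ∧ z⁻¹ ∈ ball (0 : ℂ) 3 := by
    intro z h1 h2
    refine ⟨?_, by simpa using h2, ?_⟩
    · rintro rfl; norm_num at h1
    · rw [mem_ball_zero_iff, norm_inv]
      exact inv_lt_of_inv_lt₀ (by norm_num) h1
  have hg : ∀ p z, 3⁻¹ < ‖z‖ → ‖z‖ < 3 → aff 0 z ∈ U p → g z = z ^ n * t 1 p z⁻¹ - t 0 p z := by
    intro p z h1 h2 hp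
    obtain ⟨hz0, hz, hz'⟩ := hball z h1 h2
    have hz1 : aff 0 z = aff 1 z⁻¹ := aff_inv 0 hz0
    have e0 := htc 0 p (aff 0 z) z hz hp (hU _)
    have e1 := htc 1 p (aff 0 z) z⁻¹ hz' (by rw [← hz1]; exact hp)
      (by rw [← hz1]; exact hU _)
    have e2 := coord_inv (n := n) 0 (c p (aff 0 z)) hz0
    rw [e0] at e2
    change _ = _ * coord (n := n) 1 (c p (aff 0 z)) z⁻¹ at e2
    rw [e1] at e2
    simp only [g]
    linear_combination -e2
  have hopen : IsOpen {z : ℂ | 3⁻¹ < ‖z‖ ∧ ‖z‖ < 3} :=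
    (isOpen_lt continuous_const continuous_norm).inter (isOpen_lt continuous_norm continuous_const)
  have hgd : DifferentiableOn ℂ g {z | 3⁻¹ < ‖z‖ ∧ ‖z‖ < 3} := by
    intro z hz
    have hz' := hball z hz.1 hz.2
    have ho : ∀ i : Fin 2, IsOpen (aff i ⁻¹' (U (aff 0 z) : Set P1) ∩ ball 0 3) := fun i =>
      ((U _).isOpen.preimage (continuous_aff i)).inter isOpen_ball
    have d0 : DifferentiableAt ℂ (t 0 (aff 0 z)) z :=
      (ht 0 (aff 0 z)).differentiableAt ((ho 0).mem_nhds ⟨hU _, hz'.2.1⟩)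
    have d1 : DifferentiableAt ℂ (t 1 (aff 0 z)) z⁻¹ :=
      (ht 1 (aff 0 z)).differentiableAt ((ho 1).mem_nhds
        ⟨by change aff (1 - 0) z⁻¹ ∈ U (aff 0 z); rw [← aff_inv 0 hz'.1]; exact hU _, hz'.2.2⟩)
    have d2 : DifferentiableAt ℂ (fun w => w ^ n * t 1 (aff 0 z) w⁻¹ - t 0 (aff 0 z) w) z :=
      ((differentiableAt_zpow.2 (Or.inl hz'.1)).mul
        (d1.comp z (differentiableAt_inv hz'.1))).sub d0
    refine (d2.congr_of_eventuallyEq ?_).differentiableWithinAt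
    filter_upwards [hopen.mem_nhds hz, ((U (aff 0 z)).isOpen.preimage (continuous_aff 0)).mem_nhds
      (hU (aff 0 z))] with w hw hw'
    exact hg _ w hw.1 hw.2 hw'
  obtain ⟨a, b, ha, hb, hab⟩ := exists_laurent_split hgd
  -- The order `l + 2 = -n` is the one for which the remainder `z^(-l-2) H(1/z) = zⁿ H(1/z)` is a
  -- section near infinity. The constant term is absorbed by `a`, so only `z⁻¹, …, z^(-l-1)`
  -- survive.
  obtain ⟨f, H, hH, hf⟩ := exists_taylor (ball_mem_nhds (0 : ℂ) (by norm_num : (0 : ℝ) < 2))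
    (l + 2) hb
  let L : ℂ → ℂ := fun z => ∑ j ∈ Finset.range (l + 1), f (j + 1) * z⁻¹ ^ (j + 1)
  have hsplit : ∀ z : ℂ, 2⁻¹ < ‖z‖ → ‖z‖ < 2 → g z = (a z + f 0) + L z + z ^ n * H z⁻¹ := by
    intro z h1 h2
    rw [hab z h1 h2, hf, Finset.sum_range_succ']
    have hzn : z⁻¹ ^ (l + 2) = z ^ n := by
      rw [inv_pow, ← zpow_natCast, ← zpow_neg, hn]
      congr 1
      push_cast
      ring
    rw [hzn]
    simp only [L]
    ring
  -- From chart 0 to chart 1 the cocycle is the new coboundary minus `L`, which explains the sign.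
  refine ⟨fun j => -f (j + 1), ?_⟩
  symm
  refine SectionSheaf.H1.mk_eq_mk_iff.2 ?_
  let u : Fin 2 → P1 → ℂ → ℂ := ![fun p z => t 0 p z + (a z + f 0), fun p z => t 1 p z - H z]
  have hsum : ∀ z, ∑ j ∈ Finset.range (l + 1), -f (j + 1) * z⁻¹ ^ (j + 1) = -L z := by
    intro z; simp [L]
  have hmix : ∀ z : ℂ, ‖z‖ < 2 → aff 0 z ∈ chartBall 1 → ∀ p q, aff 0 z ∈ U p → aff 0 z ∈ U q →
      z ≠ 0 ∧ coord (n := n) 0 (c p q) z + L z =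
        z ^ n * (t 1 q z⁻¹ - H z⁻¹) - (t 0 p z + (a z + f 0)) := by
    intro z h2 hz1 p q hp hq
    have h0 : z ≠ 0 := ne_zero_of_aff_mem 1 (chartBall_le _ hz1)
    rw [aff_inv 0 h0] at hz1
    have h1 : 2⁻¹ < ‖z‖ := by
      have := (aff_mem_chartBall 1 z⁻¹).1 hz1
      rw [norm_inv] at this
      exact inv_lt_of_inv_lt₀ (norm_pos_iff.2 h0) this
    have h3 : (3 : ℝ)⁻¹ < 2⁻¹ := by norm_num
    have e1 := hg q z (by linarith) (by linarith) hq
    have e2 := htc 0 p q z (by rw [mem_ball_zero_iff]; linarith) hp hq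
    refine ⟨h0, ?_⟩
    rw [e2]
    linear_combination e1 - hsplit z h1 h2
  refine ⟨fun p => U p ⊓ chartBall (chartIndex p), fun p => ⟨hU p, mem_chartBall_chartIndex p⟩,
    fun p => chartSec (chartIndex p) n (u (chartIndex p) p), fun p => ?_, fun p q x hp hq => ?_⟩
  · refine chartSec_mem _ _ (inf_le_right.trans (chartBall_le _)) ?_
    have hsub : ∀ i, ∀ z ∈ aff i ⁻¹' ((U p ⊓ chartBall i : Opens P1) : Set P1),
        z ∈ aff i ⁻¹' (U p : Set P1) ∩ ball 0 3 ∧ z ∈ ball (0 : ℂ) 2 := by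
      intro i z hz
      have h2 := (aff_mem_chartBall i z).1 hz.2
      exact ⟨⟨hz.1, by rw [mem_ball_zero_iff]; linarith⟩, by rwa [mem_ball_zero_iff]⟩
    change DifferentiableOn ℂ (u (chartIndex p) p)
      (aff (chartIndex p) ⁻¹' ((U p ⊓ chartBall (chartIndex p) : Opens P1) : Set P1))
    rcases (chartIndex_cases p p).1 with h0 | h0 <;> rw [h0]
    · exact ((ht 0 p).mono fun z hz => (hsub _ z hz).1).add
        ((ha.mono fun z hz => (hsub _ z hz).2).add_const _)
    · exact ((ht 1 p).mono fun z hz => (hsub _ z hz).1).sub (hH.mono fun z hz => (hsub _ z hz).2)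
  · have hnum : ∀ p, (chartIndex p = 0 → chartNum p = 0) ∧ (chartIndex p = 1 → chartNum p = 1) :=
      fun p => ⟨fun h => by simp [chartNum, h], fun h => by simp [chartNum, h]⟩
    change (c p q - (chartNum q - chartNum p) • (laurentSec n l fun j => -f (j + 1)).1) x =
      (chartSec (chartIndex q) n (u (chartIndex q) q) -
        chartSec (chartIndex p) n (u (chartIndex p) p)) x
    have hcinv : ∀ (v : ℂ → ℂ) z, z ≠ 0 → coord 0 (chartSec 1 n v) z = z ^ n * v z⁻¹ :=
      fun v z hz => coord_chartSec_inv 0 n v hz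
    have h3 : ∀ z : ℂ, ‖z‖ < 2 → z ∈ ball (0 : ℂ) 3 := fun z hz => by
      rw [mem_ball_zero_iff]; linarith
    obtain ⟨hp, hp'⟩ := hp
    obtain ⟨hq, hq'⟩ := hq
    obtain ⟨h0 | h1, h0' | h1'⟩ := chartIndex_cases p q
    · rw [(hnum p).1 h0, (hnum q).1 h0', h0, h0', sub_zero, zero_smul, sub_zero]
      rw [h0] at hp'
      obtain ⟨z, hz, rfl⟩ := hp'
      refine eq_of_coord_eq 0 ?_
      rw [coord_sub, coord_chartSec, coord_chartSec, htc 0 p q z (h3 z (by simpa using hz)) hp hq]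
      change _ = (t 0 q z + (a z + f 0)) - (t 0 p z + (a z + f 0))
      ring
    · rw [(hnum p).1 h0, (hnum q).2 h1', h0, h1', sub_zero, one_smul]
      rw [h0] at hp'
      rw [h1'] at hq'
      obtain ⟨z, hz, rfl⟩ := hp'
      obtain ⟨hz0, h4⟩ := hmix z (by simpa using hz) hq' p q hp hq
      refine eq_of_coord_eq 0 ?_
      rw [coord_sub, coord_chartSec, hcinv _ z hz0]
      change coord (n := n) 0 (c p q) z - coord (n := n) 0 (laurentSec n l _).1 z =
        z ^ n * (t 1 q z⁻¹ - H z⁻¹) - (t 0 p z + (a z + f 0))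
      rw [coord_laurentSec, hsum]
      linear_combination h4
    · rw [(hnum p).2 h1, (hnum q).1 h0', h1, h0', zero_sub, neg_smul, one_smul, sub_neg_eq_add]
      rw [h1] at hp'
      rw [h0'] at hq'
      obtain ⟨z, hz, rfl⟩ := hq'
      obtain ⟨hz0, h4⟩ := hmix z (by simpa using hz) hp' q p hq hp
      refine eq_of_coord_eq 0 ?_
      rw [coord_sub, coord_chartSec, hcinv _ z hz0]
      change coord (n := n) 0 (c p q) z + coord (n := n) 0 (laurentSec n l _).1 z =
        (t 0 q z + (a z + f 0)) - z ^ n * (t 1 p z⁻¹ - H z⁻¹)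
      -- These two instances of the cocycle identity give `c p q = -c q p`.
      have h5 := hcc' 0 p q p z hp hq hp
      have h6 := hcc' 0 p p p z hp hp hp
      rw [coord_laurentSec, hsum]
      linear_combination -h4 - h5 - h6
    · rw [(hnum p).2 h1, (hnum q).2 h1', h1, h1', sub_self, zero_smul, sub_zero]
      rw [h1] at hp'
      obtain ⟨z, hz, rfl⟩ := hp'
      refine eq_of_coord_eq 1 ?_
      rw [coord_sub, coord_chartSec, coord_chartSec, htc 1 p q z (h3 z (by simpa using hz)) hp hq]
      change _ = (t 1 q z - H z) - (t 1 p z - H z)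
      ring

/-! ### The residue pairing and Serre duality. -/

theorem circleIntegrable_residue {n : ℤ} {l : ℕ} (s : (lineBundle n).sec overlap) (P : Forms l) :
    CircleIntegrable (fun z => coord (n := n) 0 s.1 z * MvPolynomial.eval (vec 0 z) P.1) 0 1 := by
  refine ContinuousOn.circleIntegrable zero_le_one (ContinuousOn.mul ?_
    (differentiable_eval_vec P.1 0).continuous.continuousOn)
  refine (mem_sec_iff.1 s.2 0).continuousOn.mono fun z hz => ⟨aff_mem_chartDomain 0 z, ?_⟩
  refine aff_mem_other 0 ?_
  rintro rfl
  simp at hz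

/-- The residue pairing of a section over the intersection of the charts with a form. -/
def residue (n : ℤ) (l : ℕ) : (lineBundle n).sec overlap →ₗ[ℂ] Module.Dual ℂ (Forms l) :=
  LinearMap.mk₂ ℂ (fun s P => ∮ z in C(0, 1),
      coord (n := n) 0 s.1 z * MvPolynomial.eval (vec 0 z) P.1)
    (fun s t P => by
      rw [← circleIntegral.integral_add (circleIntegrable_residue s P)
        (circleIntegrable_residue t P)]
      exact circleIntegral.integral_congr zero_le_one fun z _ => add_mul _ _ _)
    (fun k s P => by
      rw [← circleIntegral.integral_smul]
      exact circleIntegral.integral_congr zero_le_one fun z _ => mul_assoc _ _ _)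
    (fun s P Q => by
      rw [← circleIntegral.integral_add (circleIntegrable_residue s P)
        (circleIntegrable_residue s Q)]
      refine circleIntegral.integral_congr zero_le_one fun z _ => ?_
      change _ * MvPolynomial.eval _ (P.1 + Q.1) = _
      rw [map_add, mul_add])
    (fun k s P => by
      rw [← circleIntegral.integral_smul]
      refine circleIntegral.integral_congr zero_le_one fun z _ => ?_
      change _ * MvPolynomial.eval _ (k • P.1) = _
      rw [MvPolynomial.smul_eval, smul_eq_mul]
      ring)

theorem residue_apply {n : ℤ} {l : ℕ} (s : (lineBundle n).sec overlap) (P : Forms l) :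
    residue n l s P = ∮ z in C(0, 1),
      coord (n := n) 0 s.1 z * MvPolynomial.eval (vec 0 z) P.1 := rfl

/-- The substitution `z ↦ 1/z` reverses the unit circle, and `d(1/z) = -dz/z²`; the two signs
cancel. -/
theorem circleIntegral_inversion (K : ℂ → ℂ) :
    (∮ z in C(0, 1), (z ^ 2)⁻¹ * K z⁻¹) = ∮ z in C(0, 1), K z := by
  let φ : ℝ → ℂ := fun θ => circleMap 0 1 θ * I * K (circleMap 0 1 θ)
  have hinv : ∀ θ, circleMap 0 1 (-θ) = (circleMap 0 1 θ)⁻¹ := by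
    intro θ
    simp [circleMap, ← Complex.exp_neg]
  have h1 : (∮ z in C(0, 1), (z ^ 2)⁻¹ * K z⁻¹) = ∫ θ in (0 : ℝ)..2 * Real.pi, φ (-θ) := by
    refine intervalIntegral.integral_congr fun θ _ => ?_
    have h0 : circleMap 0 1 θ ≠ 0 := circleMap_ne_center one_ne_zero
    simp only [φ, deriv_circleMap, smul_eq_mul, hinv]
    field_simp
  have h2 : (∮ z in C(0, 1), K z) = ∫ θ in (0 : ℝ)..2 * Real.pi, φ θ := by
    refine intervalIntegral.integral_congr fun θ _ => ?_
    simp only [φ, deriv_circleMap, smul_eq_mul]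
  have hper : Function.Periodic φ (2 * Real.pi) := by
    intro θ
    simp only [φ, periodic_circleMap 0 1 θ]
  rw [h1, h2, intervalIntegral.integral_comp_neg, neg_zero]
  have := hper.intervalIntegral_add_eq (-(2 * Real.pi)) 0
  simpa using this

theorem circleIntegral_eq_zero_of_differentiable {K : ℂ → ℂ} (hK : Differentiable ℂ K) :
    (∮ z in C(0, 1), K z) = 0 :=
  circleIntegral_eq_zero_of_differentiable_on_off_countable zero_le_one countable_empty
    hK.continuous.continuousOn fun z _ => hK z

theorem differentiable_coord {n : ℤ} {i : Fin 2} {s : ∀ x, lineFibre n x}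
    (hs : s ∈ (lineBundle n).sec (chartDomain i)) : Differentiable ℂ (coord i s) := by
  have h := mem_sec_iff.1 hs i
  rw [show aff i ⁻¹' (chartDomain i : Set P1) = univ from
    eq_univ_of_forall fun z => aff_mem_chartDomain i z] at h
  exact differentiableOn_univ.1 h

/-- Both parts integrate to zero by Cauchy's theorem, each in its own chart: `n + l = -2`, so `s₁ P
dz` becomes, up to sign, an entire function times `dw` in the coordinate `w = 1/z`. -/
theorem residue_eq_zero {n : ℤ} {l : ℕ} (hn : n = -2 - l) {s : (lineBundle n).sec overlap}
    {s₀ s₁ : ∀ x, lineFibre n x} (h₀ : s₀ ∈ (lineBundle n).sec (chartDomain 0))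
    (h₁ : s₁ ∈ (lineBundle n).sec (chartDomain 1)) (h : s.1 = s₁ - s₀) : residue n l s = 0 := by
  refine LinearMap.ext fun P => ?_
  have e0 : (∮ z in C(0, 1), coord 0 s₀ z * MvPolynomial.eval (vec 0 z) P.1) = 0 :=
    circleIntegral_eq_zero_of_differentiable
      ((differentiable_coord h₀).mul (differentiable_eval_vec P.1 0))
  have hinv : ∀ z, z ≠ 0 → coord 0 s₁ z * MvPolynomial.eval (vec 0 z) P.1 =
      (z ^ 2)⁻¹ * (coord 1 s₁ z⁻¹ * MvPolynomial.eval (vec 1 z⁻¹) P.1) := by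
    intro z hz
    rw [coord_inv 0 s₁ hz, eval_form_vec P hz]
    have : (z ^ 2)⁻¹ = z ^ n * z ^ l := by
      rw [← zpow_natCast z l, ← zpow_add₀ hz, hn, ← zpow_natCast, ← zpow_neg]
      congr 1
      push_cast
      ring
    rw [this]
    change _ * coord 1 s₁ z⁻¹ * _ = _
    ring
  have hne : ∀ z ∈ sphere (0 : ℂ) 1, z ≠ 0 := by
    rintro z hz rfl
    simp at hz
  have e1 : (∮ z in C(0, 1), coord 0 s₁ z * MvPolynomial.eval (vec 0 z) P.1) = 0 := by
    rw [circleIntegral.integral_congr zero_le_one fun z hz => hinv z (hne z hz),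
      circleIntegral_inversion (fun w => coord 1 s₁ w * MvPolynomial.eval (vec 1 w) P.1)]
    exact circleIntegral_eq_zero_of_differentiable
      ((differentiable_coord h₁).mul (differentiable_eval_vec P.1 1))
  have c0 : CircleIntegrable (fun z => coord 0 s₀ z * MvPolynomial.eval (vec 0 z) P.1) 0 1 :=
    ((differentiable_coord h₀).mul
      (differentiable_eval_vec P.1 0)).continuous.continuousOn.circleIntegrable zero_le_one
  have c1 : CircleIntegrable (fun z => coord 0 s₁ z * MvPolynomial.eval (vec 0 z) P.1) 0 1 := by
    refine ContinuousOn.circleIntegrable zero_le_one (ContinuousOn.congr (f := fun z =>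
      (z ^ 2)⁻¹ * (coord 1 s₁ z⁻¹ * MvPolynomial.eval (vec 1 z⁻¹) P.1)) ?_
      fun z hz => hinv z (hne z hz))
    refine ContinuousOn.mul (ContinuousOn.inv₀ (by fun_prop) fun z hz => pow_ne_zero 2 (hne z hz)) ?_
    exact (((differentiable_coord h₁).mul
      (differentiable_eval_vec P.1 1)).continuous.comp_continuousOn
        (continuousOn_id.inv₀ fun z hz => hne z hz))
  rw [residue_apply, h]
  calc _ = ∮ z in C(0, 1), (coord 0 s₁ z * MvPolynomial.eval (vec 0 z) P.1 -
        coord 0 s₀ z * MvPolynomial.eval (vec 0 z) P.1) :=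
        circleIntegral.integral_congr zero_le_one fun z _ => sub_mul _ _ _
    _ = 0 := by rw [circleIntegral.integral_sub c1 c0, e0, e1, sub_zero]

/-- Among the powers of `z` only `z⁻¹` has a non-zero integral, so the pairing is diagonal in the
monomials. Its perfectness on principal parts follows. -/
theorem residue_laurentSec {n : ℤ} {l : ℕ} (b f : ℕ → ℂ) :
    residue n l (laurentSec n l b) (formOfCoeffs l f) =
      2 * Real.pi * I * ∑ j ∈ Finset.range (l + 1), b j * f j := by
  have hne : ∀ z ∈ sphere (0 : ℂ) 1, z ≠ 0 := by
    rintro z hz rfl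
    simp at hz
  have hz : ∀ z ∈ sphere (0 : ℂ) 1, coord (n := n) 0 (laurentSec n l b).1 z *
      MvPolynomial.eval (vec 0 z) (formOfCoeffs l f).1 =
      ∑ j ∈ Finset.range (l + 1), ∑ k ∈ Finset.range (l + 1),
        b j * f k * (z - 0) ^ ((k : ℤ) - j - 1) := by
    intro z hz
    rw [coord_laurentSec, eval_formOfCoeffs, Finset.sum_mul_sum]
    refine Finset.sum_congr rfl fun j _ => Finset.sum_congr rfl fun k _ => ?_
    have h0 := hne z hz
    have h2 : z ^ ((k : ℤ) - j - 1) = z ^ k * z⁻¹ ^ (j + 1) := by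
      rw [sub_sub, zpow_sub₀ h0, inv_pow, zpow_natCast, div_eq_mul_inv]
      congr 2
    rw [sub_zero, h2]
    simp [vec]
    ring
  have hint : ∀ m : ℤ, CircleIntegrable (fun z => (z - 0) ^ m) (0 : ℂ) 1 := by
    intro m
    refine ContinuousOn.circleIntegrable zero_le_one fun z hz => ?_
    simp only [sub_zero]
    exact (continuousAt_zpow₀ z m (Or.inl (hne z hz))).continuousWithinAt
  rw [residue_apply, circleIntegral.integral_congr zero_le_one hz,
    circleIntegral.integral_fun_sum (fun j _ => ?_)]
  · rw [Finset.mul_sum]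
    refine Finset.sum_congr rfl fun j hj => ?_
    rw [circleIntegral.integral_fun_sum (fun k _ => ?_)]
    · rw [Finset.sum_eq_single j]
      · rw [circleIntegral.integral_const_mul]
        have e : (∮ z in C(0, 1), (z - 0 : ℂ) ^ ((j : ℤ) - j - 1)) = 2 * Real.pi * I := by
          rw [← circleIntegral.integral_sub_center_inv (0 : ℂ) (one_ne_zero (α := ℝ))]
          refine circleIntegral.integral_congr zero_le_one fun z _ => ?_
          simp
        rw [e]; ring
      · intro k _ hk
        rw [circleIntegral.integral_const_mul, circleIntegral.integral_sub_zpow_of_ne, mul_zero]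
        intro h; apply hk; omega
      · intro h; exact absurd hj h
    · exact (hint _).const_smul (a := b j * f k)
  · refine CircleIntegrable.fun_sum _ fun k _ => ?_
    exact (hint _).const_smul (a := b j * f k)

theorem formOfCoeffs_eq_sum (l : ℕ) (f : ℕ → ℂ) : formOfCoeffs l f =
    ∑ j ∈ Finset.range (l + 1), f j • formOfCoeffs l (Pi.single j 1) := by
  refine form_ext fun z => ?_
  rw [AddSubmonoidClass.coe_finsetSum, map_sum, eval_formOfCoeffs]
  refine Finset.sum_congr rfl fun j hj => ?_
  change _ = MvPolynomial.eval _ (f j • (formOfCoeffs l (Pi.single j 1)).1)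
  rw [MvPolynomial.smul_eval, eval_formOfCoeffs, Finset.sum_eq_single j]
  · simp
  · intro k _ hk; simp [hk]
  · intro h; exact absurd hj h

theorem residue_surjective (n : ℤ) (l : ℕ) : Function.Surjective (residue n l) := by
  intro Φ
  refine ⟨laurentSec n l fun j => (2 * Real.pi * I)⁻¹ * Φ (formOfCoeffs l (Pi.single j 1)),
    LinearMap.ext fun P => ?_⟩
  obtain ⟨f, rfl⟩ := exists_eq_formOfCoeffs P
  rw [residue_laurentSec, formOfCoeffs_eq_sum, map_sum, Finset.mul_sum]
  refine Finset.sum_congr rfl fun j _ => ?_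
  rw [map_smul, smul_eq_mul]
  have := two_pi_I_ne_zero
  field_simp

theorem laurentSec_eq_zero {n : ℤ} {l : ℕ} {b : ℕ → ℂ} (h : residue n l (laurentSec n l b) = 0) :
    laurentSec n l b = 0 := by
  have hb : ∀ j ∈ Finset.range (l + 1), b j = 0 := by
    intro j hj
    have h1 := residue_laurentSec (n := n) (l := l) b (Pi.single j 1)
    rw [h, LinearMap.zero_apply, Finset.sum_eq_single j] at h1
    · simpa [two_pi_I_ne_zero] using h1.symm
    · intro k _ hk; simp [hk]
    · intro h; exact absurd hj h
  refine Subtype.ext ?_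
  have : (fun z : ℂ => ∑ j ∈ Finset.range (l + 1), b j * z⁻¹ ^ (j + 1)) = fun _ => 0 := by
    funext z
    exact Finset.sum_eq_zero fun j hj => by rw [hb j hj, zero_mul]
  change chartSec 0 n (fun z : ℂ => ∑ j ∈ Finset.range (l + 1), b j * z⁻¹ ^ (j + 1)) = 0
  rw [this]
  funext x
  exact Subtype.ext (funext fun v => mul_zero _)

/-- A section with zero residue pairing is cohomologous to a principal part, whose pairing is then
zero too, so that this principal part vanishes. Thus `H¹` and the dual space are quotients of the
same space by the same kernel. -/
theorem ker_overlapClass {n : ℤ} {l : ℕ} (hn : n = -2 - l) :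
    LinearMap.ker (overlapClass (lineBundle n)) = LinearMap.ker (residue n l) := by
  have hle : ∀ s, overlapClass (lineBundle n) s = 0 → residue n l s = 0 := by
    intro s hs
    obtain ⟨s₀, h₀, s₁, h₁, h⟩ := exists_sub_of_overlapClass_eq_zero hs
    exact residue_eq_zero hn h₀ h₁ h
  ext s
  rw [LinearMap.mem_ker, LinearMap.mem_ker]
  refine ⟨hle s, fun hs => ?_⟩
  obtain ⟨b, hb⟩ := exists_laurentSec hn (overlapClass _ s)
  have h1 : residue n l (laurentSec n l b - s) = 0 := hle _ (by rw [map_sub, hb, sub_self])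
  rw [map_sub, hs, sub_zero] at h1
  rw [← hb, laurentSec_eq_zero h1, map_zero]

/-- **Serre duality** for `𝒪(-2-l)`. -/
def serreDuality {n : ℤ} {l : ℕ} (hn : n = -2 - l) :
    (lineBundle n).H1 ≃ₗ[ℂ] Module.Dual ℂ (Forms l) :=
  (LinearMap.quotKerEquivOfSurjective (overlapClass (lineBundle n)) fun h =>
    let ⟨_, hb⟩ := exists_laurentSec hn h
    ⟨_, hb⟩).symm ≪≫ₗ Submodule.quotEquivOfEq _ _ (ker_overlapClass hn) ≪≫ₗ
    LinearMap.quotKerEquivOfSurjective (residue n l) (residue_surjective n l)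

theorem serreDuality_overlapClass {n : ℤ} {l : ℕ} (hn : n = -2 - l)
    (s : (lineBundle n).sec overlap) :
    serreDuality hn (overlapClass (lineBundle n) s) = residue n l s := by
  have h : (LinearMap.quotKerEquivOfSurjective (overlapClass (lineBundle n)) fun h =>
      let ⟨_, hb⟩ := exists_laurentSec hn h
      ⟨_, hb⟩).symm (overlapClass (lineBundle n) s) = Submodule.Quotient.mk s := by
    rw [LinearEquiv.symm_apply_eq]
    rfl
  simp only [serreDuality, LinearEquiv.trans_apply]
  rw [h]
  rfl

theorem overlapClass_surjective {n : ℤ} {l : ℕ} (hn : n = -2 - l) :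
    Function.Surjective (overlapClass (lineBundle n)) := fun h =>
  let ⟨_, hb⟩ := exists_laurentSec hn h
  ⟨_, hb⟩

/-- Serre duality transforms the multiplication by a form into its transpose. -/
theorem serreDuality_mulHom {n m : ℤ} {l d : ℕ} (hn : n = -2 - (l + d : ℕ)) (hm : m = -2 - l)
    (h : m = n + d) (Q : Forms d) (c : (lineBundle n).H1) :
    serreDuality hm ((mulHom h Q).mapH1 c) = serreDuality hn c ∘ₗ mulForm Q := by
  obtain ⟨s, rfl⟩ := overlapClass_surjective hn c
  have e : (mulHom h Q).mapH1 (overlapClass _ s) =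
      overlapClass _ ⟨_, (mulHom h Q).map_sec _ _ s.2⟩ := by
    refine congrArg (SectionSheaf.H1.mk _) (Subtype.ext ?_)
    funext p q x
    exact ((mulHom h Q).app x).map_smul _ _
  rw [e, serreDuality_overlapClass, serreDuality_overlapClass]
  refine LinearMap.ext fun P => ?_
  rw [residue_apply, LinearMap.comp_apply, residue_apply]
  refine circleIntegral.integral_congr zero_le_one fun z _ => ?_
  change (MvPolynomial.eval (vec 0 z) Q.1 * coord (n := n) 0 s.1 z) * _ =
    _ * MvPolynomial.eval (vec 0 z) (P.1 * Q.1)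
  rw [map_mul]
  ring

/-! ## Morphisms and cohomology of direct sums and quotients -/

namespace SectionSheaf

variable {S T R : SectionSheaf}

/-- Composition of morphisms. -/
def Hom.comp (g : T.Hom R) (f : S.Hom T) : S.Hom R where
  app x := g.app x ∘ₗ f.app x
  map_sec U s hs := g.map_sec U _ (f.map_sec U s hs)

theorem Hom.mapH1_comp (g : T.Hom R) (f : S.Hom T) (h : S.H1) :
    (g.comp f).mapH1 h = g.mapH1 (f.mapH1 h) := by
  obtain ⟨c, rfl⟩ := H1.mk_surjective S h
  rfl

theorem Hom.mapH1_congr {f g : S.Hom T} (hfg : ∀ x v, f.app x v = g.app x v) (h : S.H1) :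
    f.mapH1 h = g.mapH1 h := by
  obtain ⟨c, rfl⟩ := H1.mk_surjective S h
  refine congrArg (H1.mk T) (Subtype.ext ?_)
  funext p q x
  exact hfg x _

/-- The projections and inclusions of a direct sum. -/
def fstHom (S T : SectionSheaf) : (S.prod T).Hom S where
  app x := LinearMap.fst ℂ (S.Fib x) (T.Fib x)
  map_sec _ _ hs := hs.1

def sndHom (S T : SectionSheaf) : (S.prod T).Hom T where
  app x := LinearMap.snd ℂ (S.Fib x) (T.Fib x)
  map_sec _ _ hs := hs.2

def inlHom (S T : SectionSheaf) : S.Hom (S.prod T) where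
  app x := LinearMap.inl ℂ (S.Fib x) (T.Fib x)
  map_sec _ _ hs := ⟨hs, Submodule.zero_mem _⟩

def inrHom (S T : SectionSheaf) : T.Hom (S.prod T) where
  app x := LinearMap.inr ℂ (S.Fib x) (T.Fib x)
  map_sec _ _ hs := ⟨Submodule.zero_mem _, hs⟩

/-- Cohomology commutes with direct sums. -/
def prodH1 (S T : SectionSheaf) : (S.prod T).H1 ≃ₗ[ℂ] S.H1 × T.H1 :=
  LinearEquiv.ofLinearMap ((fstHom S T).mapH1.prod (sndHom S T).mapH1)
    ((inlHom S T).mapH1.coprod (inrHom S T).mapH1)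
    (by
      refine LinearMap.ext fun h => ?_
      obtain ⟨a, b⟩ := h
      obtain ⟨a, rfl⟩ := H1.mk_surjective S a
      obtain ⟨b, rfl⟩ := H1.mk_surjective T b
      refine Prod.ext (congrArg (H1.mk S) (Subtype.ext ?_)) (congrArg (H1.mk T) (Subtype.ext ?_))
      · funext p q x
        exact add_zero (a.1 p q x)
      · funext p q x
        exact zero_add (b.1 p q x))
    (by
      refine LinearMap.ext fun h => ?_
      obtain ⟨c, rfl⟩ := H1.mk_surjective _ h
      refine congrArg (H1.mk (S.prod T)) (Subtype.ext ?_)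
      funext p q x
      exact Prod.ext (add_zero (c.1 p q x).1) (zero_add (c.1 p q x).2))

/-- The morphism induced on a quotient. -/
def descHom {D : ∀ x, Submodule ℂ (S.Fib x)} (π : S.Hom T)
    (hD : ∀ x, D x ≤ LinearMap.ker (π.app x)) : (S.quot D).Hom T where
  app x := (D x).liftQ (π.app x) (hD x)
  map_sec U s hs := T.sec_local _ _ fun x hx => by
    obtain ⟨V, hV, t, ht, h⟩ := hs x hx
    refine ⟨V, hV, _, π.map_sec V t ht, fun y hy => ?_⟩
    rw [← h y hy]
    rfl

/-- The maps `π` and `S → S/D` factor through each other, the second as `v ↦ ι (π v)` modulo `D`. So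
`T` can replace `S/D` without an isomorphism being constructed. -/
theorem quotHom_mapH1_eq_zero_iff {D : ∀ x, Submodule ℂ (S.Fib x)} (π : S.Hom T) (ι : T.Hom S)
    (hD : ∀ x, D x ≤ LinearMap.ker (π.app x)) (hι : ∀ x v, v - ι.app x (π.app x v) ∈ D x)
    (h : S.H1) : (S.quotHom D).mapH1 h = 0 ↔ π.mapH1 h = 0 := by
  constructor
  · intro h0
    have : π.mapH1 h = (descHom π hD).mapH1 ((S.quotHom D).mapH1 h) := by
      rw [← Hom.mapH1_comp]
      exact Hom.mapH1_congr (fun x v => rfl) h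
    rw [this, h0, map_zero]
  · intro h0
    have : (S.quotHom D).mapH1 h = ((S.quotHom D).comp ι).mapH1 (π.mapH1 h) := by
      rw [← Hom.mapH1_comp]
      exact Hom.mapH1_congr (fun x v => (Submodule.Quotient.eq (D x)).2 (hι x v)) h
    rw [this, h0, map_zero]

end SectionSheaf

open SectionSheaf

/-! ## Maximal destabilising line subbundles -/

theorem IsMaxDestab.unique {S : SectionSheaf} {D D' : ∀ x, Submodule ℂ (S.Fib x)}
    (h : IsMaxDestab S D) (h' : IsMaxDestab S D') : D = D' := by
  by_contra hne
  obtain ⟨m, hm, hmax⟩ := h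
  obtain ⟨m', hm', hmax'⟩ := h'
  exact lt_asymm (hmax m' D' hm' (Ne.symm hne)) (hmax' m D hm hne)

theorem IsMaxDestab.maxDestab_eq {S : SectionSheaf} {D : ∀ x, Submodule ℂ (S.Fib x)}
    (h : IsMaxDestab S D) (x : P1) : maxDestab S x = D x := by
  have : {D' | IsMaxDestab S D'} = {D} := by
    ext D'
    exact ⟨fun h' => h'.unique h, fun h' => by rw [h']; exact h⟩
  rw [maxDestab, this]
  simp

/-- Evaluation at a vector of the line `x`, as a coordinate of the fibre of `𝒪(n)`. -/
def evalEquiv (n : ℤ) {x : P1} (v : Punctured x) : lineFibre n x ≃ₗ[ℂ] ℂ :=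
  LinearEquiv.ofBijective
    { toFun := fun f => f.1 v
      map_add' := fun _ _ => rfl
      map_smul' := fun _ _ => rfl }
    ⟨fun _ _ h => lineFibre_ext v h, fun k => by
      obtain ⟨i, z, rfl⟩ := exists_aff x
      let e : lineFibre n (aff i z) := chartSec i n (fun _ => 1) (aff i z)
      have he : e.1 (affPoint i z) = 1 := coord_chartSec i n (fun _ => 1) z
      have hv : e.1 v ≠ 0 := by
        intro h0
        have : e = 0 := lineFibre_ext v h0
        rw [this] at he
        exact zero_ne_one he
      exact ⟨(k * (e.1 v)⁻¹) • e, by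
        change k * (e.1 v)⁻¹ * e.1 v = k
        rw [mul_assoc, inv_mul_cancel₀ hv, mul_one]⟩⟩

/-- A vector of the line `x`. -/
def repPoint (x : P1) : Punctured x := ⟨x.rep, x.rep_nonzero, x.mk_rep⟩

/-- A line subbundle of degree `m ≥ n₁ > n₂` has zero projection to `𝒪(n₂)` by `hom_eq_zero`; it is
contained in `𝒪(n₁)`, and equal to it since the fibres are lines. -/
theorem isMaxDestab_split {n₁ n₂ : ℤ} (h : n₂ < n₁) : IsMaxDestab (splitBundle n₁ n₂)
    fun x => LinearMap.ker ((sndHom (lineBundle n₁) (lineBundle n₂)).app x) := by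
  refine ⟨n₁, ⟨inlHom _ _, fun x => ⟨LinearMap.inl_injective, ?_⟩⟩, ?_⟩
  · exact LinearMap.range_inl ℂ _ _
  · rintro m D ⟨i, hi⟩ hne
    by_contra hm
    apply hne
    have h0 : ∀ x f, ((sndHom (lineBundle n₁) (lineBundle n₂)).comp i).app x f = 0 :=
      fun x f => hom_eq_zero _ (by omega) x f
    funext x
    rw [← (hi x).2]
    refine le_antisymm ?_ ?_
    · rintro _ ⟨f, rfl⟩
      exact h0 x f
    · rintro ⟨f, f₂⟩ hf
      have hf₂ : f₂ = 0 := hf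
      subst hf₂
      let e : lineFibre m x := (evalEquiv m (repPoint x)).symm 1
      have he : e ≠ 0 := by simp [e]
      have hie : i.app x e ≠ 0 := fun h1 => he ((hi x).1 (h1.trans (map_zero _).symm))
      obtain ⟨f', hf'⟩ : ∃ f' : lineFibre n₁ x, i.app x e = (f', (0 : lineFibre n₂ x)) :=
        ⟨(i.app x e).1, Prod.ext rfl (h0 x e)⟩
      have hne' : f'.1 (repPoint x) ≠ 0 := by
        intro h1
        apply hie
        rw [hf', show f' = 0 from lineFibre_ext _ h1]
        rfl
      refine ⟨(f.1 (repPoint x) * (f'.1 (repPoint x))⁻¹) • e, ?_⟩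
      refine ((i.app x).map_smul _ _).trans ?_
      rw [hf']
      refine Prod.ext (lineFibre_ext (repPoint x) ?_)
        (show (f.1 (repPoint x) * (f'.1 (repPoint x))⁻¹) • (0 : lineFibre n₂ x) = 0 from smul_zero _)
      change f.1 (repPoint x) * (f'.1 (repPoint x))⁻¹ * f'.1 (repPoint x) = f.1 (repPoint x)
      rw [mul_assoc, inv_mul_cancel₀ hne', mul_one]

theorem mem_maxDestab_split {n₁ n₂ : ℤ} (h : n₂ < n₁) {x : P1} (v : (splitBundle n₁ n₂).Fib x) :
    v ∈ maxDestab (splitBundle n₁ n₂) x ↔ ∃ f : lineFibre n₁ x, v = (f, (0 : lineFibre n₂ x)) := by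
  rw [(isMaxDestab_split h).maxDestab_eq x]
  exact ⟨fun hv => ⟨v.1, Prod.ext rfl hv⟩, fun ⟨f, hf⟩ => by rw [hf]; rfl⟩

theorem mem_H1₀_split {n₁ n₂ : ℤ} (h : n₂ < n₁) (c : (splitBundle n₁ n₂).H1) :
    c ∈ H1₀ (splitBundle n₁ n₂) ↔ (sndHom (lineBundle n₁) (lineBundle n₂)).mapH1 c ≠ 0 := by
  refine not_congr (quotHom_mapH1_eq_zero_iff (S := splitBundle n₁ n₂)
    (sndHom (lineBundle n₁) (lineBundle n₂)) (inrHom (lineBundle n₁) (lineBundle n₂))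
    (fun x => ((isMaxDestab_split h).maxDestab_eq x).le) (fun x v => ?_) c)
  rw [mem_maxDestab_split h]
  exact ⟨v.1, Prod.ext (sub_zero v.1) (sub_self v.2)⟩

/-! ## The automorphism group of `𝒪(n₁) ⊕ 𝒪(n₂)` -/

section Aut

variable {n₁ n₂ : ℤ} {d : ℕ}

/-- The endomorphism of `𝒪(n₁) ⊕ 𝒪(n₂)` with a given matrix. -/
def matrixHom (h : n₁ = n₂ + d) (g : G d) : (splitBundle n₁ n₂).Hom (splitBundle n₁ n₂) where
  app x := LinearMap.prod
    ((g.u₁ : ℂ) • LinearMap.fst ℂ ((lineBundle n₁).Fib x) ((lineBundle n₂).Fib x) +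
      (mulHom h g.Q).app x ∘ₗ LinearMap.snd ℂ ((lineBundle n₁).Fib x) ((lineBundle n₂).Fib x))
    ((g.u₂ : ℂ) • LinearMap.snd ℂ ((lineBundle n₁).Fib x) ((lineBundle n₂).Fib x))
  map_sec U _ hs := ⟨Submodule.add_mem _ (Submodule.smul_mem _ _ hs.1)
    ((mulHom h g.Q).map_sec U _ hs.2), Submodule.smul_mem _ _ hs.2⟩

theorem matrixHom_comp (h : n₁ = n₂ + d) (g : G d) (x : P1) (s : (splitBundle n₁ n₂).Fib x)
    (v : Punctured x) :
    comp₁ ((matrixHom h g).app x s) v =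
      g.u₁ * comp₁ s v + MvPolynomial.eval v.1 g.Q.1 * comp₂ s v ∧
    comp₂ ((matrixHom h g).app x s) v = g.u₂ * comp₂ s v :=
  ⟨show (_ : ℂ) = _ from rfl, show (_ : ℂ) = _ from rfl⟩

theorem split_ext {x : P1} {s t : (splitBundle n₁ n₂).Fib x} (v : Punctured x)
    (h₁ : comp₁ s v = comp₁ t v) (h₂ : comp₂ s v = comp₂ t v) : s = t :=
  Prod.ext (lineFibre_ext v h₁) (lineFibre_ext v h₂)

theorem matrixHom_mul (h : n₁ = n₂ + d) (g g' : G d) (x : P1) (s : (splitBundle n₁ n₂).Fib x) :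
    (matrixHom h (g * g')).app x s = (matrixHom h g).app x ((matrixHom h g').app x s) := by
  have e₁ : (g * g').u₁ = g.u₁ * g'.u₁ := rfl
  have e₂ : (g * g').u₂ = g.u₂ * g'.u₂ := rfl
  have e₃ : (g * g').Q.1 = (g.u₁ : ℂ) • g'.Q.1 + (g'.u₂ : ℂ) • g.Q.1 := rfl
  refine split_ext (repPoint x) ?_ ?_
  · rw [(matrixHom_comp h _ x _ _).1, (matrixHom_comp h _ x _ _).1, (matrixHom_comp h _ x _ _).1,
      (matrixHom_comp h _ x _ _).2, e₁, e₃, map_add, MvPolynomial.smul_eval,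
      MvPolynomial.smul_eval]
    push_cast
    ring
  · rw [(matrixHom_comp h _ x _ _).2, (matrixHom_comp h _ x _ _).2, (matrixHom_comp h _ x _ _).2,
      e₂]
    push_cast
    ring

theorem matrixHom_one (h : n₁ = n₂ + d) (x : P1) (s : (splitBundle n₁ n₂).Fib x) :
    (matrixHom h (1 : G d)).app x s = s := by
  have e₁ : ((1 : G d).u₁ : ℂ) = 1 := rfl
  have e₂ : ((1 : G d).u₂ : ℂ) = 1 := rfl
  have e₃ : (1 : G d).Q.1 = 0 := rfl
  refine split_ext (repPoint x) ?_ ?_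
  · rw [(matrixHom_comp h _ x _ _).1, e₁, e₃, map_zero]; ring
  · rw [(matrixHom_comp h _ x _ _).2, e₂]; ring

theorem matrixHom_inv_mul (h : n₁ = n₂ + d) (g : G d) (x : P1) (s : (splitBundle n₁ n₂).Fib x) :
    (matrixHom h g⁻¹).app x ((matrixHom h g).app x s) = s := by
  rw [← matrixHom_mul, inv_mul_cancel, matrixHom_one]

theorem matrixHom_mul_inv (h : n₁ = n₂ + d) (g : G d) (x : P1) (s : (splitBundle n₁ n₂).Fib x) :
    (matrixHom h g).app x ((matrixHom h g⁻¹).app x s) = s := by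
  rw [← matrixHom_mul, mul_inv_cancel, matrixHom_one]

/-- The automorphism of `𝒪(n₁) ⊕ 𝒪(n₂)` with a given matrix. -/
def matrixAut (h : n₁ = n₂ + d) (g : G d) : (splitBundle n₁ n₂).Aut where
  app x := LinearEquiv.ofLinearMap ((matrixHom h g).app x) ((matrixHom h g⁻¹).app x)
    (LinearMap.ext (matrixHom_mul_inv h g x)) (LinearMap.ext (matrixHom_inv_mul h g x))
  map_sec U s := by
    refine ⟨fun hs => ?_, fun hs => (matrixHom h g).map_sec U s hs⟩
    have h1 := (matrixHom h g⁻¹).map_sec U _ hs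
    have h2 : (fun x => (matrixHom h g⁻¹).app x ((matrixHom h g).app x (s x))) = s :=
      funext fun x => matrixHom_inv_mul h g x (s x)
    rw [← h2]
    exact h1

theorem isGivenBy_matrixAut (h : n₁ = n₂ + d) (g : G d) : IsGivenBy (matrixAut h g) g :=
  fun x s v => matrixHom_comp h g x s v

theorem aut_ext {S : SectionSheaf} {φ ψ : S.Aut} (h : ∀ x v, φ.app x v = ψ.app x v) : φ = ψ :=
  Iso.ext (funext fun x => LinearEquiv.ext (h x))

theorem matrixAut_mul (h : n₁ = n₂ + d) (g g' : G d) :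
    matrixAut h (g * g') = matrixAut h g * matrixAut h g' :=
  aut_ext fun x v => matrixHom_mul h g g' x v

theorem matrixAut_injective (h : n₁ = n₂ + d) : Function.Injective (matrixAut (n₁ := n₁) h) := by
  intro g g' hg
  have key : ∀ x (s : (splitBundle n₁ n₂).Fib x) (v : Punctured x),
      g.u₁ * comp₁ s v + MvPolynomial.eval v.1 g.Q.1 * comp₂ s v =
        g'.u₁ * comp₁ s v + MvPolynomial.eval v.1 g'.Q.1 * comp₂ s v ∧
      g.u₂ * comp₂ s v = g'.u₂ * comp₂ s v := by
    intro x s v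
    have h1 := isGivenBy_matrixAut h g x s v
    have h2 := isGivenBy_matrixAut h g' x s v
    rw [← hg] at h2
    exact ⟨h1.1.symm.trans h2.1, h1.2.symm.trans h2.2⟩
  let e (n : ℤ) (z : ℂ) : lineFibre n (aff 0 z) := (evalEquiv n (affPoint 0 z)).symm 1
  have he : ∀ n z, (e n z).1 (affPoint 0 z) = 1 := fun n z =>
    (evalEquiv n (affPoint 0 z)).apply_symm_apply 1
  have k1 : ∀ z, ∃ s : (splitBundle n₁ n₂).Fib (aff 0 z),
      comp₁ s (affPoint 0 z) = 1 ∧ comp₂ s (affPoint 0 z) = 0 :=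
    fun z => ⟨(e n₁ z, (0 : lineFibre n₂ _)), he _ _, rfl⟩
  have k2 : ∀ z, ∃ s : (splitBundle n₁ n₂).Fib (aff 0 z),
      comp₁ s (affPoint 0 z) = 0 ∧ comp₂ s (affPoint 0 z) = 1 :=
    fun z => ⟨((0 : lineFibre n₁ _), e n₂ z), rfl, he _ _⟩
  refine G.ext ?_ ?_ (form_ext fun z => ?_)
  · obtain ⟨s, hs₁, hs₂⟩ := k1 0
    have h3 := (key _ s (affPoint 0 0)).1
    rw [hs₁, hs₂] at h3
    exact Units.ext (by simpa using h3)
  · obtain ⟨s, hs₁, hs₂⟩ := k2 0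
    have h3 := (key _ s (affPoint 0 0)).2
    rw [hs₂] at h3
    exact Units.ext (by simpa using h3)
  · obtain ⟨s, hs₁, hs₂⟩ := k2 z
    have h3 := (key _ s (affPoint 0 z)).1
    rw [hs₁, hs₂, mul_zero, zero_add, mul_one, mul_zero, zero_add, mul_one] at h3
    exact h3

/-- The four components are morphisms of line bundles: constants on the diagonal, a form from
`𝒪(n₂)` to `𝒪(n₁)`, and zero from `𝒪(n₁)` to `𝒪(n₂)`. Injectivity forces `u₁ ≠ 0` and surjectivity
`u₂ ≠ 0`. -/
theorem exists_matrixAut (hlt : n₂ < n₁) (h : n₁ = n₂ + d) (φ : (splitBundle n₁ n₂).Aut) :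
    ∃ g, matrixAut h g = φ := by
  have const : ∀ {n : ℤ} (ψ : (lineBundle n).Hom (lineBundle n)), ∃ u : ℂ, ∀ x (f : lineFibre n x),
      ψ.app x f = u • f := by
    intro n ψ
    obtain ⟨Q, hQ⟩ := exists_form_of_hom ψ (d := 0) (by simp)
    obtain ⟨f, rfl⟩ := exists_eq_formOfCoeffs Q
    refine ⟨f 0, fun x s => (hQ x s).trans (lineFibre_ext (repPoint x) ?_)⟩
    change MvPolynomial.eval (repPoint x).1 (formOfCoeffs 0 f).1 * s.1 (repPoint x) =
      f 0 * s.1 (repPoint x)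
    rw [eval_formOfCoeffs]
    simp
  let inl := inlHom (lineBundle n₁) (lineBundle n₂)
  let inr := inrHom (lineBundle n₁) (lineBundle n₂)
  let fst := fstHom (lineBundle n₁) (lineBundle n₂)
  let snd := sndHom (lineBundle n₁) (lineBundle n₂)
  let ψ : ((lineBundle n₁).prod (lineBundle n₂)).Hom ((lineBundle n₁).prod (lineBundle n₂)) := φ.hom
  obtain ⟨u₁, hu₁⟩ := const (fst.comp (ψ.comp inl))
  obtain ⟨u₂, hu₂⟩ := const (snd.comp (ψ.comp inr))
  obtain ⟨Q, hQ⟩ := exists_form_of_hom (fst.comp (ψ.comp inr)) h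
  have h0 := fun x f => hom_eq_zero (snd.comp (ψ.comp inl)) hlt x f
  have happ : ∀ x (s : (splitBundle n₁ n₂).Fib x) (v : Punctured x),
      comp₁ (φ.app x s) v = u₁ * comp₁ s v + MvPolynomial.eval v.1 Q.1 * comp₂ s v ∧
        comp₂ (φ.app x s) v = u₂ * comp₂ s v := by
    intro x s v
    have e : φ.app x s = φ.app x (inl.app x s.1) + φ.app x (inr.app x s.2) :=
      (congrArg (φ.app x) (Prod.ext (add_zero s.1).symm (zero_add s.2).symm)).trans
        ((φ.app x).map_add _ _)
    have a₁ : comp₁ (φ.app x (inl.app x s.1)) v = u₁ * comp₁ s v :=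
      congrArg (fun f : lineFibre n₁ x => f.1 v) (hu₁ x s.1)
    have a₂ : comp₂ (φ.app x (inl.app x s.1)) v = 0 :=
      congrArg (fun f : lineFibre n₂ x => f.1 v) (h0 x s.1)
    have a₃ : comp₁ (φ.app x (inr.app x s.2)) v = MvPolynomial.eval v.1 Q.1 * comp₂ s v :=
      congrArg (fun f : lineFibre n₁ x => f.1 v) (hQ x s.2)
    have a₄ : comp₂ (φ.app x (inr.app x s.2)) v = u₂ * comp₂ s v :=
      congrArg (fun f : lineFibre n₂ x => f.1 v) (hu₂ x s.2)
    rw [e]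
    exact ⟨congrArg₂ (· + ·) a₁ a₃, (congrArg₂ (· + ·) a₂ a₄).trans (zero_add _)⟩
  let x : P1 := aff 0 0
  have he : ∀ n, ((evalEquiv n (repPoint x)).symm 1).1 (repPoint x) = 1 :=
    fun n => (evalEquiv n (repPoint x)).apply_symm_apply 1
  have hu₁' : u₁ ≠ 0 := by
    intro h1
    let s : (splitBundle n₁ n₂).Fib x := ((evalEquiv n₁ (repPoint x)).symm 1, (0 : lineFibre n₂ x))
    have hs₁ : comp₁ s (repPoint x) = 1 := he n₁
    have hs₂ : comp₂ s (repPoint x) = 0 := rfl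
    have h2 : φ.app x s = 0 := by
      obtain ⟨h3, h4⟩ := happ x s (repPoint x)
      rw [h1, hs₂, zero_mul, mul_zero, add_zero] at h3
      rw [hs₂, mul_zero] at h4
      exact split_ext (repPoint x) h3 h4
    have h3 : s = 0 := (φ.app x).injective (h2.trans (map_zero _).symm)
    rw [h3] at hs₁
    exact zero_ne_one hs₁
  have hu₂' : u₂ ≠ 0 := by
    intro h1
    obtain ⟨s, hs⟩ := (φ.app x).surjective
      ((0 : lineFibre n₁ x), (evalEquiv n₂ (repPoint x)).symm 1)
    have h2 := (happ x s (repPoint x)).2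
    rw [h1, zero_mul, hs] at h2
    exact one_ne_zero ((he n₂).symm.trans h2)
  refine ⟨⟨Units.mk0 u₁ hu₁', Units.mk0 u₂ hu₂', Q⟩, aut_ext fun x v => ?_⟩
  have h1 := happ x v (repPoint x)
  have h2 := isGivenBy_matrixAut h ⟨Units.mk0 u₁ hu₁', Units.mk0 u₂ hu₂', Q⟩ x v (repPoint x)
  exact split_ext (repPoint x) (h2.1.trans h1.1.symm) (h2.2.trans h1.2.symm)

/-- The isomorphism from `Aut(𝒪(n₁) ⊕ 𝒪(n₂))` to the group of matrices. -/
def autEquiv (hlt : n₂ < n₁) (h : n₁ = n₂ + d) : (splitBundle n₁ n₂).Aut ≃* G d :=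
  (MulEquiv.ofBijective (MulHom.mk (matrixAut h) (matrixAut_mul h))
    ⟨matrixAut_injective h, exists_matrixAut hlt h⟩).symm

theorem matrixAut_autEquiv (hlt : n₂ < n₁) (h : n₁ = n₂ + d) (φ : (splitBundle n₁ n₂).Aut) :
    matrixAut h (autEquiv hlt h φ) = φ :=
  (MulEquiv.ofBijective (MulHom.mk (matrixAut h) (matrixAut_mul h))
    ⟨matrixAut_injective h, exists_matrixAut hlt h⟩).apply_symm_apply φ

/-- Automorphisms act on the maximal destabilising line subbundle by scalars. -/
theorem matrixAut_app_maxDestab (hlt : n₂ < n₁) (h : n₁ = n₂ + d) (g : G d) {x : P1}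
    {v : (splitBundle n₁ n₂).Fib x} (hv : v ∈ maxDestab (splitBundle n₁ n₂) x) :
    (matrixAut h g).app x v = (g.u₁ : ℂ) • v := by
  obtain ⟨f, hf⟩ := (mem_maxDestab_split hlt v).1 hv
  have h0 : comp₂ v (repPoint x) = 0 := by rw [hf]; rfl
  obtain ⟨h1, h2⟩ := isGivenBy_matrixAut h g x v (repPoint x)
  rw [h0, mul_zero, add_zero] at h1
  rw [h0, mul_zero] at h2
  refine split_ext (repPoint x) (h1.trans rfl) (h2.trans ?_)
  exact ((congrArg ((g.u₁ : ℂ) * ·) h0).trans (mul_zero _)).symm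

theorem exists_mem_maxDestab (hlt : n₂ < n₁) (x : P1) :
    ∃ v ∈ maxDestab (splitBundle n₁ n₂) x, v ≠ 0 := by
  refine ⟨((evalEquiv n₁ (repPoint x)).symm 1, (0 : lineFibre n₂ x)),
    (mem_maxDestab_split hlt _).2 ⟨_, rfl⟩, fun h0 => ?_⟩
  have h1 : (evalEquiv n₁ (repPoint x)).symm 1 = 0 := congrArg Prod.fst h0
  simp at h1

/-- An automorphism which fixes a non-zero vector of the maximal destabilising line subbundle
induces the identity on it. -/
theorem matrixAut_mem_Aut₀_iff (hlt : n₂ < n₁) (h : n₁ = n₂ + d) (g : G d) {x₀ : P1}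
    {v : (splitBundle n₁ n₂).Fib x₀} (hv : v ∈ maxDestab (splitBundle n₁ n₂) x₀) (hv0 : v ≠ 0) :
    (matrixAut h g ∈ Aut₀ (splitBundle n₁ n₂) ↔ g ∈ G₀ d) ∧
      ((matrixAut h g).app x₀ v = v ↔ g ∈ G₀ d) := by
  -- The action on the subbundle is by the scalar `u₁`, the same at all points, so one vector at one
  -- point decides.
  have key : (matrixAut h g).app x₀ v = v → g ∈ G₀ d := by
    intro h1
    rw [matrixAut_app_maxDestab hlt h g hv] at h1
    have h2 : ((g.u₁ : ℂ) - 1) • v = 0 := by rw [sub_smul, one_smul, h1, sub_self]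
    have h3 := (smul_eq_zero.1 h2).resolve_right hv0
    exact Units.ext (by simpa [sub_eq_zero] using h3)
  have key' : g ∈ G₀ d → ∀ x, ∀ w ∈ maxDestab (splitBundle n₁ n₂) x,
      (matrixAut h g).app x w = w := by
    intro hg x w hw
    have hg' : g.u₁ = 1 := hg
    rw [matrixAut_app_maxDestab hlt h g hw, hg', Units.val_one, one_smul]
  exact ⟨⟨fun h1 => key (h1 x₀ v hv), fun hg => key' hg⟩, ⟨key, fun hg => key' hg x₀ v hv⟩⟩

/-- The isomorphism from `H¹(𝒪(n₁) ⊕ 𝒪(n₂))` to the sum of the duals of the spaces of forms. -/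
def dualPairsEquiv {l : ℕ} (hn₁ : n₁ = -2 - l) (hn₂ : n₂ = -2 - (l + d : ℕ)) :
    (splitBundle n₁ n₂).H1 ≃ₗ[ℂ] DualPairs l d :=
  (prodH1 (lineBundle n₁) (lineBundle n₂)).trans
    ((serreDuality hn₁).prodCongr (serreDuality hn₂))

/-- Only the off-diagonal term needs an argument: `serreDuality_mulHom` turns `H¹(m_Q)` into the
transpose of `m_Q`. -/
theorem dualPairsEquiv_smul {l : ℕ} (hn₁ : n₁ = -2 - l) (hn₂ : n₂ = -2 - (l + d : ℕ))
    (h : n₁ = n₂ + d) (g : G d) (c : (splitBundle n₁ n₂).H1) :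
    dualPairsEquiv hn₁ hn₂ (matrixAut h g • c) = g • dualPairsEquiv hn₁ hn₂ c := by
  let fst := fstHom (lineBundle n₁) (lineBundle n₂)
  let snd := sndHom (lineBundle n₁) (lineBundle n₂)
  have h1 : fst.mapH1 (matrixAut h g • c) = (g.u₁ : ℂ) • fst.mapH1 c +
      (mulHom h g.Q).mapH1 (snd.mapH1 c) := by
    obtain ⟨c, rfl⟩ := H1.mk_surjective _ c
    exact congrArg (H1.mk _) (Subtype.ext (funext fun p => funext fun q => funext fun x => rfl))
  have h2 : snd.mapH1 (matrixAut h g • c) = (g.u₂ : ℂ) • snd.mapH1 c := by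
    obtain ⟨c, rfl⟩ := H1.mk_surjective _ c
    exact congrArg (H1.mk _) (Subtype.ext (funext fun p => funext fun q => funext fun x => rfl))
  refine Prod.ext ?_ ?_
  · change serreDuality hn₁ (fst.mapH1 (matrixAut h g • c)) =
      (g.u₁ : ℂ) • serreDuality hn₁ (fst.mapH1 c) +
        serreDuality hn₂ (snd.mapH1 c) ∘ₗ mulForm g.Q
    rw [h1, map_add, map_smul, serreDuality_mulHom hn₂ hn₁]
  · change serreDuality hn₂ (snd.mapH1 (matrixAut h g • c)) =
      (g.u₂ : ℂ) • serreDuality hn₂ (snd.mapH1 c)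
    rw [h2, map_smul]

theorem dualPairsEquiv_mem_iff {l : ℕ} (hn₁ : n₁ = -2 - l) (hn₂ : n₂ = -2 - (l + d : ℕ))
    (hlt : n₂ < n₁) (c : (splitBundle n₁ n₂).H1) :
    c ∈ H1₀ (splitBundle n₁ n₂) ↔ dualPairsEquiv hn₁ hn₂ c ∈ DualPairs₀ l d := by
  rw [mem_H1₀_split hlt]
  exact (map_ne_zero_iff _ (serreDuality hn₂).injective).symm

end Aut

/-! ## Isomorphisms of bundles -/

/-- The inverse of an isomorphism. -/
def SectionSheaf.Iso.symm {S T : SectionSheaf} (f : S.Iso T) : T.Iso S where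
  app x := (f.app x).symm
  map_sec U s := by rw [← f.map_sec U (fun x => (f.app x).symm (s x))]; simp

/-- The composition of two isomorphisms. -/
def SectionSheaf.Iso.trans {S T R : SectionSheaf} (f : S.Iso T) (g : T.Iso R) : S.Iso R where
  app x := (f.app x).trans (g.app x)
  map_sec U s := (g.map_sec U (fun x => f.app x (s x))).trans (f.map_sec U s)

theorem SectionSheaf.Iso.mapH1_trans {S T R : SectionSheaf} (f : S.Iso T) (g : T.Iso R)
    (h : S.H1) : (f.trans g).hom.mapH1 h = g.hom.mapH1 (f.hom.mapH1 h) := by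
  obtain ⟨c, rfl⟩ := H1.mk_surjective S h
  rfl

theorem SectionSheaf.Iso.mapH1_symm_apply {S T : SectionSheaf} (f : S.Iso T) (h : S.H1) :
    f.symm.hom.mapH1 (f.hom.mapH1 h) = h := by
  obtain ⟨c, rfl⟩ := H1.mk_surjective S h
  refine congrArg (H1.mk S) (Subtype.ext ?_)
  funext p q x
  exact (f.app x).symm_apply_apply _

theorem SectionSheaf.Iso.mapH1_apply_symm {S T : SectionSheaf} (f : S.Iso T) (h : T.H1) :
    f.hom.mapH1 (f.symm.hom.mapH1 h) = h := f.symm.mapH1_symm_apply h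

theorem IsLineSubbundle.map {S T : SectionSheaf} (f : S.Iso T) {m : ℤ}
    {D : ∀ x, Submodule ℂ (S.Fib x)} (h : IsLineSubbundle S m D) :
    IsLineSubbundle T m (fun x => (D x).map (f.app x).toLinearMap) := by
  obtain ⟨i, hi⟩ := h
  refine ⟨f.hom.comp i, fun x => ⟨(f.app x).injective.comp (hi x).1, ?_⟩⟩
  change LinearMap.range _ = Submodule.map _ (D x)
  rw [← (hi x).2]
  exact LinearMap.range_comp _ _

theorem IsMaxDestab.map {S T : SectionSheaf} (f : S.Iso T) {D : ∀ x, Submodule ℂ (S.Fib x)}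
    (h : IsMaxDestab S D) : IsMaxDestab T (fun x => (D x).map (f.app x).toLinearMap) := by
  obtain ⟨m, hm, hmax⟩ := h
  refine ⟨m, hm.map f, fun m' D' h' hne => ?_⟩
  refine hmax m' (fun x => (D' x).map (f.symm.app x).toLinearMap) (h'.map f.symm) fun heq => hne ?_
  funext x
  have := congrFun heq x
  rw [← this, ← Submodule.map_comp]
  have e : (f.app x).toLinearMap ∘ₗ (f.symm.app x).toLinearMap = LinearMap.id :=
    LinearMap.ext fun v => (f.app x).apply_symm_apply v
  rw [e, Submodule.map_id]

theorem SectionSheaf.Iso.mem_maxDestab_iff {S T : SectionSheaf} (f : S.Iso T)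
    {D : ∀ x, Submodule ℂ (T.Fib x)} (hT : IsMaxDestab T D) {x : P1} (v : S.Fib x) :
    f.app x v ∈ maxDestab T x ↔ v ∈ maxDestab S x := by
  rw [hT.maxDestab_eq, (hT.map f.symm).maxDestab_eq]
  constructor
  · intro hv
    exact ⟨f.app x v, hv, (f.app x).symm_apply_apply v⟩
  · rintro ⟨w, hw, rfl⟩
    have : f.app x (f.symm.app x w) = w := (f.app x).apply_symm_apply w
    change f.app x (f.symm.app x w) ∈ D x
    rwa [this]

theorem SectionSheaf.Hom.mapH1_quot_eq_zero {S T : SectionSheaf} (f : S.Hom T)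
    {D : ∀ x, Submodule ℂ (S.Fib x)} {D' : ∀ x, Submodule ℂ (T.Fib x)}
    (hD : ∀ x, ∀ v ∈ D x, f.app x v ∈ D' x) {h : S.H1} (h0 : (S.quotHom D).mapH1 h = 0) :
    (T.quotHom D').mapH1 (f.mapH1 h) = 0 := by
  have hker : ∀ x, D x ≤ LinearMap.ker (((T.quotHom D').comp f).app x) := fun x v hv =>
    (Submodule.Quotient.mk_eq_zero _).2 (hD x v hv)
  have e : (T.quotHom D').mapH1 (f.mapH1 h) =
      (descHom ((T.quotHom D').comp f) hker).mapH1 ((S.quotHom D).mapH1 h) := by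
    rw [← Hom.mapH1_comp, ← Hom.mapH1_comp]
    exact Hom.mapH1_congr (fun x v => rfl) h
  rw [e, h0, map_zero]

theorem SectionSheaf.Iso.mem_H1₀_iff {S T : SectionSheaf} (f : S.Iso T)
    {D : ∀ x, Submodule ℂ (T.Fib x)} (hT : IsMaxDestab T D) (h : S.H1) :
    f.hom.mapH1 h ∈ H1₀ T ↔ h ∈ H1₀ S := by
  refine not_congr ⟨fun h0 => ?_, fun h0 => ?_⟩
  · have := f.symm.hom.mapH1_quot_eq_zero (D' := maxDestab S)
      (fun x v hv => (f.symm.mem_maxDestab_iff (hT.map f.symm) v).2 hv) h0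
    rwa [f.mapH1_symm_apply] at this
  · exact f.hom.mapH1_quot_eq_zero (fun x v hv => (f.mem_maxDestab_iff hT v).2 hv) h0

/-! ## Sections of affine bundles -/

namespace AffineBundle

variable {r : ℕ} {A B : AffineBundle r}

theorem IsSec.mono {U V : Opens P1} (hUV : U ≤ V) {s : ∀ x, A.Fib x} (hs : A.IsSec V s) :
    A.IsSec U s := fun τ hτ => (hs τ hτ).mono (inf_le_inf_right _ hUV)

theorem IsSec.of_local {U : Opens P1} {s : ∀ x, A.Fib x}
    (h : ∀ x ∈ U, ∃ V : Opens P1, x ∈ V ∧ ∃ t, A.IsSec V t ∧ ∀ y ∈ V, t y = s y) :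
    A.IsSec U s := by
  intro τ hτ
  refine HolOn.of_local fun x hx => ?_
  obtain ⟨V, hxV, t, ht, hts⟩ := h x hx.1
  exact ⟨V ⊓ τ.base, ⟨hxV, hx.2⟩, _, ht τ hτ, fun y hy => by rw [hts y hy.1]⟩

theorem IsSec.vsub {U : Opens P1} {s t : ∀ x, A.Fib x} (hs : A.IsSec U s) (ht : A.IsSec U t) :
    (fun x => (s x -ᵥ t x : A.Lin x)) ∈ A.linearisation.sec U := by
  intro τ hτ
  have e : (fun x => (τ.map x).linear (s x -ᵥ t x)) = fun x => τ.map x (s x) - τ.map x (t x) :=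
    funext fun x => (τ.map x).toAffineMap.linearMap_vsub _ _
  rw [e]
  exact (hs τ hτ).sub (ht τ hτ)

theorem IsSec.vadd {U : Opens P1} {v : ∀ x, A.Lin x} {s : ∀ x, A.Fib x}
    (hv : v ∈ A.linearisation.sec U) (hs : A.IsSec U s) : A.IsSec U (fun x => v x +ᵥ s x) := by
  intro τ hτ
  have e : (fun x => τ.map x (v x +ᵥ s x)) = fun x => (τ.map x).linear (v x) + τ.map x (s x) :=
    funext fun x => (τ.map x).map_vadd _ _
  rw [e]
  exact (hv τ hτ).add (hs τ hτ)

/-- The linear part of a morphism of affine bundles preserves holomorphic sections. -/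
theorem map_mem_linearisation {ψ : ∀ x, A.Fib x ≃ᵃ[ℂ] B.Fib x}
    (hψ : ∀ U s, A.IsSec U s → B.IsSec U (fun x => ψ x (s x))) {U : Opens P1} {v : ∀ x, A.Lin x}
    (hv : v ∈ A.linearisation.sec U) : (fun x => (ψ x).linear (v x)) ∈ B.linearisation.sec U := by
  refine B.linearisation.sec_local _ _ fun p hp => ?_
  -- Locally `v = (v + s) - s` for a section `s` of `A`, so its image is the difference of the
  -- sections `ψ (v + s)` and `ψ s`.
  have hs : A.IsSec (U ⊓ (A.trivAt p).base) (A.localSec p) := (A.localSec_isSec p).mono inf_le_right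
  have h1 := hψ _ _ (IsSec.vadd (A.linearisation.mono inf_le_left hv) hs)
  refine ⟨U ⊓ (A.trivAt p).base, ⟨hp, A.mem_trivAt p⟩, _, h1.vsub (hψ _ _ hs), fun y _ => ?_⟩
  change ψ y (v y +ᵥ A.localSec p y) -ᵥ ψ y (A.localSec p y) = (ψ y).linear (v y)
  rw [AffineEquiv.map_vadd, vadd_vsub]

/-- The linearisation of an isomorphism. -/
def Iso.linearisation (ψ : A.Iso B) : A.linearisation.Iso B.linearisation where
  app x := (ψ.app x).linear
  map_sec U v := by
    refine ⟨fun hv => ?_, map_mem_linearisation fun U s => (ψ.map_sec U s).2⟩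
    have h1 := map_mem_linearisation (ψ := ψ.symm.app) (fun U s => (ψ.symm.map_sec U s).2) hv
    have e : (fun x => (ψ.symm.app x).linear ((ψ.app x).linear (v x))) = v :=
      funext fun x => (ψ.app x).linear.symm_apply_apply (v x)
    rw [← e]
    exact h1

/-- The invariant can be computed with arbitrary holomorphic local sections. -/
theorem invariant_eq_mk_iff {c : A.linearisation.Z1} : A.invariant = H1.mk _ c ↔
    ∃ (W : P1 → Opens P1) (σ : P1 → ∀ x, A.Fib x), (∀ p, p ∈ W p) ∧ (∀ p, A.IsSec (W p) (σ p)) ∧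
      ∀ p q x, x ∈ W p → x ∈ W q → c.1 p q x = (σ q x -ᵥ σ p x : A.Lin x) := by
  constructor
  · intro h
    obtain ⟨U, hU, t, ht, hc⟩ := H1.mk_eq_mk_iff.1 h.symm
    let t' : P1 → ∀ x, A.Lin x := t
    let c' : P1 → P1 → ∀ x, A.Lin x := c.1
    -- Translating the chosen local sections by the cochain `t` changes their cocycle by the
    -- coboundary of `t`.
    refine ⟨fun p => U p ⊓ (A.trivAt p).base, fun p x => t' p x +ᵥ A.localSec p x,
      fun p => ⟨hU p, A.mem_trivAt p⟩, fun p => IsSec.vadd (A.linearisation.mono inf_le_left (ht p))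
        ((A.localSec_isSec p).mono inf_le_right), fun p q x hp hq => ?_⟩
    have h1 : c' p q x - (A.localSec q x -ᵥ A.localSec p x) = t' q x - t' p x :=
      hc p q x hp.1 hq.1
    change c' p q x = _
    rw [sub_eq_iff_eq_add.1 h1, vadd_vsub_assoc, vsub_vadd_eq_vsub_sub]
    abel
  · rintro ⟨W, σ, hW, hσ, hc⟩
    refine H1.mk_eq_mk_iff.2 ⟨fun p => (A.trivAt p).base ⊓ W p,
      fun p => ⟨A.mem_trivAt p, hW p⟩, fun p x => (A.localSec p x -ᵥ σ p x : A.Lin x),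
      fun p => IsSec.vsub ((A.localSec_isSec p).mono inf_le_left) ((hσ p).mono inf_le_right),
      fun p q x hp hq => ?_⟩
    have h1 : (A.localSec q x -ᵥ A.localSec p x) - (σ q x -ᵥ σ p x) =
        (A.localSec q x -ᵥ σ q x) - (A.localSec p x -ᵥ σ p x) := vsub_sub_vsub_comm _ _ _ _
    rw [← hc p q x hp.2 hq.2] at h1
    exact h1

theorem Iso.mapH1_invariant (ψ : A.Iso B) :
    ψ.linearisation.hom.mapH1 A.invariant = B.invariant := by
  symm
  refine invariant_eq_mk_iff.2 ⟨fun p => (A.trivAt p).base, fun p x => ψ.app x (A.localSec p x),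
    A.mem_trivAt, fun p => (ψ.map_sec _ _).2 (A.localSec_isSec p), fun p q x _ _ => ?_⟩
  exact (ψ.app x).toAffineMap.linearMap_vsub _ _

/-- An isomorphism of linearisations which is compatible with the invariants is the linear part
of an isomorphism. -/
theorem exists_iso_of_mapH1_invariant (f : A.linearisation.Iso B.linearisation)
    (h : f.hom.mapH1 A.invariant = B.invariant) :
    ∃ ψ : A.Iso B, ∀ x v, (ψ.app x).linear v = f.app x v := by
  obtain ⟨W, σ, hW, hσ, hc⟩ := (invariant_eq_mk_iff (c := f.hom.mapZ A.cocycle)).1 h.symm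
  have hc' : ∀ p q x, x ∈ W p → x ∈ W q →
      f.app x (A.localSec q x -ᵥ A.localSec p x : A.Lin x) = (σ q x -ᵥ σ p x : B.Lin x) := hc
  let F (x : P1) : A.Lin x ≃ₗ[ℂ] B.Lin x := f.app x
  -- At `x` the index `x` serves as base index; `hψ` shows that every other index `p` with `x ∈ W p`
  -- gives the same map, and holomorphy near `p` is read off with `p` fixed.
  let ψ (x : P1) : A.Fib x ≃ᵃ[ℂ] B.Fib x :=
    (AffineEquiv.vaddConst ℂ (A.localSec x x)).symm.trans
      ((F x).toAffineEquiv.trans (AffineEquiv.vaddConst ℂ (σ x x)))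
  have hψ : ∀ p x a, x ∈ W p → ψ x a = F x (a -ᵥ A.localSec p x) +ᵥ σ p x := by
    intro p x a hx
    change F x (a -ᵥ A.localSec x x) +ᵥ σ x x = _
    have h1 : F x (A.localSec p x -ᵥ A.localSec x x) = σ p x -ᵥ σ x x := hc' x p x (hW x) hx
    rw [← vsub_add_vsub_cancel a (A.localSec p x) (A.localSec x x), map_add, h1, add_vadd,
      vsub_vadd]
  refine ⟨⟨ψ, fun U s => ⟨fun hs => ?_, fun hs => ?_⟩⟩, fun x v => rfl⟩
  · refine IsSec.of_local fun p hp => ⟨U ⊓ (W p ⊓ (A.trivAt p).base),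
      ⟨hp, hW p, A.mem_trivAt p⟩, fun x => (s x -ᵥ A.localSec p x : A.Lin x) +ᵥ A.localSec p x,
      IsSec.vadd ?_ ((A.localSec_isSec p).mono (inf_le_right.trans inf_le_right)),
      fun y _ => vsub_vadd _ _⟩
    refine (f.map_sec _ _).1 ?_
    have h1 := (hs.mono inf_le_left).vsub ((hσ p).mono
      (inf_le_right.trans inf_le_left : U ⊓ (W p ⊓ (A.trivAt p).base) ≤ W p))
    refine B.linearisation.sec_local _ _ fun x hx => ⟨_, hx, _, h1, fun y hy => ?_⟩
    change (ψ y (s y) -ᵥ σ p y : B.Lin y) = F y (s y -ᵥ A.localSec p y)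
    rw [hψ p y _ hy.2.1, vadd_vsub]
  · refine IsSec.of_local fun p hp => ⟨U ⊓ (W p ⊓ (A.trivAt p).base),
      ⟨hp, hW p, A.mem_trivAt p⟩, fun x => F x (s x -ᵥ A.localSec p x) +ᵥ σ p x,
      IsSec.vadd ?_ ((hσ p).mono (inf_le_right.trans inf_le_left)),
      fun y hy => (hψ p y _ hy.2.1).symm⟩
    exact f.hom.map_sec _ _ ((hs.mono inf_le_left).vsub
      ((A.localSec_isSec p).mono (inf_le_right.trans inf_le_right)))

end AffineBundle

/-! ## Construction of affine bundles -/

section Compatible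

variable {r : ℕ} {Lin Fib : P1 → Type} [∀ x, AddCommGroup (Lin x)] [∀ x, Module ℂ (Lin x)]
  [∀ x, AddTorsor (Lin x) (Fib x)]

theorem HolOn.sum {F : Type} [NormedAddCommGroup F] [NormedSpace ℂ F] {U : Opens P1} {ι : Type}
    (s : Finset ι) {f : ι → P1 → F} (hf : ∀ i ∈ s, HolOn U (f i)) :
    HolOn U (fun x => ∑ i ∈ s, f i x) :=
  fun i => DifferentiableOn.fun_sum fun j hj => hf j hj i

theorem HolOn.apply {r : ℕ} {U : Opens P1} {f : P1 → Fin r → ℂ} (hf : HolOn U f) (j : Fin r) :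
    HolOn U (fun x => f x j) := fun i => differentiableOn_pi.1 (hf i) j

/-- The linear part of the comparison map between compatible trivialisations is holomorphic. -/
theorem AffTriv.Compatible.linear {τ θ : AffTriv r Lin Fib} (h : τ.Compatible θ) {U : Opens P1}
    (hU : U ≤ τ.base ⊓ θ.base) {f : P1 → Fin r → ℂ} (hf : HolOn U f) :
    HolOn U (fun x => (τ.map x).linear ((θ.map x).linear.symm (f x))) := by
  -- Compatibility speaks only of constant vectors. Expanding in the standard basis, with
  -- coefficient vectors `T e_j - T 0`, reduces a varying `f` to these.
  have e : ∀ x w, (τ.map x).linear ((θ.map x).linear.symm w) =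
      ∑ j, w j • (τ.map x ((θ.map x).symm (Pi.single j 1)) - τ.map x ((θ.map x).symm 0)) := by
    intro x w
    let T : (Fin r → ℂ) ≃ᵃ[ℂ] (Fin r → ℂ) := (θ.map x).symm.trans (τ.map x)
    have h1 : ∀ w, T.linear w = T w - T 0 := by
      intro w
      have := T.toAffineMap.linearMap_vsub w 0
      rw [vsub_eq_sub, sub_zero] at this
      exact this
    change T.linear w = ∑ j, w j • (T (Pi.single j 1) - T 0)
    have h2 := LinearMap.pi_apply_eq_sum_univ (T.linear : (Fin r → ℂ) →ₗ[ℂ] (Fin r → ℂ)) w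
    refine h2.trans (Finset.sum_congr rfl fun j _ => ?_)
    rw [← h1]
    have h3 : (fun k => if j = k then (1 : ℂ) else 0) = Pi.single j 1 := by
      funext k
      simp [Pi.single_apply, eq_comm]
    exact congrArg (fun v => w j • T.linear v) h3
  simp only [e]
  exact HolOn.sum _ fun j _ i => (hf.apply j i).smul
    ((((h (Pi.single j 1)).mono hU).sub ((h 0).mono hU)) i)

/-- Compatible trivialisations define the same holomorphic sections. -/
theorem AffTriv.Compatible.map {τ θ : AffTriv r Lin Fib} (h : τ.Compatible θ) {U : Opens P1}
    (hU : U ≤ τ.base ⊓ θ.base) {f : P1 → Fin r → ℂ} (hf : HolOn U f) :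
    HolOn U (fun x => τ.map x ((θ.map x).symm (f x))) := by
  have e : ∀ x w, τ.map x ((θ.map x).symm w) =
      (τ.map x).linear ((θ.map x).linear.symm w) + τ.map x ((θ.map x).symm 0) := by
    intro x w
    let T : (Fin r → ℂ) ≃ᵃ[ℂ] (Fin r → ℂ) := (θ.map x).symm.trans (τ.map x)
    have := T.map_vadd 0 w
    rw [vadd_eq_add, add_zero] at this
    exact this
  have e' : (fun x => τ.map x ((θ.map x).symm (f x))) = fun x =>
      (τ.map x).linear ((θ.map x).linear.symm (f x)) + τ.map x ((θ.map x).symm 0) :=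
    funext fun x => e x (f x)
  rw [e']
  exact (h.linear hU hf).add ((h 0).mono hU)

end Compatible

/-- Holomorphic local triviality of a bundle of rank `r`. -/
def LocallyTrivial (r : ℕ) (E : SectionSheaf) : Prop :=
  ∀ p, ∃ U : Opens P1, p ∈ U ∧ ∃ e : ∀ x, E.Fib x ≃ₗ[ℂ] (Fin r → ℂ),
    ∀ V ≤ U, ∀ s, s ∈ E.sec V ↔ HolOn V (fun x => e x (s x))

theorem holOn_const {F : Type} [NormedAddCommGroup F] [NormedSpace ℂ F] (U : Opens P1) (w : F) :
    HolOn U (fun _ => w) := fun _ => differentiableOn_const w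

/-- Every class in `H¹(E)` is the invariant of an affine bundle with linearisation `E`. -/
theorem exists_affineBundle {r : ℕ} {E : SectionSheaf} (hE : LocallyTrivial r E) (h : E.H1) :
    ∃ (A : AffineBundle r) (f : A.linearisation.Iso E), f.hom.mapH1 A.invariant = h := by
  obtain ⟨⟨c, W, hW, hc, hcc⟩, rfl⟩ := H1.mk_surjective E h
  choose U hU e he using hE
  -- Taking `x` itself as reference index at `x` splits the cocycle set-theoretically. These `σ p`
  -- need not be holomorphic for `E`; they are declared to be holomorphic sections of the new bundle
  -- through the trivialisations `ref p`.
  let σ (p x : P1) : E.Fib x := c x p x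
  have hσ : ∀ p q x, x ∈ W p → x ∈ W q → c p q x = σ q x - σ p x := by
    intro p q x hp hq
    rw [eq_sub_iff_add_eq', ← hcc x p q x (hW x) hp hq]
  let ref (p : P1) : AffTriv r E.Fib E.Fib := ⟨U p ⊓ W p, fun x =>
    (AffineEquiv.vaddConst ℂ (σ p x)).symm.trans (e p x).toAffineEquiv⟩
  have href : ∀ p, p ∈ (ref p).base := fun p => ⟨hU p, hW p⟩
  have hcompat : ∀ p q, (ref p).Compatible (ref q) := by
    intro p q w
    have h1 : (fun x => (e q x).symm w) ∈ E.sec ((ref p).base ⊓ (ref q).base) :=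
      (he q _ (inf_le_right.trans inf_le_left) _).2 (by
        simp only [LinearEquiv.apply_symm_apply]; exact holOn_const _ w)
    have h2 : c p q ∈ E.sec ((ref p).base ⊓ (ref q).base) :=
      E.mono (inf_le_inf inf_le_right inf_le_right) (hc p q)
    have h3 := (he p _ (inf_le_left.trans inf_le_left) _).1 (Submodule.add_mem _ h1 h2)
    refine HolOn.of_local fun x hx => ⟨_, hx, _, h3, fun y hy => ?_⟩
    change e p y ((e q y).symm w + c p q y) = e p y (((e q y).symm w + σ q y) - σ p y)
    rw [hσ p q y hy.1.2 hy.2.2, add_sub_assoc]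
  let A : AffineBundle r :=
    { Fib := E.Fib
      Lin := E.Fib
      -- Two members of this atlas are compared by passing through `ref x` near `x`, and maximality
      -- is immediate.
      atlas := {τ | ∀ p, τ.Compatible (ref p) ∧ (ref p).Compatible τ}
      cover := fun x => ⟨ref x, fun p => ⟨hcompat x p, hcompat p x⟩, href x⟩
      compat := by
        intro τ hτ θ hθ w
        refine HolOn.of_local fun x hx => ⟨τ.base ⊓ θ.base ⊓ (ref x).base, ⟨hx, href x⟩,
          fun y => τ.map y (((ref x).map y).symm ((ref x).map y ((θ.map y).symm w))), ?_,
          fun y _ => congrArg (τ.map y) (AffineEquiv.symm_apply_apply _ _)⟩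
        exact (hτ x).1.map (inf_le_inf_right _ inf_le_left) (((hθ x).2 w).mono
          (le_inf inf_le_right (inf_le_left.trans inf_le_right)))
      maximal := fun τ hτ p => hτ (ref p) fun q => ⟨hcompat p q, hcompat q p⟩ }
  have hmem : ∀ p, ref p ∈ A.atlas := fun p q => ⟨hcompat p q, hcompat q p⟩
  let f : A.linearisation.Iso E :=
    { app := fun x => LinearEquiv.refl ℂ (E.Fib x)
      map_sec := by
        intro V s
        refine ⟨fun hs τ hτ => ?_, fun hs => E.sec_local _ _ fun x hx => ?_⟩
        · refine HolOn.of_local fun x hx => ⟨V ⊓ τ.base ⊓ (ref x).base, ⟨hx, href x⟩,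
            fun y => (τ.map y).linear (((ref x).map y).linear.symm (((ref x).map y).linear (s y))),
            ?_, fun y _ => congrArg (τ.map y).linear (LinearEquiv.symm_apply_apply _ _)⟩
          refine (hτ x).1.linear (inf_le_inf_right _ inf_le_right) ?_
          exact (he x _ (inf_le_right.trans inf_le_left) s).1
            (E.mono (inf_le_left.trans inf_le_left) hs)
        · exact ⟨V ⊓ (ref x).base, ⟨hx, href x⟩, s,
            (he x _ (inf_le_right.trans inf_le_left) s).2 (hs (ref x) (hmem x)), fun _ _ => rfl⟩ }
  refine ⟨A, f, ?_⟩
  have hinv : A.invariant = H1.mk _ (f.symm.hom.mapZ ⟨c, W, hW, hc, hcc⟩) := by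
    refine AffineBundle.invariant_eq_mk_iff.2 ⟨fun p => (ref p).base, fun p x => σ p x, href,
      fun p τ hτ => ?_, fun p q x hp hq => hσ p q x hp.2 hq.2⟩
    have h1 := (hτ p).1 0
    rw [inf_comm] at h1
    refine HolOn.of_local fun x hx => ⟨_, hx, _, h1, fun y _ => ?_⟩
    congr 1
    change (e p y).symm 0 + σ p y = σ p y
    rw [map_zero, zero_add]
  rw [hinv]
  exact f.mapH1_apply_symm (H1.mk E ⟨c, W, hW, hc, hcc⟩)

open Classical in
/-- The vector of the line `x` whose coordinate with number `i` is one, if there is one. -/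
def normPoint (i : Fin 2) (x : P1) : Punctured x :=
  if h : ∃ z, aff i z = x then ⟨vec i h.choose, vec_ne_zero i _, h.choose_spec⟩ else repPoint x

theorem normPoint_aff (i : Fin 2) (z : ℂ) : normPoint i (aff i z) = affPoint i z := by
  have h : ∃ w, aff i w = aff i z := ⟨z, rfl⟩
  exact (dif_pos h).trans <| Subtype.ext (congrArg (vec i) (aff_injective i h.choose_spec))

theorem locallyTrivial_split (n₁ n₂ : ℤ) : LocallyTrivial 2 (splitBundle n₁ n₂) := by
  intro p
  obtain ⟨i, z, rfl⟩ := exists_aff p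
  refine ⟨chartDomain i, aff_mem_chartDomain i z, fun x =>
    ((evalEquiv n₁ (normPoint i x)).prodCongr (evalEquiv n₂ (normPoint i x))).trans
      (LinearEquiv.finTwoArrow ℂ ℂ).symm, fun V hV s => ?_⟩
  let s₁ : ∀ x, lineFibre n₁ x := fun x => (s x).1
  let s₂ : ∀ x, lineFibre n₂ x := fun x => (s x).2
  have e : ∀ z, (((evalEquiv n₁ (normPoint i (aff i z))).prodCongr
      (evalEquiv n₂ (normPoint i (aff i z)))).trans
      (LinearEquiv.finTwoArrow ℂ ℂ).symm) (s (aff i z)) = ![coord i s₁ z, coord i s₂ z] := by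
    intro z
    rw [normPoint_aff]
    rfl
  constructor
  · intro hs
    refine holOn_of_le hV ?_
    have h1 : DifferentiableOn ℂ (fun z => ![coord i s₁ z, coord i s₂ z]) (aff i ⁻¹' V) := by
      refine differentiableOn_pi.2 fun j => ?_
      fin_cases j
      · exact hs.1 i
      · exact hs.2 i
    exact h1.congr fun z _ => e z
  · intro hs
    have h1 : DifferentiableOn ℂ (fun z => ![coord i s₁ z, coord i s₂ z]) (aff i ⁻¹' V) :=
      (hs i).congr fun z _ => (e z).symm
    exact ⟨mem_sec_of_le (s := s₁) hV (differentiableOn_pi.1 h1 0),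
      mem_sec_of_le (s := s₂) hV (differentiableOn_pi.1 h1 1)⟩

/-! ## Orbit spaces -/

section OrbitSpace

variable {Γ X : Type} [Group Γ] [MulAction Γ X] {S : Set X}

theorem OrbitSpace.mk_eq_mk_iff {x y : X} {hx : x ∈ S} {hy : y ∈ S} :
    OrbitSpace.mk Γ x hx = OrbitSpace.mk Γ y hy ↔ ∃ g : Γ, g • y = x :=
  Quotient.eq (r := (MulAction.orbitRel Γ X).comap (Subtype.val : S → X))

theorem OrbitSpace.mk_surjective (q : OrbitSpace Γ S) : ∃ x hx, OrbitSpace.mk Γ (S := S) x hx = q := by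
  obtain ⟨⟨x, hx⟩, rfl⟩ := Quotient.exists_rep q
  exact ⟨x, hx, rfl⟩

/-- A multivalued invariant with values in orbits which classifies the elements of `T` up to
equivalence identifies the set of equivalence classes with the orbit space. -/
theorem exists_equiv_orbitSpace {T : Type 1} (s : Setoid T) (V : T → X → Prop)
    (hne : ∀ A, ∃ x, V A x) (hS : ∀ A x, V A x → x ∈ S)
    (hV : ∀ A B x y, V A x → V B y → (s A B ↔ ∃ g : Γ, g • y = x))
    (hsurj : ∀ x ∈ S, ∃ A, V A x) :
    ∃ b : Quotient s ≃ OrbitSpace Γ S, ∀ A x, V A x →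
      ∃ h : x ∈ S, b (Quotient.mk s A) = OrbitSpace.mk Γ x h := by
  -- The isomorphism `L(A) → E` is not canonical, so one value is chosen for each object; `hV` makes
  -- the orbit independent of the choice.
  choose v hv using hne
  let F : Quotient s → OrbitSpace Γ S :=
    Quotient.lift (fun A => OrbitSpace.mk Γ (v A) (hS A _ (hv A))) fun A B hAB =>
      OrbitSpace.mk_eq_mk_iff.2 ((hV A B _ _ (hv A) (hv B)).1 hAB)
  have hF : ∀ A x (h : V A x), F (Quotient.mk s A) = OrbitSpace.mk Γ x (hS A x h) := fun A x h =>
    OrbitSpace.mk_eq_mk_iff.2 ((hV A A _ _ (hv A) h).1 (s.refl A))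
  have hbij : Function.Bijective F := by
    constructor
    · intro p q h
      induction p using Quotient.inductionOn with | _ A => ?_
      induction q using Quotient.inductionOn with | _ B => ?_
      exact Quotient.sound ((hV A B _ _ (hv A) (hv B)).2 (OrbitSpace.mk_eq_mk_iff.1 h))
    · intro q
      obtain ⟨x, hx, rfl⟩ := OrbitSpace.mk_surjective q
      obtain ⟨A, hA⟩ := hsurj x hx
      exact ⟨Quotient.mk s A, hF A x hA⟩
  exact ⟨Equiv.ofBijective F hbij, fun A x h => ⟨hS A x h, hF A x h⟩⟩

variable {Γ' X' : Type} [Group Γ'] [MulAction Γ' X'] {S' : Set X'} [TopologicalSpace X]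
  [TopologicalSpace X']

/-- Since `κ` matches orbits, it and its inverse descend to the quotients. The topology of the
moduli space is induced by `b`, so nothing more has to be checked there. -/
theorem exists_homeomorph_inducedBy {M : Type 1} (b : M ≃ OrbitSpace Γ S) (κ : X ≃ₜ X')
    (hS : ∀ x, x ∈ S ↔ κ x ∈ S')
    (hΓ : ∀ x y, (∃ g : Γ, g • y = x) ↔ ∃ g : Γ', g • κ y = κ x) :
    ∃ Φ : ModuliSpace b ≃ₜ OrbitSpace Γ' S', InducedBy b κ Φ := by
  let e : S ≃ₜ S' := κ.subtype hS
  let Ψ : OrbitSpace Γ S ≃ OrbitSpace Γ' S' := Quotient.congr e.toEquiv fun x y => hΓ x.1 y.1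
  have h1 : Continuous Ψ := continuous_quot_lift _ (continuous_quot_mk.comp e.continuous)
  have h2 : Continuous Ψ.symm := continuous_quot_lift _ (continuous_quot_mk.comp e.symm.continuous)
  let Φ : ModuliSpace b ≃ₜ OrbitSpace Γ' S' :=
    { toEquiv := b.trans Ψ
      continuous_toFun := h1.comp continuous_induced_dom
      continuous_invFun := by
        refine continuous_induced_rng.2 ?_
        have : b ∘ (b.trans Ψ).symm = Ψ.symm := funext fun y => b.apply_symm_apply _
        exact this ▸ h2 }
  refine ⟨Φ, fun m x hx hm => ⟨(hS x).1 hx, ?_⟩⟩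
  change Ψ (b m) = _
  rw [hm]
  rfl

end OrbitSpace

/-! ## Classifying maps -/

/-- The classification of affine bundles with linearisation isomorphic to `E`. -/
theorem exists_isClassifyingMap {E : SectionSheaf} (hE : LocallyTrivial 2 E)
    {P : AffineBundle 2 → Prop} {S : Set E.H1} (hP : ∀ A, P A → A.HasLinearisation E)
    (hPS : ∀ (A : AffineBundle 2) (f : A.linearisation.Iso E),
      P A ↔ f.hom.mapH1 A.invariant ∈ S) :
    ∃ b : Moduli P ≃ OrbitSpace E.Aut S, IsClassifyingMap E b := by
  refine (exists_equiv_orbitSpace (Γ := E.Aut) (S := S) (isoSetoid P)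
    (fun A x => ∃ f : A.1.linearisation.Iso E, f.hom.mapH1 A.1.invariant = x) ?_ ?_ ?_ ?_).imp
    fun b hb A hA f => hb ⟨A, hA⟩ _ ⟨f, rfl⟩
  · intro A
    obtain ⟨f⟩ := hP A.1 A.2
    exact ⟨_, f, rfl⟩
  · rintro A _ ⟨f, rfl⟩
    exact (hPS A.1 f).1 A.2
  · rintro A B _ _ ⟨f, rfl⟩ ⟨f', rfl⟩
    constructor
    · rintro ⟨ψ⟩
      -- The automorphism `f ∘ L(ψ)⁻¹ ∘ f'⁻¹` of `E` carries the class of `B` to that of `A`.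
      refine ⟨(f'.symm.trans ψ.symm.linearisation).trans f, ?_⟩
      change ((f'.symm.trans ψ.symm.linearisation).trans f).hom.mapH1 _ = _
      rw [Iso.mapH1_trans, Iso.mapH1_trans, Iso.mapH1_symm_apply, ψ.symm.mapH1_invariant]
    · rintro ⟨g, hg⟩
      change g.hom.mapH1 _ = _ at hg
      -- The isomorphism `f'⁻¹ ∘ g⁻¹ ∘ f : L(A) → L(B)` sends `h_A` to `h_B`, so it is the linear
      -- part of an isomorphism.
      obtain ⟨ψ, -⟩ := AffineBundle.exists_iso_of_mapH1_invariant
        (f.trans ((Iso.symm g).trans f'.symm)) (by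
          rw [Iso.mapH1_trans, Iso.mapH1_trans, ← hg, Iso.mapH1_symm_apply, Iso.mapH1_symm_apply])
      exact ⟨ψ⟩
  · intro x hx
    obtain ⟨A, f, rfl⟩ := exists_affineBundle hE x
    exact ⟨⟨A, (hPS A f).2 hx⟩, f, rfl⟩

/-- The automorphism defined by a non-zero scalar. -/
def SectionSheaf.scalarAut (E : SectionSheaf) (u : ℂˣ) : E.Aut where
  app _ := LinearEquiv.smulOfUnit u
  map_sec U _ := (E.sec U).smul_mem_iff_of_isUnit u.isUnit

/-- Any `f` maps one framed line at `x₀` into the other, so `f ∘ ε` and `ε₀` differ by a non-zero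
scalar, and this scalar is corrected by a scalar automorphism of `E`. -/
theorem exists_matchesFraming {E : SectionSheaf} {D : ∀ x, Submodule ℂ (E.Fib x)}
    (hD : IsMaxDestab E D) {x₀ : P1} (ε₀ : ℂ ≃ₗ[ℂ] maxDestab E x₀) (A : FramedAffineBundle x₀)
    (f : A.bundle.linearisation.Iso E) :
    ∃ f' : A.bundle.linearisation.Iso E, MatchesFraming ε₀ A f' := by
  let w : maxDestab E x₀ := ⟨f.app x₀ (A.framing 1).1, (f.mem_maxDestab_iff hD _).2 (A.framing 1).2⟩
  have hw : ε₀ (ε₀.symm w) = w := ε₀.apply_symm_apply w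
  have hw0 : ε₀.symm w ≠ 0 := by
    intro h
    have h1 : w = 0 := ε₀.symm.map_eq_zero_iff.1 h
    have h2 : (A.framing 1).1 = 0 := (f.app x₀).map_eq_zero_iff.1 (congrArg Subtype.val h1)
    exact one_ne_zero (A.framing.map_eq_zero_iff.1 (Subtype.ext h2))
  refine ⟨f.trans (E.scalarAut (Units.mk0 _ hw0)⁻¹), fun c => ?_⟩
  change ((Units.mk0 _ hw0)⁻¹ : ℂˣ) • f.app x₀ (A.framing c).1 = (ε₀ c).1
  have h1 : f.app x₀ (A.framing c).1 = c • w.1 := by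
    have h : A.framing c = c • A.framing 1 := by rw [← map_smul, smul_eq_mul, mul_one]
    rw [h]
    exact map_smul (f.app x₀) c _
  have h2 : c • w = (Units.mk0 _ hw0) • ε₀ c := by
    have h : ε₀ c = c • ε₀ 1 := by rw [← map_smul, smul_eq_mul, mul_one]
    have h' : w = ε₀.symm w • ε₀ 1 := by rw [← map_smul, smul_eq_mul, mul_one, hw]
    rw [h]
    conv_lhs => rw [h']
    rw [smul_comm]
    rfl
  rw [h1, inv_smul_eq_iff]
  exact congrArg Subtype.val h2

/-- The classification of framed affine bundles with linearisation isomorphic to `E`. -/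
theorem exists_isFramedClassifyingMap {E : SectionSheaf} (hE : LocallyTrivial 2 E)
    {D : ∀ x, Submodule ℂ (E.Fib x)} (hD : IsMaxDestab E D)
    {x₀ : P1} (ε₀ : ℂ ≃ₗ[ℂ] maxDestab E x₀)
    (hAut : ∀ φ : E.Aut, (∀ c, φ.app x₀ (ε₀ c).1 = (ε₀ c).1) → φ ∈ Aut₀ E)
    {P : AffineBundle 2 → Prop} {S : Set E.H1} (hP : ∀ A, P A → A.HasLinearisation E)
    (hPS : ∀ (A : AffineBundle 2) (f : A.linearisation.Iso E),
      P A ↔ f.hom.mapH1 A.invariant ∈ S) :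
    ∃ b : FramedModuli x₀ P ≃ OrbitSpace (Aut₀ E) S, IsFramedClassifyingMap E ε₀ b := by
  have hex : ∀ A : FramedAffineBundle x₀, P A.bundle →
      ∃ f : A.bundle.linearisation.Iso E, MatchesFraming ε₀ A f := by
    intro A hA
    obtain ⟨f⟩ := hP A.bundle hA
    exact exists_matchesFraming hD ε₀ A f
  refine (exists_equiv_orbitSpace (Γ := Aut₀ E) (S := S) (framedIsoSetoid x₀ P)
    (fun A x => ∃ f : A.1.bundle.linearisation.Iso E, MatchesFraming ε₀ A.1 f ∧
      f.hom.mapH1 A.1.bundle.invariant = x) ?_ ?_ ?_ ?_).imp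
    fun b hb A hA => ⟨hex A hA, fun f hf => hb ⟨A, hA⟩ _ ⟨f, hf, rfl⟩⟩
  · intro A
    obtain ⟨f, hf⟩ := hex A.1 A.2
    exact ⟨_, f, hf, rfl⟩
  · rintro A _ ⟨f, -, rfl⟩
    exact (hPS A.1.bundle f).1 A.2
  · rintro A B _ _ ⟨f, hf, rfl⟩ ⟨f', hf', rfl⟩
    constructor
    · rintro ⟨ψ, hψ⟩
      -- As `f`, `f'` and `ψ` all respect the framings, this automorphism fixes `ε₀` at `x₀`; `hAut`
      -- then extends this to the whole subbundle.
      refine ⟨⟨(f'.symm.trans ψ.symm.linearisation).trans f, hAut _ fun c => ?_⟩, ?_⟩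
      · have h1 : (f'.app x₀).symm (ε₀ c).1 = (B.1.framing c).1 :=
          (f'.app x₀).symm_apply_eq.2 (hf' c).symm
        have h2 : (ψ.app x₀).linear.symm (B.1.framing c).1 = (A.1.framing c).1 :=
          (ψ.app x₀).linear.symm_apply_eq.2 (hψ c).symm
        change f.app x₀ ((ψ.app x₀).linear.symm ((f'.app x₀).symm (ε₀ c).1)) = _
        exact ((congrArg (fun v => f.app x₀ ((ψ.app x₀).linear.symm v)) h1).trans
          (congrArg (f.app x₀) h2)).trans (hf c)
      · change ((f'.symm.trans ψ.symm.linearisation).trans f).hom.mapH1 _ = _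
        rw [Iso.mapH1_trans, Iso.mapH1_trans, Iso.mapH1_symm_apply, ψ.symm.mapH1_invariant]
    · rintro ⟨⟨g, hg0⟩, hg⟩
      change g.hom.mapH1 _ = _ at hg
      obtain ⟨ψ, hψ⟩ := AffineBundle.exists_iso_of_mapH1_invariant
        (f.trans ((Iso.symm g).trans f'.symm)) (by
          rw [Iso.mapH1_trans, Iso.mapH1_trans, ← hg, Iso.mapH1_symm_apply, Iso.mapH1_symm_apply])
      refine ⟨ψ, fun c => (hψ x₀ _).trans ?_⟩
      change (f'.app x₀).symm ((g.app x₀).symm (f.app x₀ (A.1.framing c).1)) = _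
      refine (f'.app x₀).symm_apply_eq.2 ((g.app x₀).symm_apply_eq.2 ?_)
      have h1 : f.app x₀ (A.1.framing c).1 = (ε₀ c).1 := hf c
      have h2 : f'.app x₀ (B.1.framing c).1 = (ε₀ c).1 := hf' c
      rw [h1, h2, hg0 x₀ _ (ε₀ c).2]
  · intro x hx
    obtain ⟨A, f, rfl⟩ := exists_affineBundle hE x
    -- The framing of the constructed bundle is `ε₀` pulled back along `f`, so that `f` matches the
    -- framings by construction.
    have hmap : (maxDestab E x₀).map (f.app x₀).symm.toLinearMap = maxDestab A.linearisation x₀ := by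
      ext v
      constructor
      · rintro ⟨w, hw, rfl⟩
        refine (f.mem_maxDestab_iff hD _).1 ?_
        have : f.app x₀ ((f.app x₀).symm w) = w := (f.app x₀).apply_symm_apply w
        exact this.symm ▸ hw
      · intro hv
        exact ⟨f.app x₀ v, (f.mem_maxDestab_iff hD _).2 hv, (f.app x₀).symm_apply_apply v⟩
    exact ⟨⟨⟨A, ε₀.trans ((f.app x₀).symm.ofSubmodules _ _ hmap)⟩, (hPS A f).2 hx⟩, f,
      fun c => (f.app x₀).apply_symm_apply _, rfl⟩

/-! ## The theorem for the split bundle -/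

/-- A linear equivalence between spaces with their finest vector space topologies is a
homeomorphism. -/
theorem exists_continuousLinearEquiv {V W : Type} [AddCommGroup V] [Module ℂ V]
    [TopologicalSpace V] [IsModuleTopology ℂ V] [AddCommGroup W] [Module ℂ W]
    [TopologicalSpace W] [IsModuleTopology ℂ W] (e : V ≃ₗ[ℂ] W) :
    ∃ κ : V ≃L[ℂ] W, ∀ v, κ v = e v := by
  have hV := IsModuleTopology.toContinuousAdd ℂ V
  have hW := IsModuleTopology.toContinuousAdd ℂ W
  have hV' := IsModuleTopology.toContinuousSMul ℂ V
  have hW' := IsModuleTopology.toContinuousSMul ℂ W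
  exact ⟨⟨e, IsModuleTopology.continuous_of_linearMap e.toLinearMap,
    IsModuleTopology.continuous_of_linearMap e.symm.toLinearMap⟩, fun v => rfl⟩

instance (S : SectionSheaf) : IsModuleTopology ℂ S.H1 := ⟨rfl⟩

instance (l d : ℕ) : IsModuleTopology ℂ (DualPairs l d) := ⟨rfl⟩

/-- An equivariant bijection matches the orbits. -/
theorem exists_smul_iff_of_mulEquiv {Γ Γ' X X' : Type} [Group Γ] [MulAction Γ X] [Group Γ']
    [MulAction Γ' X'] (a : Γ ≃* Γ') {κ : X → X'} (hκ : Function.Injective κ)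
    (h : ∀ g x, κ (g • x) = a g • κ x) (x y : X) :
    (∃ g : Γ, g • y = x) ↔ ∃ g : Γ', g • κ y = κ x := by
  constructor
  · rintro ⟨g, rfl⟩
    exact ⟨a g, (h g y).symm⟩
  · rintro ⟨g, hg⟩
    refine ⟨a.symm g, hκ ?_⟩
    rw [h, a.apply_symm_apply, hg]

/-- An equivariant bijection matches the orbits of corresponding subgroups. -/
theorem exists_smul_iff_of_subgroup {Γ Γ' X X' : Type} [Group Γ] [MulAction Γ X] [Group Γ']
    [MulAction Γ' X'] (a : Γ ≃* Γ') {κ : X → X'} (hκ : Function.Injective κ)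
    (h : ∀ g x, κ (g • x) = a g • κ x) {N : Subgroup Γ} {N' : Subgroup Γ'}
    (hN : ∀ g, g ∈ N ↔ a g ∈ N') (x y : X) :
    (∃ g : N, g • y = x) ↔ ∃ g : N', g • κ y = κ x := by
  constructor
  · rintro ⟨⟨g, hg⟩, rfl⟩
    exact ⟨⟨a g, (hN g).1 hg⟩, (h g y).symm⟩
  · rintro ⟨⟨g, hg'⟩, hg⟩
    change g • κ y = κ x at hg
    refine ⟨⟨a.symm g, (hN _).2 (by rwa [a.apply_symm_apply])⟩, hκ ?_⟩
    change κ (a.symm g • y) = κ x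
    rw [h, a.apply_symm_apply, hg]

theorem nonDegenerate_iff {E : SectionSheaf} {D : ∀ x, Submodule ℂ (E.Fib x)}
    (hD : IsMaxDestab E D) (A : AffineBundle 2) (f : A.linearisation.Iso E) :
    A.HasLinearisation E ∧ A.NonDegenerate ↔ f.hom.mapH1 A.invariant ∈ H1₀ E :=
  ⟨fun h => (f.mem_H1₀_iff hD _).2 h.2, fun h => ⟨⟨f⟩, (f.mem_H1₀_iff hD _).1 h⟩⟩

end AffineP1

end

theorem mainTheorem7 (n₁ n₂ : ℤ) (h₁ : n₁ < -2) (h₂ : n₂ < n₁) (l₁ d : ℕ)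
    (hl₁ : (l₁ : ℤ) = -2 - n₁) (hd : (d : ℤ) = (-2 - n₂) - (-2 - n₁)) :
    ∃ (κ : (AffineP1.splitBundle n₁ n₂).H1 ≃L[ℂ] AffineP1.DualPairs l₁ d)
      (a : (AffineP1.splitBundle n₁ n₂).Aut ≃* AffineP1.G d),
      -- the identifications of the groups, of the cohomology spaces, and of the actions
      (∀ φ, AffineP1.IsGivenBy φ (a φ)) ∧
      (∀ φ, φ ∈ AffineP1.Aut₀ (AffineP1.splitBundle n₁ n₂) ↔ a φ ∈ AffineP1.G₀ d) ∧
      (∀ φ h, κ (φ • h) = a φ • κ h) ∧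
      (∀ h, h ∈ AffineP1.H1₀ (AffineP1.splitBundle n₁ n₂) ↔ κ h ∈ AffineP1.DualPairs₀ l₁ d) ∧
      -- affine bundles
      (∃ b : AffineP1.Moduli (fun A => A.HasLinearisation (AffineP1.splitBundle n₁ n₂)) ≃
          AffineP1.OrbitSpace (AffineP1.splitBundle n₁ n₂).Aut Set.univ,
        AffineP1.IsClassifyingMap (AffineP1.splitBundle n₁ n₂) b ∧
        ∃ Φ : AffineP1.ModuliSpace b ≃ₜ
            AffineP1.OrbitSpace (AffineP1.G d) (Set.univ : Set (AffineP1.DualPairs l₁ d)),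
          AffineP1.InducedBy b κ Φ) ∧
      -- non-degenerate affine bundles
      (∃ b : AffineP1.Moduli (fun A => A.HasLinearisation (AffineP1.splitBundle n₁ n₂) ∧
            A.NonDegenerate) ≃
          AffineP1.OrbitSpace (AffineP1.splitBundle n₁ n₂).Aut
            (AffineP1.H1₀ (AffineP1.splitBundle n₁ n₂)),
        AffineP1.IsClassifyingMap (AffineP1.splitBundle n₁ n₂) b ∧
        ∃ Φ : AffineP1.ModuliSpace b ≃ₜ
            AffineP1.OrbitSpace (AffineP1.G d) (AffineP1.DualPairs₀ l₁ d),
          AffineP1.InducedBy b κ Φ) ∧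
      -- framed affine bundles, for every point and every reference framing
      (∀ (x₀ : AffineP1.P1)
          (ε₀ : ℂ ≃ₗ[ℂ] AffineP1.maxDestab (AffineP1.splitBundle n₁ n₂) x₀),
        (∃ b : AffineP1.FramedModuli x₀
              (fun A => A.HasLinearisation (AffineP1.splitBundle n₁ n₂)) ≃
            AffineP1.OrbitSpace (AffineP1.Aut₀ (AffineP1.splitBundle n₁ n₂)) Set.univ,
          AffineP1.IsFramedClassifyingMap (AffineP1.splitBundle n₁ n₂) ε₀ b ∧
          ∃ Φ : AffineP1.ModuliSpace b ≃ₜ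
              AffineP1.OrbitSpace (AffineP1.G₀ d) (Set.univ : Set (AffineP1.DualPairs l₁ d)),
            AffineP1.InducedBy b κ Φ) ∧
        -- framed non-degenerate affine bundles
        (∃ b : AffineP1.FramedModuli x₀
              (fun A => A.HasLinearisation (AffineP1.splitBundle n₁ n₂) ∧ A.NonDegenerate) ≃
            AffineP1.OrbitSpace (AffineP1.Aut₀ (AffineP1.splitBundle n₁ n₂))
              (AffineP1.H1₀ (AffineP1.splitBundle n₁ n₂)),
          AffineP1.IsFramedClassifyingMap (AffineP1.splitBundle n₁ n₂) ε₀ b ∧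
          ∃ Φ : AffineP1.ModuliSpace b ≃ₜ
              AffineP1.OrbitSpace (AffineP1.G₀ d) (AffineP1.DualPairs₀ l₁ d),
            AffineP1.InducedBy b κ Φ)) := by
  -- Here `d = l₂ - l₁ = n₁ - n₂`, so forms of degree `d` are the morphisms `𝒪(n₂) → 𝒪(n₁)`, and
  -- `l₂` appears as `l₁ + d`.
  have h : n₁ = n₂ + d := by lia
  have hn₁ : n₁ = -2 - l₁ := by lia
  have hn₂ : n₂ = -2 - (l₁ + d : ℕ) := by push_cast; lia
  obtain ⟨κ, hκ⟩ := AffineP1.exists_continuousLinearEquiv (AffineP1.dualPairsEquiv hn₁ hn₂)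
  let a := AffineP1.autEquiv h₂ h
  have hE := AffineP1.locallyTrivial_split n₁ n₂
  have hD := AffineP1.isMaxDestab_split h₂
  have ha : ∀ φ, AffineP1.matrixAut h (a φ) = φ := AffineP1.matrixAut_autEquiv h₂ h
  have haκ : ∀ φ c, κ (φ • c) = a φ • κ c := by
    intro φ c
    rw [hκ, hκ, ← AffineP1.dualPairsEquiv_smul hn₁ hn₂ h, ha]
  have hmem : ∀ c, c ∈ AffineP1.H1₀ (AffineP1.splitBundle n₁ n₂) ↔
      κ c ∈ AffineP1.DualPairs₀ l₁ d := by
    intro c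
    rw [hκ]
    exact AffineP1.dualPairsEquiv_mem_iff hn₁ hn₂ h₂ c
  have hAut₀ : ∀ φ, φ ∈ AffineP1.Aut₀ (AffineP1.splitBundle n₁ n₂) ↔ a φ ∈ AffineP1.G₀ d := by
    intro φ
    obtain ⟨v, hv, hv0⟩ := AffineP1.exists_mem_maxDestab h₂ (AffineP1.aff 0 0)
    have := (AffineP1.matrixAut_mem_Aut₀_iff h₂ h (a φ) hv hv0).1
    rwa [ha] at this
  have hlin (A : AffineP1.AffineBundle 2)
      (f : A.linearisation.Iso (AffineP1.splitBundle n₁ n₂)) :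
      A.HasLinearisation (AffineP1.splitBundle n₁ n₂) ↔ f.hom.mapH1 A.invariant ∈ Set.univ :=
    ⟨fun _ => Set.mem_univ _, fun _ => ⟨f⟩⟩
  have huniv : ∀ c, c ∈ (Set.univ : Set (AffineP1.splitBundle n₁ n₂).H1) ↔
      κ c ∈ (Set.univ : Set (AffineP1.DualPairs l₁ d)) := fun c => Iff.rfl
  have horb := AffineP1.exists_smul_iff_of_mulEquiv a κ.injective haκ
  have horb₀ := AffineP1.exists_smul_iff_of_subgroup a κ.injective haκ hAut₀
  refine ⟨κ, a, fun φ => ?_, hAut₀, haκ, hmem, ?_, ?_, fun x₀ ε₀ => ?_⟩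
  · have := AffineP1.isGivenBy_matrixAut h (a φ)
    rwa [ha] at this
  · obtain ⟨b, hb⟩ := AffineP1.exists_isClassifyingMap hE (fun A hA => hA) hlin
    exact ⟨b, hb, AffineP1.exists_homeomorph_inducedBy b κ.toHomeomorph huniv horb⟩
  · obtain ⟨b, hb⟩ := AffineP1.exists_isClassifyingMap hE (fun A hA => hA.1)
      (AffineP1.nonDegenerate_iff hD)
    exact ⟨b, hb, AffineP1.exists_homeomorph_inducedBy b κ.toHomeomorph hmem horb⟩
  · have hfix : ∀ φ : (AffineP1.splitBundle n₁ n₂).Aut,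
        (∀ c, φ.app x₀ (ε₀ c).1 = (ε₀ c).1) → φ ∈ AffineP1.Aut₀ (AffineP1.splitBundle n₁ n₂) := by
      intro φ hφ
      have hv0 : (ε₀ 1).1 ≠ 0 := fun h0 =>
        one_ne_zero (ε₀.map_eq_zero_iff.1 (Subtype.ext h0))
      have := AffineP1.matrixAut_mem_Aut₀_iff h₂ h (a φ) (ε₀ 1).2 hv0
      rw [ha] at this
      exact this.1.2 (this.2.1 (hφ 1))
    constructor
    · obtain ⟨b, hb⟩ := AffineP1.exists_isFramedClassifyingMap hE hD ε₀ hfix (fun A hA => hA) hlin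
      exact ⟨b, hb, AffineP1.exists_homeomorph_inducedBy b κ.toHomeomorph huniv horb₀⟩
    · obtain ⟨b, hb⟩ := AffineP1.exists_isFramedClassifyingMap hE hD ε₀ hfix (fun A hA => hA.1)
        (AffineP1.nonDegenerate_iff hD)
      exact ⟨b, hb, AffineP1.exists_homeomorph_inducedBy b κ.toHomeomorph hmem horb₀⟩
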